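/- Let $\zeta_0,\zeta_1,\dots$ be i.i.d. standard complex Gaussian random variables on a probability space (real and imaginary parts independent, each $N(0,\tfrac12)$). Let $f_0(z)=\sum_{k\ge0}\zeta_k z^k/\sqrt{k!}$ be the Gaussian entire function and, for $n\ge 0$, $$f_n(z,\bar z)=\frac1{\sqrt{n!}}(\partial_z-\bar z)^n f_0(z),\qquad X_n(z)=e^{-|z|^2/2}f_n(z,\bar z),\qquad S_N(z)=\frac1N\sum_{n=0}^{N-1}|X_n(z)|^2 .$$ For $z_0\in\mathbb C$ and $N\ge1$ put $$\mathcal G_N^{(z_0)}(\xi)=\sqrt N\,\bigl(S_N(z_0+\sqrt N\,\xi)-1\bigr),\qquad \xi\in\mathbb C .$$ For $r\ge 0$ let $\kappa(r)=|B(0,1)\cap B(r,1)|/\pi$ be the normalized overlap area of two unit disks in $\mathbb C$ with centers $0$ and $r$. Theorem. Fix $z_0\in\mathbb C$ and a compact set $K\subset\mathbb C$. (i) $\kappa(r)=\frac2\pi\arccos\frac r2-\frac r\pi\sqrt{1-\frac{r^2}4}$ for $0\le r\le2$, and $\kappa(r)=0$ for $r\ge2$. (ii) There exists a centered real Gaussian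 process $\mathcal G=\{\mathcal G(\xi)\}_{\xi\in\mathbb C}$ with covariance $\mathbb E[\mathcal G(\xi)\mathcal G(\eta)]=\kappa(|\xi-\eta|)$. For every $0<\alpha<\frac12$, every such process has a version whose restrictions to $K$ have all sample paths in $C^{0,\alpha}(K)$. (iii) Almost surely all the fields $\mathcal G_N^{(z_0)}$, $N\ge1$, have continuous sample paths, and, as $N\to\infty$, $\mathcal G_N^{(z_0)}$ converges in distribution in $C(K)$ to $\mathcal G$, where $\mathcal G$ is realized as a $C(K)$-valued random variable through any version with continuous sample paths on $K$. (iv) For every $0<\alpha<\frac12$, almost surely the restrictions to $K$ of all the fields $\mathcal G_N^{(z_0)}$, $N\ge1$, lie in $C^{0,\alpha}(K)$; they are (after modification on a null set) Borel random elements of $C^{0,\alpha}(K)$, and the family of their laws is tight in $C^{0,\alpha}(K)$. Here $C^{0,\alpha}(K)$ is the space of $\alpha$-Hölder functions on $K$ with norm $\sup_K|u|+\sup_{z\ne w}|u(z)-u(w)|/|z-w|^\alpha$. -/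

import Mathlib

open MeasureTheory ProbabilityTheory Filter
open scoped NNReal

noncomputable section

namespace LandauCLT

/-! ### Complex Gaussian variables and the fields `f_n` -/

/-- The standard complex Gaussian law `N_ℂ(0,1)`: real and imaginary part are independent
real Gaussians of mean `0` and variance `1/2`. -/
def stdComplexGaussian : Measure ℂ :=
  ((gaussianReal 0 (1 / 2)).prod (gaussianReal 0 (1 / 2))).map Complex.measurableEquivRealProd.symm

/-- The Wirtinger derivative `∂_z g = (∂_x g - i ∂_y g) / 2` of a function `g : ℂ → ℂ`. -/
def wirtingerDz (g : ℂ → ℂ) (z : ℂ) : ℂ :=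
  (fderiv ℝ g z 1 - Complex.I * fderiv ℝ g z Complex.I) / 2

/-- The Landau raising operator `g ↦ ∂_z g - \bar z g`. -/
def raising (g : ℂ → ℂ) (z : ℂ) : ℂ :=
  wirtingerDz g z - (starRingEnd ℂ) z * g z

/-- The power series `∑ a_k z^k / √(k!)`. With `a_k` i.i.d. standard complex Gaussian it is the
Gaussian entire function. -/
def entireSeries (a : ℕ → ℂ) (z : ℂ) : ℂ :=
  ∑' k : ℕ, a k * (z ^ k / (Real.sqrt (k.factorial : ℝ) : ℂ))

/-- The functions `f_n = (n!)^{-1/2} (∂_z - \bar z)^n f_0`, for the coefficient sequence `a`. -/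
def landauFun (a : ℕ → ℂ) (n : ℕ) (z : ℂ) : ℂ :=
  (Real.sqrt (n.factorial : ℝ) : ℂ)⁻¹ * (raising^[n] (entireSeries a)) z

/-- The normalized functions `X_n(z) = e^{-|z|²/2} f_n(z)`. -/
def normalizedFun (a : ℕ → ℂ) (n : ℕ) (z : ℂ) : ℂ :=
  (Real.exp (-‖z‖ ^ 2 / 2) : ℂ) * landauFun a n z

/-- The averaged field `S_N(z) = N⁻¹ ∑_{n < N} |X_n(z)|²`. -/
def averagedField (a : ℕ → ℂ) (N : ℕ) (z : ℂ) : ℝ :=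
  (1 / (N : ℝ)) * ∑ n ∈ Finset.range N, ‖normalizedFun a n z‖ ^ 2

/-- The rescaled fluctuation field `ξ ↦ √N (S_N(z₀ + √N ξ) - 1)`. -/
def fluctuation (a : ℕ → ℂ) (z₀ : ℂ) (N : ℕ) (ξ : ℂ) : ℝ :=
  Real.sqrt N * (averagedField a N (z₀ + (Real.sqrt N : ℂ) * ξ) - 1)

/-! ### The limit field -/

/-- The normalized overlap area `|B(0,1) ∩ B(r,1)| / π` of two unit disks with centers at
distance `r`. -/
def overlapKernel (r : ℝ) : ℝ :=
  (volume (Metric.ball (0 : ℂ) 1 ∩ Metric.ball (r : ℂ) 1)).toReal / Real.pi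

/-- `G` is a centered real Gaussian process on `ℂ` with covariance `κ(|ξ - η|)`. -/
structure IsOverlapField {Ω : Type*} [MeasurableSpace Ω] (G : ℂ → Ω → ℝ) (P : Measure Ω) :
    Prop where
  isGaussianProcess : IsGaussianProcess G P
  centered : ∀ ξ : ℂ, ∫ ω, G ξ ω ∂P = 0
  covariance : ∀ ξ η : ℂ, ∫ ω, G ξ ω * G η ω ∂P = overlapKernel ‖ξ - η‖

/-! ### The path spaces `C(X)` and `C^{0,α}(X)` -/

/-- `C(X)` carries its Borel `σ`-algebra. -/
instance instMeasurableSpaceContinuousMap (X : Type*) [TopologicalSpace X] :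
    MeasurableSpace C(X, ℝ) := borel _

instance instBorelSpaceContinuousMap (X : Type*) [TopologicalSpace X] :
    BorelSpace C(X, ℝ) := ⟨rfl⟩

section Holder

variable (X : Type*) [MetricSpace X]

/-- The `α`-Hölder functions, as an additive subgroup of `C(X)`. -/
def holderSubgroup (α : ℝ≥0) : AddSubgroup C(X, ℝ) where
  carrier := {f | MemHolder α f}
  zero_mem' := memHolder_zero
  add_mem' hf hg := MemHolder.add hf hg
  neg_mem' {f} hf := by
    have h : MemHolder α ((-1 : ℝ) • (f : X → ℝ)) := MemHolder.smul hf
    have e : ((-1 : ℝ) • (f : X → ℝ)) = ((-f : C(X, ℝ)) : X → ℝ) := by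
      ext x; simp
    rw [e] at h
    exact h

/-- The Hölder space `C^{0,α}(X)`. It is a separate type, so that it does not inherit the
topology of `C(X)`; its norm is given below. -/
def HolderSpace (α : ℝ≥0) : Type _ := holderSubgroup X α

variable {X} {α : ℝ≥0}

instance : AddCommGroup (HolderSpace X α) :=
  inferInstanceAs (AddCommGroup (holderSubgroup X α))

/-- The inclusion of `C^{0,α}(X)` into `C(X)`. -/
def HolderSpace.toContinuousMap (f : HolderSpace X α) : C(X, ℝ) := f.1

/-- The norm `‖f‖ = sup |f| + [f]_α` on `C^{0,α}(X)`, where `[f]_α` is the best Hölder constant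
of `f`. -/
instance [CompactSpace X] : NormedAddCommGroup (HolderSpace X α) :=
  AddGroupNorm.toNormedAddCommGroup
    { toFun := fun f => ‖f.toContinuousMap‖ + (nnHolderNorm α f.toContinuousMap : ℝ)
      map_zero' := by
        have h0 : (0 : HolderSpace X α).toContinuousMap = 0 := rfl
        simp [h0]
      add_le' := fun f g => by
        have h : (f + g).toContinuousMap = f.toContinuousMap + g.toContinuousMap := rfl
        have h1 := norm_add_le f.toContinuousMap g.toContinuousMap
        have h2 : (nnHolderNorm α (f.toContinuousMap + g.toContinuousMap : X → ℝ) : ℝ) ≤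
            nnHolderNorm α f.toContinuousMap + nnHolderNorm α g.toContinuousMap := by
          exact_mod_cast MemHolder.nnHolderNorm_add_le f.2 g.2
        rw [h, ContinuousMap.coe_add]
        linarith
      neg' := fun f => by
        have h : (-f).toContinuousMap = -f.toContinuousMap := rfl
        have h1 := MemHolder.nnHolderNorm_smul (r := α) (f := f.toContinuousMap) f.2 (-1 : ℝ)
        have e : ((-1 : ℝ) • (f.toContinuousMap : X → ℝ)) = -(f.toContinuousMap : X → ℝ) := by
          ext x; simp
        rw [e] at h1
        rw [h, ContinuousMap.coe_neg, h1]
        simp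
      eq_zero_of_map_eq_zero' := fun f hf => by
        have h1 : ‖f.toContinuousMap‖ = 0 :=
          le_antisymm (by
            have := (nnHolderNorm α f.toContinuousMap).coe_nonneg
            linarith) (norm_nonneg _)
        exact Subtype.ext (norm_eq_zero.mp h1) }

/-- `C^{0,α}(X)` carries its Borel `σ`-algebra. -/
instance [CompactSpace X] : MeasurableSpace (HolderSpace X α) := borel _

instance [CompactSpace X] : BorelSpace (HolderSpace X α) := ⟨rfl⟩

end Holder

open Classical in
/-- The restriction of `g` to `K` as an element of `C(K)`; set to `0` if it is not continuous. -/
def continuousPath (K : TopologicalSpace.Compacts ℂ) (g : ℂ → ℝ) : C(K, ℝ) :=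
  if h : Continuous (fun x : K => g x) then ⟨fun x : K => g x, h⟩ else 0

open Classical in
/-- The restriction of `g` to `K` as an element of `C^{0,α}(K)`; set to `0` if it does not belong
to that space. -/
def holderPath (K : TopologicalSpace.Compacts ℂ) (α : ℝ≥0) (g : ℂ → ℝ) : HolderSpace K α :=
  if h : Continuous (fun x : K => g x) ∧ MemHolder α (fun x : K => g x) then
    ⟨⟨fun x : K => g x, h.1⟩, h.2⟩
  else 0

end LandauCLT

end

noncomputable section

namespace LandauCLT

section

open scoped ComplexConjugate Topology Nat

/-! ### Complex Hermite polynomials -/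

/-! Almost surely the coefficients grow at most geometrically, and then X_n(z) = ∑_k ζ_k D_{nk}(z),
where D_{nk} are the matrix elements of the displacement (Weyl) operators in the number basis. These
matrices compose up to a phase, as `hasSum_displacement_mul` records: ∑_k D_{nk}(z) conj(D_{mk}(w))
= e^{i Im(z \bar w)} conj(D_{mn}(w - z)). So a linear combination ∑ c_j 𝒢_N(ξ_j) is a centered
Hermitian quadratic form in independent Gaussians, with variance ∑ c_i c_j κ_N(|ξ_i - ξ_j|), where
κ_N(r) = N⁻¹ ∑_{n,k<N} |D_{nk}(√N r)|². Neither the phase nor z₀ enters the variance.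

Kernel limit (`tendsto_prelimitKernel`). Pick n uniformly below N, then k with probabilities
|D_{nk}(√N r)|²; κ_N(r) is the probability that k/N < 1. By rotation covariance and the composition
law, the characteristic function of k/N is an average of diagonal elements, that is of Laguerre
polynomials. Mehler–Heine asymptotics turn these into Bessel functions, and the limit is the
characteristic function of |U - r|² for U uniform in the unit disk. The event |U - r| < 1 has
probability κ(r).

Gaussian limit (`norm_integral_exp_seriesForm_sub_le`, `tendsto_integral_exp_sum_fluctuation`). For
fixed z the rows of D are orthonormal, so the quadratic form has operator norm at most ∑|c_j|/√N.
After diagonalization its characteristic function is a product of factors e^{-iλ}/(1 - iλ), each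
within 2|λ|³ of e^{-λ²/2}. The total error is at most twice the operator norm times the variance,
hence tends to 0.

Regularity. Differentiating along the real axis telescopes the sum defining κ_N and gives 1 - κ_N(r)
≤ 2r uniformly in N (`one_sub_prelimitKernel_le`). Exponential moments of quadratic forms then yield
E|𝒢_N(ξ) - 𝒢_N(η)|^{2p} ≤ C_p |ξ - η|^p for every p. Dyadic chaining puts the paths, with
probability close to 1 uniformly in N, in a fixed β-Hölder ball for any β < 1/2
(`exists_holderBall_compl_le`). Such balls are compact in C(K) by Arzelà–Ascoli, and in C^{0,α}(K)
for α < β by interpolation. Tightness and convergence of the characteristic functions of finite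
linear combinations give convergence in law.

The limit field is an isonormal process on L²(ℂ), evaluated at normalized indicators of unit disks,
whose inner products are the values of κ. The bound 1 - κ(r) ≤ 2r passes to the limit, so the same
chaining gives its Hölder versions. The closed form of κ is the area of a lens, computed by
integration. -/

/-- The complex Hermite polynomials `(∂_z - \bar z)^n z^k`. -/
def complexHermite : ℕ → ℕ → ℂ → ℂ
  | 0, k, z => z ^ k
  | n + 1, k, z => k * complexHermite n (k - 1) z - conj z * complexHermite n k z

lemma complexHermite_zero (k : ℕ) (z : ℂ) : complexHermite 0 k z = z ^ k := rfl

lemma complexHermite_succ_left (n k : ℕ) (z : ℂ) :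
    complexHermite (n + 1) k z = k * complexHermite n (k - 1) z - conj z * complexHermite n k z :=
  rfl

lemma complexHermite_zero_right (n : ℕ) (z : ℂ) : complexHermite n 0 z = (-conj z) ^ n := by
  induction n with
  | zero => simp [complexHermite]
  | succ n ih => rw [complexHermite_succ_left, ih]; push_cast; ring

/-- The commutator of ∂_z - \bar z with multiplication by z is 1, so moving z out past n copies of
the operator costs n terms with one copy fewer. -/
lemma complexHermite_succ_right (n k : ℕ) (z : ℂ) :
    complexHermite n (k + 1) z =
      z * complexHermite n k z + n * complexHermite (n - 1) k z := by
  induction n generalizing k with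
  | zero => simp [complexHermite, pow_succ]; ring
  | succ n ih =>
    rw [complexHermite_succ_left, ih k, complexHermite_succ_left n k z]
    simp only [Nat.add_sub_cancel]
    cases k with
    | zero =>
      cases n with
      | zero => simp [complexHermite]; ring
      | succ n =>
        simp only [complexHermite_zero_right, Nat.add_sub_cancel]
        push_cast; ring
    | succ k =>
      cases n with
      | zero => simp [complexHermite]; ring
      | succ n =>
        have h1 := ih k
        have h2 := complexHermite_succ_left n (k + 1) z
        simp only [Nat.add_sub_cancel] at h1 h2 ⊢
        push_cast at h1 h2 ⊢
        linear_combination ((k : ℂ) + 1) * h1 - ((n : ℂ) + 1) * h2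

lemma norm_complexHermite_le {R : ℝ} (hR : 1 ≤ R) {z : ℂ} (hz : ‖z‖ ≤ R) (n k : ℕ) :
    ‖complexHermite n k z‖ ≤ (k + R) ^ n * R ^ k := by
  have hR0 : 0 ≤ R := by linarith
  induction n generalizing k with
  | zero => simp only [complexHermite_zero, norm_pow, pow_zero, one_mul]; gcongr
  | succ n ih =>
    rw [complexHermite_succ_left]
    refine (norm_sub_le _ _).trans ?_
    rw [norm_mul, norm_mul, Complex.norm_natCast, RCLike.norm_conj]
    have h1 : (k : ℝ) * ‖complexHermite n (k - 1) z‖ ≤ k * ((k + R) ^ n * R ^ k) := by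
      refine mul_le_mul_of_nonneg_left ((ih (k - 1)).trans ?_) (by positivity)
      have : ((k - 1 : ℕ) : ℝ) ≤ k := by exact_mod_cast Nat.sub_le k 1
      gcongr
      exact Nat.sub_le k 1
    have h2 : ‖z‖ * ‖complexHermite n k z‖ ≤ R * ((k + R) ^ n * R ^ k) := by
      gcongr; exact ih k
    calc _ ≤ _ := add_le_add h1 h2
      _ = _ := by ring

/-- The polynomial factor (k + S)^n is at most n! e^{k+S}, and a further factor k is at most 2^k.
Both the polynomials and their z-derivatives thus grow geometrically in k, uniformly on disks. -/
lemma exists_norm_complexHermite_le (R : ℝ) (n : ℕ) :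
    ∃ C D : ℝ, 0 ≤ C ∧ 0 ≤ D ∧ ∀ (k : ℕ) (z : ℂ), ‖z‖ ≤ R →
      ‖complexHermite n k z‖ ≤ C * D ^ k ∧ k * ‖complexHermite n (k - 1) z‖ ≤ C * D ^ k := by
  set S : ℝ := max R 1 with hS
  have hS1 : 1 ≤ S := le_max_right _ _
  have key : ∀ (k : ℕ) (z : ℂ), ‖z‖ ≤ R →
      ‖complexHermite n k z‖ ≤ (n ! * Real.exp S) * (Real.exp 1 * S) ^ k := by
    intro k z hz
    refine (norm_complexHermite_le hS1 (hz.trans (le_max_left _ _)) n k).trans ?_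
    have h := Real.pow_div_factorial_le_exp (x := (k : ℝ) + S) (by positivity) n
    rw [div_le_iff₀ (by positivity), Real.exp_add] at h
    have h2 : Real.exp (k : ℝ) = Real.exp 1 ^ k := by rw [← Real.exp_nat_mul, mul_one]
    rw [mul_pow, ← h2]
    calc (k + S) ^ n * S ^ k ≤ (Real.exp k * Real.exp S * n !) * S ^ k := by gcongr
      _ = _ := by ring
  have hE : 1 ≤ Real.exp 1 * S := by
    have : 1 ≤ Real.exp 1 := Real.one_le_exp (by norm_num)
    nlinarith
  refine ⟨n ! * Real.exp S, 2 * (Real.exp 1 * S), by positivity, by positivity, fun k z hz => ?_⟩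
  have h1 := key k z hz
  have h2 := key (k - 1) z hz
  have h3 : (k : ℝ) ≤ 2 ^ k := by exact_mod_cast (Nat.lt_two_pow_self (n := k)).le
  rw [mul_pow]
  constructor
  · refine h1.trans ?_
    have : (1 : ℝ) ≤ 2 ^ k := one_le_pow₀ (by norm_num)
    gcongr
    exact le_mul_of_one_le_left (by positivity) this
  · have h4 : (Real.exp 1 * S) ^ (k - 1) ≤ (Real.exp 1 * S) ^ k :=
      pow_le_pow_right₀ hE (Nat.sub_le k 1)
    calc (k : ℝ) * ‖complexHermite n (k - 1) z‖
        ≤ 2 ^ k * ((n ! * Real.exp S) * (Real.exp 1 * S) ^ k) := by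
          gcongr; exact h2.trans (by gcongr)
      _ = _ := by ring

/-- With x = |B|^k/√(k!), the weighted AM–GM inequality x ≤ ½ 2^{-k} + 2^k x² splits the series into
a geometric one and the exponential series of 2B². -/
lemma summable_pow_div_sqrt_factorial (B : ℝ) :
    Summable fun k : ℕ => B ^ k / Real.sqrt (k ! : ℝ) := by
  have h1 : Summable fun k : ℕ => (1 / 2 : ℝ) ^ k := summable_geometric_two
  have h2 : Summable fun k : ℕ => (1 / 2 * (1 / 2) ^ k + (2 * B ^ 2) ^ k / (k ! : ℝ) : ℝ) :=
    (h1.mul_left _).add (Real.summable_pow_div_factorial (2 * B ^ 2))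
  refine Summable.of_norm_bounded h2 fun k => ?_
  set s := Real.sqrt (k ! : ℝ) with hs
  have hs0 : 0 < s := Real.sqrt_pos.2 (by positivity)
  have hs2 : (k ! : ℝ) = s ^ 2 := (Real.sq_sqrt (by positivity)).symm
  rw [hs2, norm_div, norm_pow, Real.norm_eq_abs, Real.norm_eq_abs, abs_of_pos hs0]
  have e : (2 * B ^ 2) ^ k / s ^ 2 = 2 ^ k * (|B| ^ k / s) ^ 2 := by
    rw [← sq_abs B, div_pow, mul_pow]; ring
  rw [e]
  set x := |B| ^ k / s
  have hp : (0 : ℝ) < 2 ^ k := by positivity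
  have e2 : (1 / 2 : ℝ) ^ k = (2 ^ k)⁻¹ := by rw [one_div, inv_pow]
  rw [e2]
  set y : ℝ := 2 ^ k
  have : 0 ≤ y⁻¹ * ((y * x - 1/2) ^ 2 + 1/4) := by positivity
  have e3 : y⁻¹ * ((y * x - 1/2) ^ 2 + 1/4) = 1/2 * y⁻¹ + y * x ^ 2 - x := by
    field_simp; ring
  linarith

/-! ### Termwise differentiation of series with geometrically growing coefficients -/

/-- A coefficient sequence of at most exponential growth. -/
def Tempered (a : ℕ → ℂ) : Prop := ∃ C : ℝ, 0 ≤ C ∧ ∀ k, ‖a k‖ ≤ C * 2 ^ k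

lemma sqrt_factorial_ne_zero (k : ℕ) : (Real.sqrt (k ! : ℝ) : ℂ) ≠ 0 := by
  rw [Complex.ofReal_ne_zero]; positivity

lemma sqrt_factorial_sq (k : ℕ) : (Real.sqrt (k ! : ℝ) : ℂ) ^ 2 = (k ! : ℂ) := by
  rw [← Complex.ofReal_pow, Real.sq_sqrt (by positivity)]; simp

/-- The real-linear map `h ↦ p h + q \bar h`. -/
def wirtingerCLM (p q : ℂ) : ℂ →L[ℝ] ℂ :=
  p • ContinuousLinearMap.id ℝ ℂ + q • (Complex.conjCLE : ℂ →L[ℝ] ℂ)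

lemma wirtingerCLM_apply (p q h : ℂ) : wirtingerCLM p q h = p * h + q * conj h := by
  simp [wirtingerCLM]

lemma norm_wirtingerCLM_le (p q : ℂ) : ‖wirtingerCLM p q‖ ≤ ‖p‖ + ‖q‖ := by
  refine ContinuousLinearMap.opNorm_le_bound _ (by positivity) fun h => ?_
  rw [wirtingerCLM_apply]
  refine (norm_add_le _ _).trans (le_of_eq ?_)
  rw [norm_mul, norm_mul, RCLike.norm_conj]; ring

lemma continuous_wirtingerCLM {X : Type*} [TopologicalSpace X] {p q : X → ℂ}
    (hp : Continuous p) (hq : Continuous q) : Continuous fun x => wirtingerCLM (p x) (q x) := by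
  unfold wirtingerCLM; fun_prop

lemma HasFDerivAt.wirtingerDz_eq {g : ℂ → ℂ} {z p q : ℂ} (h : HasFDerivAt g (wirtingerCLM p q) z) :
    wirtingerDz g z = p := by
  rw [wirtingerDz, h.fderiv, wirtingerCLM_apply, wirtingerCLM_apply]
  simp only [map_one, Complex.conj_I]
  linear_combination (q / 2 - p / 2) * Complex.I_mul_I

/-- ∂_z commutes with ∂_z - \bar z, so it acts on z^k and lowers k; the commutator of ∂_{\bar z}
with it is -1, so ∂_{\bar z} lowers n. -/
lemma hasFDerivAt_complexHermite (n k : ℕ) (z : ℂ) :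
    HasFDerivAt (complexHermite n k)
      (wirtingerCLM (k * complexHermite n (k - 1) z) (-(n * complexHermite (n - 1) k z))) z := by
  induction n generalizing k with
  | zero =>
    have h : HasFDerivAt (fun z : ℂ => z ^ k) _ z :=
      ((hasDerivAt_pow k z).hasFDerivAt).restrictScalars ℝ
    convert! h using 1
    ext v; simp [wirtingerCLM_apply, complexHermite]; ring
  | succ n ih =>
    have h1 := (ih (k - 1)).const_mul (k : ℂ)
    have h2 : HasFDerivAt (fun w : ℂ => conj w) (Complex.conjCLE : ℂ →L[ℝ] ℂ) z :=
      Complex.conjCLE.hasFDerivAt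
    have h3 := h1.sub (h2.mul (ih k))
    convert! h3 using 1
    ext v
    simp only [wirtingerCLM_apply, sub_apply, add_apply, smul_apply, smul_eq_mul, ContinuousLinearEquiv.coe_coe,
      Complex.conjCLE_apply, Nat.add_sub_cancel]
    cases k with
    | zero =>
      cases n with
      | zero => simp [complexHermite]
      | succ n =>
        simp [complexHermite_zero_right]; ring
    | succ k =>
      rw [complexHermite_succ_left n (k + 1 - 1)]
      cases n with
      | zero => simp [complexHermite]; ring
      | succ n =>
        simp only [Nat.add_sub_cancel]
        rw [complexHermite_succ_left n (k+1)]
        simp only [Nat.add_sub_cancel]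
        push_cast; ring

/-- The series `∑ a_k (∂_z - \bar z)^n z^k / √(k!)`. -/
def hermiteSeries (a : ℕ → ℂ) (n : ℕ) (z : ℂ) : ℂ :=
  ∑' k : ℕ, a k * (complexHermite n k z / (Real.sqrt (k ! : ℝ) : ℂ))

/-- The weight 2^k is the growth allowed by `Tempered`. One majorant serves both the series and its
termwise z-derivative on a disk. -/
lemma exists_summable_bound (n : ℕ) (R : ℝ) :
    ∃ u : ℕ → ℝ, Summable u ∧ (∀ k, 0 ≤ u k) ∧ ∀ (k : ℕ) (z : ℂ), ‖z‖ ≤ R →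
      2 ^ k * ‖complexHermite n k z / (Real.sqrt (k ! : ℝ) : ℂ)‖ ≤ u k ∧
      2 ^ k * ‖k * complexHermite n (k - 1) z / (Real.sqrt (k ! : ℝ) : ℂ)‖ ≤ u k := by
  obtain ⟨C, D, hC, hD, h⟩ := exists_norm_complexHermite_le R n
  refine ⟨fun k => C * ((2 * D) ^ k / Real.sqrt (k ! : ℝ)),
    (summable_pow_div_sqrt_factorial _).mul_left _, fun k => by positivity, fun k z hz => ?_⟩
  obtain ⟨h1, h2⟩ := h k z hz
  simp only [norm_div, norm_mul, Complex.norm_real, Complex.norm_natCast, Real.norm_eq_abs,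
    abs_of_nonneg (Real.sqrt_nonneg _)]
  have e : C * ((2 * D) ^ k / Real.sqrt (k ! : ℝ)) = 2 ^ k * ((C * D ^ k) / Real.sqrt (k ! : ℝ)) := by
    rw [mul_pow]; ring
  rw [e]
  exact ⟨by gcongr, by gcongr⟩

lemma Tempered.summable_hermite {a : ℕ → ℂ} (ha : Tempered a) (n : ℕ) (z : ℂ) :
    Summable fun k : ℕ => ‖a k * (complexHermite n k z / (Real.sqrt (k ! : ℝ) : ℂ))‖ := by
  obtain ⟨C, hC, hCa⟩ := ha
  obtain ⟨u, hu, hu0, hb⟩ := exists_summable_bound n ‖z‖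
  refine Summable.of_norm_bounded (hu.mul_left C) fun k => ?_
  rw [norm_norm, norm_mul]
  calc _ ≤ C * 2 ^ k * ‖complexHermite n k z / (Real.sqrt (k ! : ℝ) : ℂ)‖ := by
        gcongr; exact hCa k
    _ ≤ C * u k := by rw [mul_assoc]; gcongr; exact (hb k z le_rfl).1

lemma Tempered.summable_hermite_pred {a : ℕ → ℂ} (ha : Tempered a) (n : ℕ) (z : ℂ) :
    Summable fun k : ℕ => ‖a k * (k * complexHermite n (k - 1) z / (Real.sqrt (k ! : ℝ) : ℂ))‖ := by
  obtain ⟨C, hC, hCa⟩ := ha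
  obtain ⟨u, hu, hu0, hb⟩ := exists_summable_bound n ‖z‖
  refine Summable.of_norm_bounded (hu.mul_left C) fun k => ?_
  rw [norm_norm, norm_mul]
  calc _ ≤ C * 2 ^ k * ‖k * complexHermite n (k - 1) z / (Real.sqrt (k ! : ℝ) : ℂ)‖ := by
        gcongr; exact hCa k
    _ ≤ C * u k := by rw [mul_assoc]; gcongr; exact (hb k z le_rfl).2

lemma Tempered.tsum_pred_eq {a : ℕ → ℂ} (ha : Tempered a) (n : ℕ) (z : ℂ) :
    ∑' k : ℕ, a k * (k * complexHermite n (k - 1) z / (Real.sqrt (k ! : ℝ) : ℂ)) =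
      hermiteSeries a (n + 1) z + conj z * hermiteSeries a n z := by
  rw [hermiteSeries, hermiteSeries, ← tsum_mul_left,
    ← (ha.summable_hermite (n + 1) z).of_norm.tsum_add
      ((ha.summable_hermite n z).of_norm.mul_left _)]
  refine tsum_congr fun k => ?_
  rw [complexHermite_succ_left]; ring

/-- The z-derivative is written through the series of index n + 1 and n, so that subtracting \bar z
times the series leaves index n + 1: the raising operator acts by n ↦ n + 1. -/
lemma Tempered.hasFDerivAt_hermiteSeries {a : ℕ → ℂ} (ha : Tempered a) (n : ℕ) (z : ℂ) :
    HasFDerivAt (hermiteSeries a n)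
      (wirtingerCLM (hermiteSeries a (n + 1) z + conj z * hermiteSeries a n z)
        (-(n * hermiteSeries a (n - 1) z))) z := by
  obtain ⟨C, hC, hCa⟩ := id ha
  obtain ⟨u, hu, hu0, hb⟩ := exists_summable_bound n (‖z‖ + 1)
  obtain ⟨v, hv, hv0, hb'⟩ := exists_summable_bound (n - 1) (‖z‖ + 1)
  have hd : ∀ (k : ℕ) (w : ℂ), HasFDerivAt
      (fun w => a k * (complexHermite n k w / (Real.sqrt (k ! : ℝ) : ℂ)))
      (wirtingerCLM (a k * (k * complexHermite n (k - 1) w / (Real.sqrt (k ! : ℝ) : ℂ)))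
        (-(n * (a k * (complexHermite (n - 1) k w / (Real.sqrt (k ! : ℝ) : ℂ)))))) w := by
    intro k w
    have h := (hasFDerivAt_complexHermite n k w).const_mul (a k * (Real.sqrt (k ! : ℝ) : ℂ)⁻¹)
    convert! h using 1
    · ext w; ring
    · ext v
      simp only [wirtingerCLM_apply, smul_apply, smul_eq_mul]; ring
  have hsum : Summable fun k => C * u k + n * (C * v k) :=
    (hu.mul_left C).add ((hv.mul_left C).mul_left _)
  have hbound : ∀ (k : ℕ) (w : ℂ), w ∈ Metric.ball (0 : ℂ) (‖z‖ + 1) →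
      ‖wirtingerCLM (a k * (k * complexHermite n (k - 1) w / (Real.sqrt (k ! : ℝ) : ℂ)))
        (-(n * (a k * (complexHermite (n - 1) k w / (Real.sqrt (k ! : ℝ) : ℂ)))))‖ ≤
      C * u k + n * (C * v k) := by
    intro k w hw
    rw [mem_ball_zero_iff] at hw
    refine (norm_wirtingerCLM_le _ _).trans ?_
    rw [norm_neg, norm_mul, norm_mul (n : ℂ), norm_mul (a k), Complex.norm_natCast]
    have h1 := (hb k w hw.le).2
    have h2 := (hb' k w hw.le).1
    have h3 := hCa k
    have h4 : ∀ x y : ℝ, 0 ≤ x → 2 ^ k * x ≤ y → ‖a k‖ * x ≤ C * y := by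
      intro x y hx hy
      calc _ ≤ C * 2 ^ k * x := by gcongr
        _ ≤ C * y := by rw [mul_assoc]; gcongr
    exact add_le_add (h4 _ _ (norm_nonneg _) h1)
      (mul_le_mul_of_nonneg_left (h4 _ _ (norm_nonneg _) h2) (by positivity))
  have hmem : z ∈ Metric.ball (0 : ℂ) (‖z‖ + 1) := by simp
  have key := hasFDerivAt_tsum_of_isPreconnected hsum Metric.isOpen_ball
    (convex_ball (0 : ℂ) (‖z‖ + 1)).isPreconnected (fun k w _ => hd k w) hbound hmem
    (ha.summable_hermite n z).of_norm hmem
  convert! key using 1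
  have hS : Summable fun k => wirtingerCLM
      (a k * (k * complexHermite n (k - 1) z / (Real.sqrt (k ! : ℝ) : ℂ)))
        (-(n * (a k * (complexHermite (n - 1) k z / (Real.sqrt (k ! : ℝ) : ℂ))))) :=
    Summable.of_norm_bounded hsum fun k => hbound k z hmem
  refine ContinuousLinearMap.ext fun v => ?_
  have hv := (ContinuousLinearMap.apply ℝ ℂ v).map_tsum hS
  simp only [ContinuousLinearMap.apply_apply] at hv
  rw [hv]
  simp only [wirtingerCLM_apply]
  rw [Summable.tsum_add, tsum_mul_right, tsum_mul_right, ha.tsum_pred_eq, tsum_neg, tsum_mul_left]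
  · rfl
  · exact (ha.summable_hermite_pred n z).of_norm.mul_right _
  · exact (((ha.summable_hermite (n - 1) z).of_norm.mul_left _).neg).mul_right _

lemma Tempered.raising_iterate {a : ℕ → ℂ} (ha : Tempered a) (n : ℕ) :
    raising^[n] (entireSeries a) = hermiteSeries a n := by
  induction n with
  | zero => rfl
  | succ n ih =>
    rw [Function.iterate_succ_apply', ih]
    ext z
    rw [raising, HasFDerivAt.wirtingerDz_eq (ha.hasFDerivAt_hermiteSeries n z)]
    ring

lemma Tempered.contDiff_hermiteSeries {a : ℕ → ℂ} (ha : Tempered a) (n : ℕ) :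
    ContDiff ℝ 1 (hermiteSeries a n) := by
  have hc : ∀ m, Continuous (hermiteSeries a m) := fun m =>
    (Differentiable.continuous (𝕜 := ℝ) fun z => (ha.hasFDerivAt_hermiteSeries m z).differentiableAt)
  rw [contDiff_one_iff_hasFDerivAt]
  refine ⟨_, ?_, ha.hasFDerivAt_hermiteSeries n⟩
  have h1 := hc n
  have h2 := hc (n + 1)
  have h3 := hc (n - 1)
  exact continuous_wirtingerCLM (h2.add (Complex.continuous_conj.mul h1))
    ((continuous_const.mul h3).neg)

end

section

open scoped ComplexConjugate Topology Nat

/-! ### Unitarity of the matrix of complex Hermite functions -/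

/-- The index shift is the adjointness of differentiation and multiplication by the variable in the
Fock pairing ∑ a_k b_k / k!. -/
lemma hasSum_shift_factorial {f : ℕ → ℂ} {g : ℕ → ℂ} {s : ℂ}
    (h : HasSum (fun k => f k * g (k + 1) / (k ! : ℂ)) s) :
    HasSum (fun k : ℕ => k * f (k - 1) * g k / (k ! : ℂ)) s := by
  rw [← hasSum_nat_add_iff' 1]
  simp only [Finset.range_one, Finset.sum_singleton, Nat.cast_zero, zero_mul, zero_div, sub_zero]
  convert! h using 1
  ext k
  rw [Nat.add_sub_cancel, Nat.factorial_succ]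
  have : (k ! : ℂ) ≠ 0 := by exact_mod_cast k.factorial_ne_zero
  have : (k : ℂ) + 1 ≠ 0 := by exact_mod_cast k.succ_ne_zero
  push_cast
  field_simp

/-- This is the composition law of displacement operators before normalization. It starts from the
exponential series at n = m = 0; induction on m, then on n, uses the left recursion, whose factor k
is absorbed by the shift of 1/k!. -/
lemma hasSum_complexHermite_mul (n m : ℕ) (z w : ℂ) :
    HasSum (fun k => complexHermite n k z * conj (complexHermite m k w) / (k ! : ℂ))
      (Complex.exp (z * conj w) * conj (complexHermite m n (w - z))) := by
  induction n generalizing m with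
  | zero =>
    simp only [complexHermite_zero, complexHermite_zero_right]
    induction m with
    | zero =>
      have h := NormedSpace.expSeries_div_hasSum_exp (z * conj w)
      rw [← Complex.exp_eq_exp_ℂ] at h
      simpa [complexHermite_zero, mul_pow] using h
    | succ m ih =>
      have h1 : HasSum (fun k => conj (complexHermite m k w) * z ^ (k + 1) / (k ! : ℂ))
          (z * (Complex.exp (z * conj w) * conj ((-conj (w - z)) ^ m))) := by
        convert! ih.mul_left z using 1
        ext k; ring
      have h2 := (hasSum_shift_factorial (g := fun k => z ^ k) h1).sub (ih.mul_left w)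
      convert! h2 using 1
      · ext k
        simp only [complexHermite_succ_left, map_sub, map_mul, Complex.conj_conj, map_natCast]
        ring
      · simp only [map_pow, map_neg, map_sub, Complex.conj_conj, pow_succ, map_mul]; ring
  | succ n ih =>
    have h1 : HasSum (fun k => complexHermite n k z * conj (complexHermite m (k + 1) w) / (k ! : ℂ))
        (conj w * (Complex.exp (z * conj w) * conj (complexHermite m n (w - z))) +
          m * (Complex.exp (z * conj w) * conj (complexHermite (m - 1) n (w - z)))) := by
      convert! ((ih m).mul_left (conj w)).add ((ih (m - 1)).mul_left (m : ℂ)) using 1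
      ext k
      simp only [complexHermite_succ_right, map_add, map_mul, map_natCast]
      ring
    have h2 := (hasSum_shift_factorial (g := fun k => conj (complexHermite m k w)) h1).sub
      ((ih m).mul_left (conj z))
    convert! h2 using 1
    · ext k
      rw [complexHermite_succ_left]; ring
    · simp only [complexHermite_succ_right, map_add, map_mul, map_natCast, map_sub]; ring

/-- The normalized complex Hermite functions, that is, the matrix elements of the displacement
operators in the number basis. -/
def displacement (n k : ℕ) (z : ℂ) : ℂ :=
  (Real.exp (-‖z‖ ^ 2 / 2) : ℂ) * complexHermite n k z /
    ((Real.sqrt (n ! : ℝ) : ℂ) * (Real.sqrt (k ! : ℝ) : ℂ))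

lemma hasSum_displacement_mul (n m : ℕ) (z w : ℂ) :
    HasSum (fun k => displacement n k z * conj (displacement m k w))
      (Complex.exp (Complex.I * (z * conj w).im) * conj (displacement m n (w - z))) := by
  have h := (hasSum_complexHermite_mul n m z w).mul_left
    ((Real.exp (-‖z‖ ^ 2 / 2) : ℂ) * (Real.exp (-‖w‖ ^ 2 / 2) : ℂ) /
      ((Real.sqrt (n ! : ℝ) : ℂ) * (Real.sqrt (m ! : ℝ) : ℂ)))
  convert! h using 1
  · ext k
    simp only [displacement, map_div₀, map_mul, Complex.conj_ofReal]
    rw [← sqrt_factorial_sq k]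
    have h1 := sqrt_factorial_ne_zero k
    have h2 := sqrt_factorial_ne_zero n
    have h3 := sqrt_factorial_ne_zero m
    field_simp
  · simp only [displacement, map_div₀, map_mul, Complex.conj_ofReal]
    -- Since |w - z|² = |z|² + |w|² - 2 Re(z \bar w), the Gaussian weights absorb the real part of
    -- the exponent and leave only a phase.
    have e : Complex.exp (Complex.I * (z * conj w).im) * (Real.exp (-‖w - z‖ ^ 2 / 2) : ℂ) =
        (Real.exp (-‖z‖ ^ 2 / 2) : ℂ) * (Real.exp (-‖w‖ ^ 2 / 2) : ℂ) *
          Complex.exp (z * conj w) := by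
      simp only [Complex.ofReal_exp, ← Complex.exp_add]
      congr 1
      simp only [← Complex.normSq_eq_norm_sq, Complex.normSq_apply]
      apply Complex.ext
      · simp; ring
      · simp
    have h2 := sqrt_factorial_ne_zero n
    have h3 := sqrt_factorial_ne_zero m
    generalize (Real.exp (-‖w - z‖ ^ 2 / 2) : ℂ) = A at e ⊢
    generalize (Real.exp (-‖w‖ ^ 2 / 2) : ℂ) = B at e ⊢
    generalize (Real.exp (-‖z‖ ^ 2 / 2) : ℂ) = C at e ⊢
    field_simp
    linear_combination conj (complexHermite m n (w - z)) * e

lemma complexHermite_self_zero (n : ℕ) : complexHermite n n 0 = n ! := by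
  induction n with
  | zero => simp [complexHermite]
  | succ n ih =>
    rw [complexHermite_succ_left, Nat.add_sub_cancel, ih, Nat.factorial_succ]
    simp

lemma complexHermite_zero_of_ne {n k : ℕ} (h : n ≠ k) : complexHermite n k 0 = 0 := by
  induction n generalizing k with
  | zero => simp [complexHermite, h.symm]
  | succ n ih =>
    rw [complexHermite_succ_left]
    cases k with
    | zero => simp
    | succ k => simp [ih (k := k) (by omega)]

lemma displacement_zero (n k : ℕ) : displacement n k 0 = if n = k then 1 else 0 := by
  rw [displacement]
  split_ifs with h
  · subst h
    have := sqrt_factorial_ne_zero n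
    rw [complexHermite_self_zero, ← sqrt_factorial_sq, sq (Real.sqrt _ : ℂ), norm_zero]
    simp only [zero_pow two_ne_zero, neg_zero, zero_div, Real.exp_zero, Complex.ofReal_one, one_mul]
    exact div_self (mul_ne_zero this this)
  · simp [complexHermite_zero_of_ne h]

lemma hasSum_displacement_mul_self (n m : ℕ) (z : ℂ) :
    HasSum (fun k => displacement n k z * conj (displacement m k z)) (if n = m then 1 else 0) := by
  convert! hasSum_displacement_mul n m z z using 1
  rw [sub_self, displacement_zero, Complex.mul_conj]
  simp [eq_comm, apply_ite conj]

lemma hasSum_normSq_displacement (n : ℕ) (z : ℂ) :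
    HasSum (fun k => ‖displacement n k z‖ ^ 2) 1 := by
  rw [← Complex.hasSum_ofReal]
  convert! hasSum_displacement_mul_self n n z using 1
  · ext k
    rw [Complex.mul_conj, Complex.normSq_eq_norm_sq]
  · simp

lemma sum_normSq_displacement_le (n : ℕ) (s : Finset ℕ) (z : ℂ) :
    ∑ k ∈ s, ‖displacement n k z‖ ^ 2 ≤ 1 :=
  sum_le_hasSum s (fun _ _ => by positivity) (hasSum_normSq_displacement n z)

/-- Rotation by c multiplies the polynomial by c^{k-n}; dividing is avoided by keeping conjugate
powers on both sides. This makes moduli radial, and later inserts c^k into the sum over a row. -/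
lemma complexHermite_mul_of_norm_one {c : ℂ} (hc : ‖c‖ = 1) (n k : ℕ) (z : ℂ) :
    conj c ^ k * complexHermite n k (c * z) = conj c ^ n * complexHermite n k z := by
  have hcc : conj c * c = 1 := by
    rw [mul_comm, Complex.mul_conj, Complex.normSq_eq_norm_sq, hc]; simp
  induction n generalizing k with
  | zero => rw [complexHermite_zero, complexHermite_zero, mul_pow, ← mul_assoc, ← mul_pow, hcc]; simp
  | succ n ih =>
    rw [complexHermite_succ_left, complexHermite_succ_left, map_mul]
    have h1 := ih k
    cases k with
    | zero => simp only [Nat.cast_zero, zero_mul, zero_sub]; linear_combination (-conj c * conj z) * h1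
    | succ k =>
      have h2 := ih k
      simp only [Nat.add_sub_cancel]
      linear_combination (-conj c * conj z) * h1 + ((k + 1 : ℕ) : ℂ) * conj c * h2

lemma displacement_mul_of_norm_one {c : ℂ} (hc : ‖c‖ = 1) (n k : ℕ) (z : ℂ) :
    conj c ^ k * displacement n k (c * z) = conj c ^ n * displacement n k z := by
  rw [displacement, displacement, norm_mul, hc, one_mul]
  linear_combination ((Real.exp (-‖z‖ ^ 2 / 2) : ℂ) /
    ((Real.sqrt (n ! : ℝ) : ℂ) * (Real.sqrt (k ! : ℝ) : ℂ))) * complexHermite_mul_of_norm_one hc n k z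

lemma norm_displacement_eq (n k : ℕ) (z : ℂ) :
    ‖displacement n k z‖ = ‖displacement n k (‖z‖ : ℂ)‖ := by
  obtain ⟨θ, hθ⟩ : ∃ θ : ℝ, z = Complex.exp (θ * Complex.I) * (‖z‖ : ℂ) :=
    ⟨Complex.arg z, by rw [mul_comm]; exact (Complex.norm_mul_exp_arg_mul_I z).symm⟩
  have hc : ‖Complex.exp (θ * Complex.I)‖ = 1 := Complex.norm_exp_ofReal_mul_I θ
  have h := congrArg norm (displacement_mul_of_norm_one hc n k (‖z‖ : ℂ))
  simp only [norm_mul, norm_pow, RCLike.norm_conj, hc, one_pow, one_mul] at h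
  rw [← h, ← hθ]

/-! ### The prelimit overlap kernel -/

/-- The covariance of the fluctuation field at distance `r`. -/
def prelimitKernel (N : ℕ) (r : ℝ) : ℝ :=
  (1 / (N : ℝ)) * ∑ n ∈ Finset.range N, ∑ k ∈ Finset.range N,
    ‖displacement n k ((Real.sqrt N * r : ℝ) : ℂ)‖ ^ 2

lemma conj_complexHermite (n k : ℕ) (z : ℂ) :
    conj (complexHermite n k z) = complexHermite n k (conj z) := by
  induction n generalizing k with
  | zero => simp [complexHermite]
  | succ n ih => simp [complexHermite_succ_left, ih]

lemma conj_displacement (n k : ℕ) (z : ℂ) :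
    conj (displacement n k z) = displacement n k (conj z) := by
  simp only [displacement, map_div₀, map_mul, Complex.conj_ofReal, conj_complexHermite,
    RCLike.norm_conj]

/-! ### Ladder derivatives and the uniform Lipschitz bound at the origin -/

/-- The real matrix elements of the displacement operators along the real axis. -/
def realDisplacement (n k : ℕ) (x : ℝ) : ℝ := (displacement n k x).re

lemma ofReal_realDisplacement (n k : ℕ) (x : ℝ) :
    (realDisplacement n k x : ℂ) = displacement n k x := by
  rw [realDisplacement, ← Complex.conj_eq_iff_re, conj_displacement, Complex.conj_ofReal]

lemma norm_displacement_sq (n k : ℕ) (x : ℝ) :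
    ‖displacement n k x‖ ^ 2 = realDisplacement n k x ^ 2 := by
  rw [← ofReal_realDisplacement, Complex.norm_real, Real.norm_eq_abs, sq_abs]

lemma sqrt_factorial_succ (n : ℕ) :
    Real.sqrt ((n + 1)! : ℝ) = Real.sqrt (n + 1) * Real.sqrt (n ! : ℝ) := by
  rw [Nat.factorial_succ, Nat.cast_mul, Real.sqrt_mul (by positivity)]
  push_cast; rfl

/-- The derivative along the real axis is ∂_z + ∂_{\bar z}. The first operator gives index n + 1
plus x times index n, and the latter is cancelled by the derivative of the Gaussian weight; the
second gives index n - 1. -/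
lemma hasDerivAt_displacement (n k : ℕ) (x : ℝ) :
    HasDerivAt (fun x : ℝ => displacement n k x)
      ((Real.sqrt (n + 1) : ℂ) * displacement (n + 1) k x -
        (Real.sqrt n : ℂ) * displacement (n - 1) k x) x := by
  have h1 : HasDerivAt (fun x : ℝ => (x : ℂ)) 1 x := Complex.ofRealCLM.hasDerivAt
  have h2 : HasDerivAt (fun x : ℝ => complexHermite n k (x : ℂ)) _ x :=
    (hasFDerivAt_complexHermite n k (x : ℂ)).comp_hasDerivAt x h1
  have h3 : HasDerivAt (fun x : ℝ => (Real.exp (-x ^ 2 / 2) : ℂ))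
      ((Real.exp (-x ^ 2 / 2) * (-x) : ℝ) : ℂ) x := by
    refine HasDerivAt.ofReal_comp ?_
    have h : HasDerivAt (fun x : ℝ => -x ^ 2 / 2) (-x) x := by
      convert! ((hasDerivAt_pow 2 x).neg.div_const 2) using 1
      simp; ring
    exact h.exp
  have h4 := (h3.mul h2).div_const ((Real.sqrt (n ! : ℝ) : ℂ) * (Real.sqrt (k ! : ℝ) : ℂ))
  have hn : ∀ y : ℝ, ‖(y : ℂ)‖ ^ 2 = y ^ 2 := fun y => by
    rw [Complex.norm_real, Real.norm_eq_abs, sq_abs]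
  simp only [displacement, hn]
  convert! h4 using 1
  rw [wirtingerCLM_apply, complexHermite_succ_left, sqrt_factorial_succ, Complex.conj_ofReal]
  have hs1 := sqrt_factorial_ne_zero n
  have hs2 := sqrt_factorial_ne_zero k
  have hs3 : ((Real.sqrt ((n : ℝ) + 1) : ℝ) : ℂ) ≠ 0 := by
    rw [Complex.ofReal_ne_zero]; positivity
  have e : (Real.sqrt n : ℂ) * ((Real.exp (-x ^ 2 / 2) : ℂ) * complexHermite (n - 1) k x /
      ((Real.sqrt ((n - 1)! : ℝ) : ℂ) * (Real.sqrt (k ! : ℝ) : ℂ))) =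
      n * (Real.exp (-x ^ 2 / 2) : ℂ) * complexHermite (n - 1) k x /
      ((Real.sqrt (n ! : ℝ) : ℂ) * (Real.sqrt (k ! : ℝ) : ℂ)) := by
    cases n with
    | zero => simp
    | succ n =>
      simp only [Nat.add_sub_cancel, sqrt_factorial_succ]
      have hs1 := sqrt_factorial_ne_zero n
      have hs3 : ((Real.sqrt ((n : ℝ) + 1) : ℝ) : ℂ) ≠ 0 := by
        rw [Complex.ofReal_ne_zero]; positivity
      have hs4 : ((Real.sqrt ((n : ℝ) + 1) : ℝ) : ℂ) ^ 2 = ((n + 1 : ℕ) : ℂ) := by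
        rw [← Complex.ofReal_pow, Real.sq_sqrt (by positivity)]; push_cast; rfl
      rw [← hs4]
      push_cast
      field_simp
  rw [e]
  generalize Real.exp (-x ^ 2 / 2) = A
  push_cast
  simp only [map_one]
  field_simp
  ring

lemma hasDerivAt_realDisplacement (n k : ℕ) (x : ℝ) :
    HasDerivAt (realDisplacement n k)
      (Real.sqrt (n + 1) * realDisplacement (n + 1) k x -
        Real.sqrt n * realDisplacement (n - 1) k x) x := by
  have h := Complex.reCLM.hasFDerivAt.comp_hasDerivAt x (hasDerivAt_displacement n k x)
  convert! h using 1
  simp [realDisplacement]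

/-- The ladder coefficients √(n+1) and -√n make consecutive terms cancel, so only the boundary
product of rows N - 1 and N survives. For N = 0 the factor √N removes the truncated index. -/
lemma hasDerivAt_sum_sq_realDisplacement (N k : ℕ) (x : ℝ) :
    HasDerivAt (fun x => ∑ n ∈ Finset.range N, realDisplacement n k x ^ 2)
      (2 * Real.sqrt N * realDisplacement (N - 1) k x * realDisplacement N k x) x := by
  induction N with
  | zero => simpa using hasDerivAt_const x (0 : ℝ)
  | succ N ih =>
    simp only [Finset.sum_range_succ]
    convert! ih.add ((hasDerivAt_realDisplacement N k x).pow 2) using 1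
    simp only [Nat.add_sub_cancel]
    push_cast; ring

lemma prelimitKernel_zero {N : ℕ} (hN : 1 ≤ N) : prelimitKernel N 0 = 1 := by
  have h0 : (N : ℝ) ≠ 0 := by positivity
  have h : ∀ n ∈ Finset.range N, ∑ k ∈ Finset.range N, ‖displacement n k 0‖ ^ 2 = 1 := by
    intro n hn
    rw [Finset.sum_eq_single n]
    · simp [displacement_zero]
    · intro k _ hk
      simp [displacement_zero, hk.symm]
    · exact fun h => absurd hn h
  rw [prelimitKernel, mul_zero, Complex.ofReal_zero, Finset.sum_congr rfl h]
  simp [h0]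

/-- Rows N - 1 and N have norm at most 1, so the telescoped derivative summed over k is at most 2√N.
The argument √N r and the prefactor 1/N turn this into the constant 2, independent of N. -/
lemma one_sub_prelimitKernel_le {N : ℕ} (hN : 1 ≤ N) {r : ℝ} (hr : 0 ≤ r) :
    1 - prelimitKernel N r ≤ 2 * r := by
  have hN0 : (0 : ℝ) < N := by positivity
  set f : ℝ → ℝ := fun x => ∑ k ∈ Finset.range N, ∑ n ∈ Finset.range N,
    realDisplacement n k x ^ 2 with hf
  have hfκ : ∀ r, prelimitKernel N r = 1 / (N : ℝ) * f (Real.sqrt N * r) := by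
    intro r
    rw [prelimitKernel, hf, Finset.sum_comm]
    simp only [norm_displacement_sq]
  have hd : ∀ x, HasDerivAt f (∑ k ∈ Finset.range N,
      2 * Real.sqrt N * realDisplacement (N - 1) k x * realDisplacement N k x) x := fun x =>
    HasDerivAt.fun_sum fun k _ => hasDerivAt_sum_sq_realDisplacement N k x
  have hb : ∀ x, ‖∑ k ∈ Finset.range N,
      2 * Real.sqrt N * realDisplacement (N - 1) k x * realDisplacement N k x‖ ≤
      2 * Real.sqrt N := by
    intro x
    have h1 := sum_normSq_displacement_le (N - 1) (Finset.range N) x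
    have h2 := sum_normSq_displacement_le N (Finset.range N) x
    simp only [norm_displacement_sq] at h1 h2
    have h3 : ∀ k, ‖2 * Real.sqrt N * realDisplacement (N - 1) k x * realDisplacement N k x‖ ≤
        Real.sqrt N * (realDisplacement (N - 1) k x ^ 2 + realDisplacement N k x ^ 2) := by
      intro k
      have : 2 * Real.sqrt N * realDisplacement (N - 1) k x * realDisplacement N k x =
        Real.sqrt N * (2 * realDisplacement (N - 1) k x * realDisplacement N k x) := by ring
      rw [this, norm_mul, Real.norm_eq_abs, abs_of_nonneg (Real.sqrt_nonneg _), Real.norm_eq_abs]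
      gcongr
      rw [abs_le]
      constructor <;>
        nlinarith [sq_nonneg (realDisplacement (N - 1) k x + realDisplacement N k x),
          sq_nonneg (realDisplacement (N - 1) k x - realDisplacement N k x)]
    calc _ ≤ ∑ k ∈ Finset.range N, _ := norm_sum_le_of_le _ fun k _ => h3 k
      _ = Real.sqrt N * (∑ k ∈ Finset.range N, realDisplacement (N - 1) k x ^ 2 +
          ∑ k ∈ Finset.range N, realDisplacement N k x ^ 2) := by
          rw [← Finset.mul_sum, Finset.sum_add_distrib]
      _ ≤ Real.sqrt N * (1 + 1) := by gcongr
      _ = _ := by ring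
  have hmv := Convex.norm_image_sub_le_of_norm_hasDerivWithin_le (s := Set.univ) (x := 0)
    (y := Real.sqrt N * r)
    (fun x _ => (hd x).hasDerivWithinAt) (fun x _ => hb x) convex_univ trivial trivial
  have h0 : 1 / (N : ℝ) * f 0 = 1 := by
    have := hfκ 0
    rw [mul_zero, prelimitKernel_zero hN] at this
    exact this.symm
  have h5 : f 0 - f (Real.sqrt N * r) ≤ 2 * N * r := by
    have := (le_abs_self _).trans ((abs_sub_comm _ _).le.trans hmv)
    rw [sub_zero, Real.norm_eq_abs, abs_of_nonneg (by positivity)] at this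
    nlinarith [Real.mul_self_sqrt hN0.le]
  calc 1 - prelimitKernel N r = 1 / (N : ℝ) * (f 0 - f (Real.sqrt N * r)) := by
        rw [hfκ, mul_sub, h0]
    _ ≤ 1 / (N : ℝ) * (2 * N * r) := by gcongr
    _ = 2 * r := by field_simp

end

section

open scoped ComplexConjugate Topology Nat

/-! ### Diagonal matrix elements and Laguerre polynomials -/

/-- The Laguerre polynomials. -/
def laguerre (n : ℕ) (x : ℝ) : ℝ :=
  ∑ l ∈ Finset.range (n + 1), (n.choose l : ℝ) * (-x) ^ l / (l ! : ℝ)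

/-- ∂_z and multiplication by -\bar z commute, so the binomial theorem applies to (∂_z - \bar z)^n.
-/
lemma complexHermite_eq_sum (n k : ℕ) (z : ℂ) :
    complexHermite n k z = ∑ p ∈ Finset.HasAntidiagonal.antidiagonal n,
      (n.choose p.1) • ((k.descFactorial p.1 : ℂ) * z ^ (k - p.1) * (-conj z) ^ p.2) := by
  induction n generalizing k with
  | zero => simp [complexHermite]
  | succ n ih =>
    rw [complexHermite_succ_left, ih (k - 1), ih k, Finset.sum_antidiagonal_choose_succ_nsmul
      (fun i j => (k.descFactorial i : ℂ) * z ^ (k - i) * (-conj z) ^ j), add_comm, sub_eq_add_neg]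
    congr 1
    · rw [Finset.mul_sum]
      refine Finset.sum_congr rfl fun p hp => ?_
      rw [← Finset.HasAntidiagonal.mem_antidiagonal.1 hp, Nat.choose_symm_add]
      have h1 : (k : ℂ) * ((k - 1).descFactorial p.1 : ℂ) = (k.descFactorial (p.1 + 1) : ℂ) := by
        cases k with
        | zero => simp
        | succ k => rw [Nat.succ_descFactorial_succ]; simp
      rw [← h1, Nat.sub_sub, add_comm 1 p.1]
      simp only [nsmul_eq_mul]; ring
    · rw [Finset.mul_sum, ← Finset.sum_neg_distrib]
      refine Finset.sum_congr rfl fun p _ => ?_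
      simp only [nsmul_eq_mul]; ring

lemma complexHermite_self (n : ℕ) (z : ℂ) :
    complexHermite n n z = (n ! : ℂ) * (laguerre n (‖z‖ ^ 2) : ℂ) := by
  rw [complexHermite_eq_sum, laguerre, ← Finset.Nat.sum_antidiagonal_eq_sum_range_succ
    (fun l _ => (n.choose l : ℝ) * (-‖z‖ ^ 2) ^ l / (l ! : ℝ)),
    ← Finset.Nat.sum_antidiagonal_swap]
  push_cast
  rw [Finset.mul_sum]
  refine Finset.sum_congr rfl fun p hp => ?_
  have hp := Finset.HasAntidiagonal.mem_antidiagonal.1 hp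
  simp only [Prod.fst_swap, Prod.snd_swap, nsmul_eq_mul]
  have h2 : n - p.2 = p.1 := by omega
  have h3 : ((p.1)! : ℂ) ≠ 0 := by exact_mod_cast p.1.factorial_ne_zero
  have h4 : (n.descFactorial p.2 : ℂ) = n ! / ((p.1)! : ℂ) := by
    rw [eq_div_iff h3, ← h2, mul_comm]
    exact_mod_cast Nat.factorial_mul_descFactorial (by omega : p.2 ≤ n)
  rw [h4, h2, ← Complex.ofReal_pow ‖z‖ 2, ← Complex.normSq_eq_norm_sq, ← Complex.mul_conj,
    ← hp, Nat.choose_symm_add, neg_pow (z * conj z), mul_pow, neg_pow (conj z)]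
  ring

lemma displacement_self (n : ℕ) (z : ℂ) :
    displacement n n z = ((Real.exp (-‖z‖ ^ 2 / 2) * laguerre n (‖z‖ ^ 2) : ℝ) : ℂ) := by
  rw [displacement, complexHermite_self, ← sqrt_factorial_sq]
  have := sqrt_factorial_ne_zero n
  push_cast
  field_simp

/-- By rotation covariance |D_{nk}(z)|² c^k equals c^n D_{nk}(cz) conj(D_{nk}(z)). The composition
law sums this to a diagonal element at (1 - c)z, which is a Laguerre function. -/
lemma hasSum_normSq_displacement_mul_pow {c : ℂ} (hc : ‖c‖ = 1) (n : ℕ) (z : ℂ) :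
    HasSum (fun k => ((‖displacement n k z‖ ^ 2 : ℝ) : ℂ) * c ^ k)
      (c ^ n * Complex.exp (Complex.I * (‖z‖ ^ 2 * c.im : ℝ)) *
        ((Real.exp (-(‖1 - c‖ ^ 2 * ‖z‖ ^ 2) / 2) *
          laguerre n (‖1 - c‖ ^ 2 * ‖z‖ ^ 2) : ℝ) : ℂ)) := by
  have hcc : c * conj c = 1 := by
    rw [Complex.mul_conj, Complex.normSq_eq_norm_sq, hc]; simp
  convert! (hasSum_displacement_mul n n (c * z) z).mul_left (c ^ n) using 1
  · ext k
    have h := displacement_mul_of_norm_one hc n k z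
    have h1 : (c * conj c) ^ k = 1 := by rw [hcc, one_pow]
    have h2 : (c * conj c) ^ n = 1 := by rw [hcc, one_pow]
    rw [mul_pow] at h1 h2
    rw [← Complex.normSq_eq_norm_sq, ← Complex.mul_conj]
    linear_combination (- c ^ k * displacement n k z * conj (displacement n k z)) * h2
      - c ^ n * c ^ k * conj (displacement n k z) * h
      + c ^ n * displacement n k (c * z) * conj (displacement n k z) * h1
  · have e1 : z - c * z = (1 - c) * z := by ring
    have e2 : (c * z * conj z).im = ‖z‖ ^ 2 * c.im := by
      rw [mul_assoc, Complex.mul_conj, Complex.normSq_eq_norm_sq, Complex.im_mul_ofReal]; ring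
    rw [e1, e2, displacement_self, norm_mul, mul_pow, Complex.conj_ofReal, mul_assoc, ← neg_mul]

/-! ### The Bessel function `∑ (-x)^l / (l!)²` -/

/-- The entire function `∑ (-x)^l / (l!)²`, equal to `J₀(2√x)` for `x ≥ 0`. -/
def besselSeries (x : ℝ) : ℝ := ∑' l : ℕ, (-x) ^ l / ((l ! : ℝ) ^ 2)

lemma norm_besselTerm_le (x : ℝ) (l : ℕ) : ‖(-x) ^ l / ((l ! : ℝ) ^ 2)‖ ≤ |x| ^ l / (l ! : ℝ) := by
  have h1 : (1 : ℝ) ≤ l ! := by exact_mod_cast Nat.one_le_iff_ne_zero.2 l.factorial_ne_zero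
  rw [norm_div, norm_pow, norm_neg, Real.norm_eq_abs, Real.norm_eq_abs,
    abs_of_nonneg (by positivity : (0 : ℝ) ≤ (l ! : ℝ) ^ 2)]
  gcongr
  nlinarith

lemma summable_besselTerm (x : ℝ) : Summable fun l : ℕ => (-x) ^ l / ((l ! : ℝ) ^ 2) :=
  Summable.of_norm_bounded (Real.summable_pow_div_factorial |x|) (norm_besselTerm_le x)

/-- Bounding binomial coefficients by n^l gives a truncated exponential series. It serves as a
uniform bound because n x stays bounded in the scaling used. -/
lemma abs_laguerre_le (n : ℕ) {x : ℝ} (hx : 0 ≤ x) : |laguerre n x| ≤ Real.exp (n * x) := by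
  have h1 : ∀ l, |(n.choose l : ℝ) * (-x) ^ l / (l ! : ℝ)| ≤ (n * x) ^ l / (l ! : ℝ) := by
    intro l
    rw [abs_div, abs_mul, abs_pow, abs_neg, abs_of_nonneg hx, Nat.abs_cast, Nat.abs_cast, mul_pow]
    gcongr
    exact_mod_cast Nat.choose_le_pow n l
  calc |laguerre n x| ≤ ∑ l ∈ Finset.range (n + 1), (n * x) ^ l / (l ! : ℝ) :=
        (Finset.abs_sum_le_sum_abs _ _).trans (Finset.sum_le_sum fun l _ => h1 l)
    _ ≤ Real.exp (n * x) := Real.sum_le_exp_of_nonneg (by positivity) _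

lemma tendsto_choose_mul_pow {m : ℕ → ℕ} {y : ℕ → ℝ} {x : ℝ} (hy : Tendsto y atTop (𝓝 0))
    (hm : Tendsto m atTop atTop) (hmy : Tendsto (fun N => m N * y N) atTop (𝓝 x)) (l : ℕ) :
    Tendsto (fun N => ((m N).choose l : ℝ) * (y N) ^ l) atTop (𝓝 (x ^ l / (l ! : ℝ))) := by
  have h1 : Tendsto (fun N => ∏ i ∈ Finset.range l, ((m N : ℝ) * y N - i * y N)) atTop
      (𝓝 (∏ i ∈ Finset.range l, (x - i * 0))) :=
    tendsto_finsetProd _ fun i _ => hmy.sub (hy.const_mul _)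
  simp only [mul_zero, sub_zero, Finset.prod_const, Finset.card_range] at h1
  refine (h1.div_const (l ! : ℝ)).congr' ?_
  filter_upwards [hm.eventually_ge_atTop l] with N hN
  have h2 : ((m N).choose l : ℝ) = ((m N).descFactorial l : ℝ) / (l ! : ℝ) := by
    rw [Nat.descFactorial_eq_factorial_mul_choose]
    push_cast
    field_simp
  rw [h2, Nat.descFactorial_eq_prod_range]
  push_cast
  rw [div_mul_eq_mul_div]
  congr 1
  rw [← Finset.card_range l, ← Finset.prod_const, Finset.card_range, ← Finset.prod_mul_distrib]
  refine Finset.prod_congr rfl fun i hi => ?_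
  rw [Nat.cast_sub (by have := Finset.mem_range.1 hi; omega)]
  ring

lemma laguerre_eq_tsum (n : ℕ) (x : ℝ) :
    laguerre n x = ∑' l : ℕ, (n.choose l : ℝ) * (-x) ^ l / (l ! : ℝ) := by
  rw [tsum_eq_sum (s := Finset.range (n + 1)), laguerre]
  intro l hl
  rw [Nat.choose_eq_zero_of_lt (by simpa using hl)]
  simp

/-- Mehler–Heine asymptotics: with m y tending to x, each product C(m,l) y^l tends to x^l/l!, and
B^l/l! dominates the terms. -/
lemma tendsto_laguerre {m : ℕ → ℕ} {y : ℕ → ℝ} {x B : ℝ} (hy : Tendsto y atTop (𝓝 0))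
    (hm : Tendsto m atTop atTop) (hmy : Tendsto (fun N => m N * y N) atTop (𝓝 x))
    (hB : ∀ N, m N * |y N| ≤ B) :
    Tendsto (fun N => laguerre (m N) (y N)) atTop (𝓝 (besselSeries x)) := by
  simp only [laguerre_eq_tsum, besselSeries]
  have hB0 : 0 ≤ B := le_trans (by positivity) (hB 0)
  refine tendsto_tsum_of_dominated_convergence (Real.summable_pow_div_factorial B) ?_ ?_
  · intro l
    have h := (tendsto_choose_mul_pow hy hm hmy l).const_mul ((-1) ^ l / (l ! : ℝ))
    convert! h using 1
    · ext N; rw [neg_pow]; ring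
    · congr 1; rw [neg_pow]; field_simp
  · refine Eventually.of_forall fun N l => ?_
    rw [norm_div, norm_mul, norm_pow, norm_neg, Real.norm_natCast, Real.norm_natCast,
      Real.norm_eq_abs]
    have h1 : ((m N).choose l : ℝ) ≤ (m N : ℝ) ^ l := by exact_mod_cast Nat.choose_le_pow _ l
    gcongr
    calc _ ≤ (m N : ℝ) ^ l * |y N| ^ l := by gcongr
      _ = (m N * |y N|) ^ l := (mul_pow _ _ _).symm
      _ ≤ B ^ l := by gcongr; exact hB N

lemma integral_cos_pow_two_mul (i : ℕ) :
    ∫ θ in (-Real.pi)..Real.pi, Real.cos θ ^ (2 * i) =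
      2 * Real.pi * ((2 * i)! : ℝ) / (4 ^ i * (i ! : ℝ) ^ 2) := by
  induction i with
  | zero => simp; ring
  | succ i ih =>
    rw [show 2 * (i + 1) = 2 * i + 2 by ring, integral_cos_pow, ih]
    have h : ((2 * i + 2)! : ℝ) = (2 * i + 2) * (2 * i + 1) * ((2 * i)! : ℝ) := by
      rw [Nat.factorial_succ, Nat.factorial_succ]; push_cast; ring
    rw [h, Nat.factorial_succ i, pow_succ]
    simp only [Real.sin_pi, Real.sin_neg]
    push_cast
    field_simp
    ring

lemma integral_cos_pow_two_mul_add_one (i : ℕ) :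
    ∫ θ in (-Real.pi)..Real.pi, Real.cos θ ^ (2 * i + 1) = 0 := by
  induction i with
  | zero => simp
  | succ i ih =>
    rw [show 2 * (i + 1) + 1 = (2 * i + 1) + 2 by ring, integral_cos_pow, ih]
    simp

/-- The exponential series is integrated term by term; odd powers of the cosine vanish over a
period, and the even ones produce the squared factorials of J₀(x). -/
lemma integral_exp_cos (x : ℝ) :
    ∫ θ in (-Real.pi)..Real.pi, Complex.exp (Complex.I * (x * Real.cos θ : ℝ)) =
      2 * Real.pi * (besselSeries (x ^ 2 / 4) : ℂ) := by
  have h1 : HasSum (fun p : ℕ => ∫ θ in (-Real.pi)..Real.pi,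
      (Complex.I * (x * Real.cos θ : ℝ)) ^ p / (p ! : ℂ))
      (∫ θ in (-Real.pi)..Real.pi, Complex.exp (Complex.I * (x * Real.cos θ : ℝ))) := by
    refine intervalIntegral.hasSum_integral_of_dominated_convergence
      (fun p _ => |x| ^ p / (p ! : ℝ)) (fun p => ?_) (fun p => ?_) ?_ ?_ ?_
    · exact Continuous.aestronglyMeasurable (by fun_prop)
    · refine Eventually.of_forall fun θ _ => ?_
      rw [norm_div, norm_pow, norm_mul, Complex.norm_I, one_mul, Complex.norm_real,
        Complex.norm_natCast, Real.norm_eq_abs, abs_mul]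
      gcongr
      exact mul_le_of_le_one_right (abs_nonneg _) (Real.abs_cos_le_one θ)
    · exact Eventually.of_forall fun θ _ => Real.summable_pow_div_factorial |x|
    · exact intervalIntegrable_const
    · refine Eventually.of_forall fun θ _ => ?_
      have h := NormedSpace.expSeries_div_hasSum_exp (Complex.I * (x * Real.cos θ : ℝ))
      rwa [← Complex.exp_eq_exp_ℂ] at h
  have h2 : ∀ p : ℕ, ∫ θ in (-Real.pi)..Real.pi,
      (Complex.I * (x * Real.cos θ : ℝ)) ^ p / (p ! : ℂ) =
      (Complex.I * x) ^ p / (p ! : ℂ) *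
        ((∫ θ in (-Real.pi)..Real.pi, Real.cos θ ^ p : ℝ) : ℂ) := by
    intro p
    rw [← intervalIntegral.integral_ofReal, ← intervalIntegral.integral_const_mul]
    congr 1; ext θ
    push_cast; ring
  simp only [h2] at h1
  have h3 : HasSum (fun p : ℕ => (Complex.I * x) ^ p / (p ! : ℂ) *
        ((∫ θ in (-Real.pi)..Real.pi, Real.cos θ ^ p : ℝ) : ℂ))
      (2 * Real.pi * (besselSeries (x ^ 2 / 4) : ℂ) + 0) := by
    refine HasSum.even_add_odd ?_ ?_
    · have h4 := (Complex.hasSum_ofReal.2 (summable_besselTerm (x ^ 2 / 4)).hasSum).mul_left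
        (2 * Real.pi : ℂ)
      convert! h4 using 1
      ext i
      rw [integral_cos_pow_two_mul, pow_mul, mul_pow, Complex.I_sq]
      have : ((2 * i)! : ℂ) ≠ 0 := by exact_mod_cast (2 * i).factorial_ne_zero
      push_cast
      rw [← neg_div, div_pow, neg_one_mul]
      field_simp
    · simp [integral_cos_pow_two_mul_add_one, hasSum_zero]
  rw [add_zero] at h3
  exact h1.unique h3

end

section

open scoped ComplexConjugate Topology Nat

lemma continuous_besselSeries : Continuous besselSeries := by
  refine continuous_iff_continuousAt.2 fun x => ?_
  have h : ContinuousOn besselSeries (Metric.ball 0 (|x| + 1)) := by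
    refine continuousOn_tsum (u := fun l : ℕ => (|x| + 1) ^ l / (l ! : ℝ)) (fun l => by fun_prop)
      (Real.summable_pow_div_factorial _) fun l y hy => ?_
    refine (norm_besselTerm_le y l).trans ?_
    have : |y| ≤ |x| + 1 := by simpa using (mem_ball_zero_iff.1 hy).le
    gcongr
  exact h.continuousAt (Metric.isOpen_ball.mem_nhds (by simp))

/-! ### The limit law: the squared distance from a uniform point of the disk -/

/-- The law of `|U - r|²` for `U` uniformly distributed in the unit disk. -/
def diskLaw (r : ℝ) : Measure ℝ :=
  ((ENNReal.ofReal Real.pi)⁻¹ • (volume : Measure ℂ).restrict (Metric.ball 0 1)).map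
    (fun u : ℂ => ‖u - r‖ ^ 2)

lemma volume_unit_ball : (volume : Measure ℂ) (Metric.ball 0 1) = ENNReal.ofReal Real.pi := by
  rw [Complex.volume_ball]
  simp only [ENNReal.ofReal_one, one_pow, one_mul]
  rw [← NNReal.coe_real_pi, ENNReal.ofReal_coe_nnreal]

instance (r : ℝ) : IsProbabilityMeasure (diskLaw r) := by
  have : IsProbabilityMeasure
      ((ENNReal.ofReal Real.pi)⁻¹ • (volume : Measure ℂ).restrict (Metric.ball 0 1)) := by
    constructor
    rw [Measure.smul_apply, Measure.restrict_apply_univ, volume_unit_ball, smul_eq_mul]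
    exact ENNReal.inv_mul_cancel (by simpa using Real.pi_pos) (by simp)
  exact Measure.isProbabilityMeasure_map (by fun_prop)

lemma diskLaw_Iio (r : ℝ) : (diskLaw r).real (Set.Iio 1) = overlapKernel r := by
  have h : (fun u : ℂ => ‖u - r‖ ^ 2) ⁻¹' Set.Iio 1 = Metric.ball (r : ℂ) 1 := by
    ext u
    simp [dist_eq_norm]
  rw [measureReal_def, diskLaw, Measure.map_apply (by fun_prop) measurableSet_Iio, h,
    Measure.smul_apply, Measure.restrict_apply Metric.isOpen_ball.measurableSet, overlapKernel,
    Set.inter_comm, smul_eq_mul, ENNReal.toReal_mul, ENNReal.toReal_inv,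
    ENNReal.toReal_ofReal Real.pi_pos.le, div_eq_inv_mul]

lemma diskLaw_frontier (r : ℝ) : diskLaw r (frontier (Set.Iio 1)) = 0 := by
  have h : (fun u : ℂ => ‖u - r‖ ^ 2) ⁻¹' {1} = Metric.sphere (r : ℂ) 1 := by
    ext u
    rw [Set.mem_preimage, Set.mem_singleton_iff, mem_sphere_iff_norm,
      pow_eq_one_iff_of_nonneg (norm_nonneg _) two_ne_zero]
  rw [frontier_Iio, diskLaw, Measure.map_apply (by fun_prop) (measurableSet_singleton _), h,
    Measure.smul_apply]
  have : (volume : Measure ℂ).restrict (Metric.ball 0 1) (Metric.sphere (r : ℂ) 1) = 0 :=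
    le_antisymm ((Measure.restrict_apply_le _ _).trans (Measure.addHaar_sphere _ _ _).le) bot_le
  simp [this]

/-- In polar coordinates |u - r|² = ρ² + r² - 2rρ cos θ. The angular integral is a Bessel function,
and ν = ρ² turns 2ρ dρ into the uniform law on [0, 1]. -/
lemma charFun_diskLaw (r t : ℝ) :
    charFun (diskLaw r) t = ∫ ν in (0 : ℝ)..1, Complex.exp (Complex.I * (t * r ^ 2 : ℝ)) *
      (Complex.exp (Complex.I * (t * ν : ℝ)) * (besselSeries (r ^ 2 * t ^ 2 * ν) : ℂ)) := by
  set f : ℂ → ℂ := fun u => Complex.exp (t * (‖u - r‖ ^ 2 : ℝ) * Complex.I) with hf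
  have hfc : Continuous f := by fun_prop
  have h1 : charFun (diskLaw r) t = (Real.pi : ℂ)⁻¹ * ∫ u in Metric.ball (0 : ℂ) 1, f u := by
    rw [charFun_apply_real, diskLaw, integral_map (by fun_prop)
      (Continuous.aestronglyMeasurable (by fun_prop)), integral_smul_measure, ENNReal.toReal_inv,
      ENNReal.toReal_ofReal Real.pi_pos.le]
    simp [hf]
  have h2 : ∫ u in Metric.ball (0 : ℂ) 1, f u =
      ∫ p in Set.Ioo (0 : ℝ) 1 ×ˢ Set.Ioo (-Real.pi) Real.pi,
        p.1 • f (Complex.polarCoord.symm p) := by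
    rw [← integral_indicator Metric.isOpen_ball.measurableSet,
      ← Complex.integral_comp_polarCoord_symm]
    have e : ∀ p ∈ polarCoord.target, p.1 • (Metric.ball (0 : ℂ) 1).indicator f
        (Complex.polarCoord.symm p) = (Set.Iio (1 : ℝ) ×ˢ (Set.univ : Set ℝ)).indicator
          (fun p => p.1 • f (Complex.polarCoord.symm p)) p := by
      rintro p hp
      have hp0 : 0 < p.1 := hp.1
      have hmem : Complex.polarCoord.symm p ∈ Metric.ball (0 : ℂ) 1 ↔ p.1 < 1 := by
        rw [mem_ball_zero_iff, Complex.norm_polarCoord_symm, abs_of_pos hp0]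
      by_cases h : p.1 < 1
      · rw [Set.indicator_of_mem (hmem.2 h), Set.indicator_of_mem (by simpa using h)]
      · rw [Set.indicator_of_notMem (mt hmem.1 h), Set.indicator_of_notMem (by simpa using h),
          smul_zero]
    rw [setIntegral_congr_fun polarCoord.open_target.measurableSet e,
      setIntegral_indicator (measurableSet_Iio.prod MeasurableSet.univ)]
    congr 2
    ext p
    simp only [polarCoord_target, Set.mem_inter_iff, Set.mem_prod, Set.mem_Ioi, Set.mem_Ioo,
      Set.mem_Iio, Set.mem_univ, and_true]
    tauto
  have hfp : ∀ ρ θ : ℝ, f (Complex.polarCoord.symm (ρ, θ)) =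
      Complex.exp (Complex.I * (t * r ^ 2 : ℝ)) * Complex.exp (Complex.I * (t * ρ ^ 2 : ℝ)) *
        Complex.exp (Complex.I * ((-(2 * t * r * ρ)) * Real.cos θ : ℝ)) := by
    intro ρ θ
    have : ‖Complex.polarCoord.symm (ρ, θ) - r‖ ^ 2 = ρ ^ 2 + r ^ 2 - 2 * r * ρ * Real.cos θ := by
      rw [← Complex.normSq_eq_norm_sq, Complex.normSq_apply, Complex.polarCoord_symm_apply]
      simp [-Complex.ofReal_cos, -Complex.ofReal_sin]
      linear_combination ρ ^ 2 * Real.sin_sq_add_cos_sq θ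
    rw [← Complex.exp_add, ← Complex.exp_add]
    simp only [hf, this]
    congr 1
    push_cast; ring
  have h3 : ∫ p in Set.Ioo (0 : ℝ) 1 ×ˢ Set.Ioo (-Real.pi) Real.pi,
        p.1 • f (Complex.polarCoord.symm p) =
      ∫ ρ in Set.Ioo (0 : ℝ) 1, ∫ θ in Set.Ioo (-Real.pi) Real.pi,
        ρ • f (Complex.polarCoord.symm (ρ, θ)) := by
    rw [Measure.volume_eq_prod, setIntegral_prod]
    have hc : Continuous fun p : ℝ × ℝ => p.1 • f (Complex.polarCoord.symm p) := by
      have : Continuous fun p : ℝ × ℝ => Complex.polarCoord.symm p := by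
        simp only [Complex.polarCoord_symm_apply]; fun_prop
      fun_prop
    refine IntegrableOn.mono_set (t := Set.Icc (0 : ℝ) 1 ×ˢ Set.Icc (-Real.pi) Real.pi) ?_
      (Set.prod_mono Set.Ioo_subset_Icc_self Set.Ioo_subset_Icc_self)
    exact hc.continuousOn.integrableOn_compact (isCompact_Icc.prod isCompact_Icc)
  have h4 : ∀ ρ : ℝ, ∫ θ in Set.Ioo (-Real.pi) Real.pi, ρ • f (Complex.polarCoord.symm (ρ, θ)) =
      Real.pi * (Complex.exp (Complex.I * (t * r ^ 2 : ℝ)) *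
        (Complex.exp (Complex.I * (t * ρ ^ 2 : ℝ)) * (besselSeries (r ^ 2 * t ^ 2 * ρ ^ 2) : ℂ))) *
          (2 * ρ : ℝ) := by
    intro ρ
    simp only [hfp]
    rw [integral_smul, integral_const_mul, ← integral_Ioc_eq_integral_Ioo,
      ← intervalIntegral.integral_of_le (by linarith [Real.pi_pos]), integral_exp_cos]
    have : (-(2 * t * r * ρ)) ^ 2 / 4 = r ^ 2 * t ^ 2 * ρ ^ 2 := by ring
    rw [this, Complex.real_smul]
    push_cast; ring
  have h5 := intervalIntegral.integral_deriv_smul_comp (a := 0) (b := 1) (f := fun ρ : ℝ => ρ ^ 2)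
    (f' := fun ρ => 2 * ρ) (g := fun ν : ℝ => Complex.exp (Complex.I * (t * r ^ 2 : ℝ)) *
      (Complex.exp (Complex.I * (t * ν : ℝ)) * (besselSeries (r ^ 2 * t ^ 2 * ν) : ℂ)))
    (fun x _ => by simpa using hasDerivAt_pow 2 x) (by fun_prop)
    (by have := continuous_besselSeries; fun_prop)
  simp only [zero_pow two_ne_zero, one_pow] at h5
  rw [h1, h2, h3, ← h5, intervalIntegral.integral_of_le zero_le_one, integral_Ioc_eq_integral_Ioo,
    ← integral_const_mul]
  congr 1
  ext ρ
  rw [h4, Function.comp_apply, Complex.real_smul]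
  have : (Real.pi : ℂ) ≠ 0 := by exact_mod_cast Real.pi_ne_zero
  field_simp

/-! ### The prelimit law -/

/-- The law of `k / N` where `k` has distribution `|D_{n k}(z)|²`. -/
def rowLaw (n : ℕ) (z : ℂ) (N : ℕ) : Measure ℝ :=
  Measure.sum fun k : ℕ => ENNReal.ofReal (‖displacement n k z‖ ^ 2) • Measure.dirac (k / N : ℝ)

instance (n : ℕ) (z : ℂ) (N : ℕ) : IsProbabilityMeasure (rowLaw n z N) := by
  constructor
  rw [rowLaw, Measure.sum_apply _ MeasurableSet.univ]
  simp only [Measure.smul_apply, measure_univ, smul_eq_mul, mul_one]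
  rw [← ENNReal.ofReal_tsum_of_nonneg (fun _ => by positivity)
    (hasSum_normSq_displacement n z).summable, (hasSum_normSq_displacement n z).tsum_eq]
  simp

lemma rowLaw_Iio (n : ℕ) (z : ℂ) {N : ℕ} (hN : 1 ≤ N) :
    (rowLaw n z N) (Set.Iio 1) =
      ENNReal.ofReal (∑ k ∈ Finset.range N, ‖displacement n k z‖ ^ 2) := by
  have hN0 : (0 : ℝ) < N := by positivity
  rw [rowLaw, Measure.sum_apply _ measurableSet_Iio, tsum_eq_sum (s := Finset.range N),
    ENNReal.ofReal_sum_of_nonneg (fun _ _ => by positivity)]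
  · refine Finset.sum_congr rfl fun k hk => ?_
    have : (k : ℝ) / N < 1 := by
      rw [div_lt_one hN0]; exact_mod_cast Finset.mem_range.1 hk
    simp [this]
  · intro k hk
    have : ¬ (k : ℝ) / N < 1 := by
      rw [div_lt_one hN0]; exact_mod_cast fun h => hk (Finset.mem_range.2 h)
    simp [this]

lemma integral_rowLaw (n : ℕ) (z : ℂ) (N : ℕ) (t : ℝ) :
    ∫ x, Complex.exp (t * x * Complex.I) ∂(rowLaw n z N) =
      Complex.exp ((t / N : ℝ) * Complex.I) ^ n *
        Complex.exp (Complex.I * (‖z‖ ^ 2 * Real.sin (t / N) : ℝ)) *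
        ((Real.exp (-(‖1 - Complex.exp ((t / N : ℝ) * Complex.I)‖ ^ 2 * ‖z‖ ^ 2) / 2) *
          laguerre n (‖1 - Complex.exp ((t / N : ℝ) * Complex.I)‖ ^ 2 * ‖z‖ ^ 2) : ℝ) : ℂ) := by
  rw [rowLaw, integral_sum_dirac (fun _ => by simp)]
  rw [← Complex.exp_ofReal_mul_I_im (t / N),
    ← (hasSum_normSq_displacement_mul_pow (Complex.norm_exp_ofReal_mul_I (t / N)) n z).tsum_eq]
  refine tsum_congr fun k => ?_
  rw [ENNReal.toReal_ofReal (by positivity), ← Complex.exp_nat_mul, Complex.real_smul]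
  congr 2
  push_cast; ring

/-- The law of `k / N`, where `n` is uniform in `{0, …, N-1}` and `k` has conditional distribution
`|D_{n k}(√N r)|²`. -/
def overlapLaw (r : ℝ) (N : ℕ) : Measure ℝ :=
  ENNReal.ofReal (1 / N) • ∑ n ∈ Finset.range N, rowLaw n ((Real.sqrt N * r : ℝ) : ℂ) N

lemma isProbabilityMeasure_overlapLaw (r : ℝ) {N : ℕ} (hN : 1 ≤ N) :
    IsProbabilityMeasure (overlapLaw r N) := by
  constructor
  have h0 : (N : ℝ) ≠ 0 := by positivity
  rw [overlapLaw, Measure.smul_apply, Measure.finsetSum_apply]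
  simp only [measure_univ, Finset.sum_const, Finset.card_range, smul_eq_mul, nsmul_eq_mul, mul_one]
  rw [← ENNReal.ofReal_natCast, ← ENNReal.ofReal_mul (by positivity), one_div_mul_cancel h0]
  simp

lemma overlapLaw_Iio (r : ℝ) {N : ℕ} (hN : 1 ≤ N) :
    (overlapLaw r N).real (Set.Iio 1) = prelimitKernel N r := by
  rw [measureReal_def, overlapLaw, Measure.smul_apply, Measure.finsetSum_apply]
  simp only [rowLaw_Iio _ _ hN]
  rw [← ENNReal.ofReal_sum_of_nonneg (fun _ _ => by positivity), smul_eq_mul,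
    ← ENNReal.ofReal_mul (by positivity), ENNReal.toReal_ofReal (by positivity), prelimitKernel]

/-- An average over n < N becomes an integral over ν in [0, 1] with n = ⌊νN⌋, the same form as the
characteristic function of the disk law. -/
lemma integral_comp_floor (g : ℕ → ℂ) {N : ℕ} (hN : 1 ≤ N) :
    ∫ ν in (0 : ℝ)..1, g ⌊ν * N⌋₊ = (1 / N : ℝ) * ∑ n ∈ Finset.range N, g n := by
  have hN0 : (0 : ℝ) < N := by positivity
  have key : ∀ n : ℕ, Set.EqOn (fun ν : ℝ => g ⌊ν * N⌋₊) (fun _ => g n)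
      (Set.Ioo ((n : ℝ) / N) ((n + 1 : ℕ) / N)) := by
    intro n ν hν
    have h1 := (div_lt_iff₀ hN0).1 hν.1
    have h2 := (lt_div_iff₀ hN0).1 hν.2
    have : ⌊ν * N⌋₊ = n := by
      rw [Nat.floor_eq_iff ((Nat.cast_nonneg n).trans h1.le)]
      exact ⟨h1.le, by exact_mod_cast h2⟩
    simp only [this]
  have hle : ∀ n : ℕ, (n : ℝ) / N ≤ ((n + 1 : ℕ) : ℝ) / N := by
    intro n; gcongr; simp
  have hae : ∀ n : ℕ, ∀ᵐ ν : ℝ, ν ∈ Set.uIoc ((n : ℝ) / N) ((n + 1 : ℕ) / N) →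
      g ⌊ν * N⌋₊ = g n := by
    intro n
    have : ∀ᵐ ν : ℝ, ν ≠ ((n + 1 : ℕ) : ℝ) / N := by
      simp [ae_iff]
    filter_upwards [this] with ν hν hν'
    rw [Set.uIoc_of_le (hle n)] at hν'
    exact key n ⟨hν'.1, lt_of_le_of_ne hν'.2 hν⟩
  have hint : ∀ n < N, IntervalIntegrable (fun ν : ℝ => g ⌊ν * N⌋₊) volume
      ((n : ℝ) / N) ((n + 1 : ℕ) / N) := by
    intro n _
    refine (intervalIntegrable_const (c := g n)).congr_ae ?_
    rw [EventuallyEq, ae_restrict_iff' measurableSet_uIoc]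
    filter_upwards [hae n] with ν hν hν'
    exact (hν hν').symm
  have h := intervalIntegral.sum_integral_adjacent_intervals
    (a := fun n : ℕ => (n : ℝ) / N) hint
  simp only [Nat.cast_zero, zero_div, div_self hN0.ne'] at h
  rw [← h, Finset.mul_sum]
  refine Finset.sum_congr rfl fun n _ => ?_
  rw [intervalIntegral.integral_congr_ae (hae n), intervalIntegral.integral_const,
    Complex.real_smul]
  congr 1
  push_cast
  ring

lemma charFun_overlapLaw (r t : ℝ) {N : ℕ} (hN : 1 ≤ N) :
    charFun (overlapLaw r N) t = ∫ ν in (0 : ℝ)..1,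
      Complex.exp ((t / N : ℝ) * Complex.I) ^ ⌊ν * N⌋₊ *
        Complex.exp (Complex.I * (N * r ^ 2 * Real.sin (t / N) : ℝ)) *
        ((Real.exp (-(‖1 - Complex.exp ((t / N : ℝ) * Complex.I)‖ ^ 2 * (N * r ^ 2)) / 2) *
          laguerre ⌊ν * N⌋₊
            (‖1 - Complex.exp ((t / N : ℝ) * Complex.I)‖ ^ 2 * (N * r ^ 2)) : ℝ) : ℂ) := by
  have hz : ‖((Real.sqrt N * r : ℝ) : ℂ)‖ ^ 2 = N * r ^ 2 := by
    rw [Complex.norm_real, Real.norm_eq_abs, sq_abs, mul_pow, Real.sq_sqrt (by positivity)]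
  rw [integral_comp_floor (fun n => Complex.exp ((t / N : ℝ) * Complex.I) ^ n *
    Complex.exp (Complex.I * (N * r ^ 2 * Real.sin (t / N) : ℝ)) *
        ((Real.exp (-(‖1 - Complex.exp ((t / N : ℝ) * Complex.I)‖ ^ 2 * (N * r ^ 2)) / 2) *
          laguerre n
            (‖1 - Complex.exp ((t / N : ℝ) * Complex.I)‖ ^ 2 * (N * r ^ 2)) : ℝ) : ℂ)) hN,
    charFun_apply_real, overlapLaw, integral_smul_measure, integral_finsetSum_measure]
  · rw [ENNReal.toReal_ofReal (by positivity), Complex.real_smul]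
    simp only [integral_rowLaw, hz]
  · intro n _
    refine (integrable_const (1 : ℝ)).mono' (Continuous.aestronglyMeasurable (by fun_prop)) ?_
    refine Eventually.of_forall fun x => le_of_eq ?_
    rw [← Complex.ofReal_mul, Complex.norm_exp_ofReal_mul_I]

lemma norm_one_sub_exp_sq (x : ℝ) :
    ‖1 - Complex.exp (x * Complex.I)‖ ^ 2 = (2 * Real.sin (x / 2)) ^ 2 := by
  rw [← Complex.normSq_eq_norm_sq, Complex.normSq_apply]
  have h : Real.cos x = 1 - 2 * Real.sin (x / 2) ^ 2 := by
    have := Real.cos_two_mul (x / 2)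
    rw [mul_div_cancel₀ _ two_ne_zero] at this
    linarith [Real.sin_sq_add_cos_sq (x / 2)]
  simp only [Complex.sub_re, Complex.sub_im, Complex.one_re, Complex.one_im,
    Complex.exp_ofReal_mul_I_re, Complex.exp_ofReal_mul_I_im]
  linear_combination Real.sin_sq_add_cos_sq x - 2 * h

lemma tendsto_mul_sin_div (t : ℝ) :
    Tendsto (fun N : ℕ => (N : ℝ) * Real.sin (t / N)) atTop (𝓝 t) := by
  have h1 : HasDerivAt (fun x => Real.sin (t * x)) t 0 := by
    have h : HasDerivAt (fun x => t * x) t 0 := by simpa using (hasDerivAt_id (0 : ℝ)).const_mul t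
    simpa using h.sin
  have h2 := h1.tendsto_slope_zero_right
  have h3 : Tendsto (fun N : ℕ => (N : ℝ)⁻¹) atTop (𝓝[>] 0) := by
    refine tendsto_nhdsWithin_iff.2 ⟨tendsto_inv_atTop_nhds_zero_nat, ?_⟩
    filter_upwards [eventually_gt_atTop 0] with N hN
    simpa using hN
  refine (h2.comp h3).congr fun N => ?_
  simp [div_eq_mul_inv]

/-- With c = e^{it/N} the Laguerre argument is y_N = 4 sin²(t/2N) N r², so N y_N tends to r²t²,
while the index ⌊νN⌋ is asymptotic to νN. The phase N r² sin(t/N) tends to t r². The integrands are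
bounded by e^{r²t²}. -/
lemma tendsto_charFun_overlapLaw (r t : ℝ) :
    Tendsto (fun N => charFun (overlapLaw r N) t) atTop (𝓝 (charFun (diskLaw r) t)) := by
  rw [charFun_diskLaw]
  set y : ℕ → ℝ := fun N => ‖1 - Complex.exp ((t / N : ℝ) * Complex.I)‖ ^ 2 * (N * r ^ 2) with hy
  have hy0 : ∀ N, 0 ≤ y N := fun N => by positivity
  have hNy : Tendsto (fun N : ℕ => N * y N) atTop (𝓝 (r ^ 2 * t ^ 2)) := by
    have h := ((tendsto_mul_sin_div (t / 2)).pow 2).const_mul (4 * r ^ 2)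
    convert! h using 1
    · ext N
      simp only [hy, norm_one_sub_exp_sq]
      rw [div_right_comm]; ring
    · congr 1; ring
  have hyt : Tendsto y atTop (𝓝 0) := by
    have h := hNy.mul tendsto_inv_atTop_nhds_zero_nat
    rw [mul_zero] at h
    refine h.congr' ?_
    filter_upwards [eventually_gt_atTop 0] with N hN
    have : (N : ℝ) ≠ 0 := by positivity
    field_simp
  have hbd : ∀ N : ℕ, N * y N ≤ r ^ 2 * t ^ 2 := by
    intro N
    rcases Nat.eq_zero_or_pos N with rfl | hN
    · simp; positivity
    have hN0 : (0 : ℝ) < N := by exact_mod_cast hN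
    have h1 : (2 * Real.sin (t / N / 2)) ^ 2 ≤ (t / N) ^ 2 := by
      rw [sq_le_sq, abs_mul, abs_two]
      have := Real.abs_sin_le_abs (x := t / N / 2)
      rw [abs_div _ (2 : ℝ), abs_two] at this
      linarith
    simp only [hy, norm_one_sub_exp_sq]
    calc (N : ℝ) * ((2 * Real.sin (t / N / 2)) ^ 2 * (N * r ^ 2))
        ≤ N * ((t / N) ^ 2 * (N * r ^ 2)) := by gcongr
      _ = r ^ 2 * t ^ 2 := by field_simp
  have hfl : ∀ ν ∈ Set.Ioc (0 : ℝ) 1, ∀ N : ℕ, (⌊ν * N⌋₊ : ℝ) ≤ N := by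
    intro ν hν N
    have h1 : (⌊ν * N⌋₊ : ℝ) ≤ ν * N := Nat.floor_le (mul_nonneg hν.1.le (Nat.cast_nonneg _))
    exact h1.trans (mul_le_of_le_one_left (Nat.cast_nonneg _) hν.2)
  have hfd : ∀ ν ∈ Set.Ioc (0 : ℝ) 1,
      Tendsto (fun N : ℕ => (⌊ν * N⌋₊ : ℝ) / N) atTop (𝓝 ν) := fun ν hν =>
    (tendsto_nat_floor_mul_div_atTop hν.1.le).comp tendsto_natCast_atTop_atTop
  have key : Tendsto (fun N : ℕ => ∫ ν in (0 : ℝ)..1,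
      Complex.exp ((t / N : ℝ) * Complex.I) ^ ⌊ν * N⌋₊ *
        Complex.exp (Complex.I * (N * r ^ 2 * Real.sin (t / N) : ℝ)) *
        ((Real.exp (-y N / 2) * laguerre ⌊ν * N⌋₊ (y N) : ℝ) : ℂ)) atTop
      (𝓝 (∫ ν in (0 : ℝ)..1, Complex.exp (Complex.I * (t * r ^ 2 : ℝ)) *
      (Complex.exp (Complex.I * (t * ν : ℝ)) * (besselSeries (r ^ 2 * t ^ 2 * ν) : ℂ)))) := by
    refine intervalIntegral.tendsto_integral_filter_of_dominated_convergence
      (fun _ => Real.exp (r ^ 2 * t ^ 2)) ?_ ?_ intervalIntegrable_const ?_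
    · refine Eventually.of_forall fun N => Measurable.aestronglyMeasurable ?_
      exact (measurable_from_nat (f := fun n => Complex.exp ((t / N : ℝ) * Complex.I) ^ n *
        Complex.exp (Complex.I * (N * r ^ 2 * Real.sin (t / N) : ℝ)) *
        ((Real.exp (-y N / 2) * laguerre n (y N) : ℝ) : ℂ))).comp
        (Nat.measurable_floor.comp (measurable_id.mul_const _))
    · refine Eventually.of_forall fun N => Eventually.of_forall fun ν hν => ?_
      rw [Set.uIoc_of_le zero_le_one] at hν
      rw [norm_mul, norm_mul, norm_pow, Complex.norm_exp_ofReal_mul_I, mul_comm Complex.I,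
        Complex.norm_exp_ofReal_mul_I, one_pow, one_mul, one_mul, Complex.norm_real,
        Real.norm_eq_abs, abs_mul, Real.abs_exp]
      have h1 : Real.exp (-y N / 2) ≤ 1 := Real.exp_le_one_iff.2 (by linarith [hy0 N])
      have h2 : |laguerre ⌊ν * N⌋₊ (y N)| ≤ Real.exp (r ^ 2 * t ^ 2) := by
        refine (abs_laguerre_le _ (hy0 N)).trans (Real.exp_le_exp.2 ?_)
        exact (mul_le_mul_of_nonneg_right (hfl ν hν N) (hy0 N)).trans (hbd N)
      calc _ ≤ 1 * Real.exp (r ^ 2 * t ^ 2) := by gcongr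
        _ = _ := one_mul _
    · refine Eventually.of_forall fun ν hν => ?_
      rw [Set.uIoc_of_le zero_le_one] at hν
      have hexp : Tendsto (fun N : ℕ => Complex.exp ((t / N : ℝ) * Complex.I) ^ ⌊ν * N⌋₊) atTop
          (𝓝 (Complex.exp (Complex.I * (t * ν : ℝ)))) := by
        have h1 : Tendsto (fun N : ℕ => Complex.exp (Complex.I * (t * ((⌊ν * N⌋₊ : ℝ) / N) : ℝ)))
            atTop (𝓝 (Complex.exp (Complex.I * (t * ν : ℝ)))) := by
          have hc : Continuous fun x : ℝ => Complex.exp (Complex.I * (t * x : ℝ)) := by fun_prop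
          exact (hc.tendsto ν).comp (hfd ν hν)
        refine h1.congr fun N => ?_
        rw [← Complex.exp_nat_mul]
        congr 1
        push_cast; ring
      have hphase : Tendsto (fun N : ℕ =>
          Complex.exp (Complex.I * (N * r ^ 2 * Real.sin (t / N) : ℝ))) atTop
          (𝓝 (Complex.exp (Complex.I * (t * r ^ 2 : ℝ)))) := by
        have hc : Continuous fun x : ℝ => Complex.exp (Complex.I * (x * r ^ 2 : ℝ)) := by fun_prop
        refine ((hc.tendsto t).comp (tendsto_mul_sin_div t)).congr fun N => ?_
        simp only [Function.comp_apply]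
        congr 3; ring
      have hm : Tendsto (fun N : ℕ => ⌊ν * N⌋₊) atTop atTop :=
        tendsto_nat_floor_atTop.comp (tendsto_natCast_atTop_atTop.const_mul_atTop hν.1)
      have hlag : Tendsto (fun N : ℕ => laguerre ⌊ν * N⌋₊ (y N)) atTop
          (𝓝 (besselSeries (r ^ 2 * t ^ 2 * ν))) := by
        refine tendsto_laguerre (B := r ^ 2 * t ^ 2) hyt hm ?_ fun N => ?_
        · refine (hNy.mul (hfd ν hν)).congr' ?_
          filter_upwards [eventually_gt_atTop 0] with N hN
          have : (N : ℝ) ≠ 0 := by positivity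
          field_simp
        · rw [abs_of_nonneg (hy0 N)]
          exact (mul_le_mul_of_nonneg_right (hfl ν hν N) (hy0 N)).trans (hbd N)
      have hE : Tendsto (fun N : ℕ => Real.exp (-y N / 2)) atTop (𝓝 1) := by
        have hc : Continuous fun x : ℝ => Real.exp (-x / 2) := by fun_prop
        simpa [Function.comp_def] using (hc.tendsto 0).comp hyt
      have h1 := (hE.mul hlag)
      rw [one_mul] at h1
      have h2 := (Complex.continuous_ofReal.tendsto _).comp h1
      have h3 := (hexp.mul hphase).mul h2
      convert! h3 using 1
      congr 1; ring
  refine key.congr' ?_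
  filter_upwards [eventually_ge_atTop 1] with N hN
  exact (charFun_overlapLaw r t hN).symm

/-- Lévy's continuity theorem gives weak convergence of the laws; the half-line below 1 is a
continuity set of the limit because circles have area zero. -/
theorem tendsto_prelimitKernel (r : ℝ) :
    Tendsto (fun N => prelimitKernel N r) atTop (𝓝 (overlapKernel r)) := by
  -- For N = 0 the law is the zero measure, so the sequence is shifted by one.
  have hp : ∀ N : ℕ, IsProbabilityMeasure (overlapLaw r (N + 1)) := fun N =>
    isProbabilityMeasure_overlapLaw r (Nat.le_add_left 1 N)
  let μ : ℕ → ProbabilityMeasure ℝ := fun N => ⟨overlapLaw r (N + 1), hp N⟩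
  let μ₀ : ProbabilityMeasure ℝ := ⟨diskLaw r, inferInstance⟩
  have h1 : Tendsto μ atTop (𝓝 μ₀) :=
    ProbabilityMeasure.tendsto_of_tendsto_charFun fun t =>
      (tendsto_charFun_overlapLaw r t).comp (tendsto_add_atTop_nat 1)
  have h2 := ProbabilityMeasure.tendsto_measure_of_null_frontier_of_tendsto' h1
    (diskLaw_frontier r)
  have h3 := (ENNReal.tendsto_toReal (measure_ne_top (diskLaw r) (Set.Iio 1))).comp h2
  rw [← tendsto_add_atTop_iff_nat 1, ← diskLaw_Iio]
  refine h3.congr fun N => ?_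
  rw [← overlapLaw_Iio r (Nat.le_add_left 1 N)]
  rfl

lemma one_sub_overlapKernel_le {r : ℝ} (hr : 0 ≤ r) : 1 - overlapKernel r ≤ 2 * r :=
  le_of_tendsto (tendsto_const_nhds.sub (tendsto_prelimitKernel r)) <| by
    filter_upwards [eventually_ge_atTop 1] with N hN using one_sub_prelimitKernel_le hN hr

end

section

open scoped ComplexConjugate Topology InnerProductSpace

/-! ### The standard complex Gaussian law -/

instance : IsProbabilityMeasure stdComplexGaussian :=
  Measure.isProbabilityMeasure_map Complex.measurableEquivRealProd.symm.measurable.aemeasurable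

lemma integral_stdComplexGaussian (f : ℂ → ℂ) :
    ∫ z, f z ∂stdComplexGaussian = ∫ p : ℝ × ℝ, f (⟨p.1, p.2⟩)
      ∂((gaussianReal 0 (1 / 2)).prod (gaussianReal 0 (1 / 2))) := by
  rw [stdComplexGaussian, integral_map_equiv]
  rfl

lemma charFun_stdComplexGaussian (t : ℂ) :
    charFun stdComplexGaussian t = Complex.exp (-(‖t‖ ^ 2 : ℝ) / 4) := by
  have h1 : ∀ p : ℝ × ℝ, Complex.exp ((⟪(⟨p.1, p.2⟩ : ℂ), t⟫_ℝ : ℝ) * Complex.I) =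
      Complex.exp (t.re * p.1 * Complex.I) * Complex.exp (t.im * p.2 * Complex.I) := by
    intro p
    rw [← Complex.exp_add, Complex.inner]
    congr 1
    simp
    ring
  rw [charFun_apply, integral_stdComplexGaussian]
  simp only [h1]
  rw [integral_prod_mul (fun x : ℝ => Complex.exp (t.re * x * Complex.I))
    (fun y : ℝ => Complex.exp (t.im * y * Complex.I)), ← charFun_apply_real, ← charFun_apply_real,
    charFun_gaussianReal, charFun_gaussianReal, ← Complex.exp_add, ← Complex.normSq_eq_norm_sq,
    Complex.normSq_apply]
  congr 1
  push_cast
  ring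

/-- The square removes the branch of the complex square root, and it is the quantity needed: the
real and imaginary parts contribute equal factors. -/
lemma integral_exp_mul_sq_gaussianReal {c : ℂ} (hc : c.re < 1) :
    (∫ x, Complex.exp (c * (x : ℂ) ^ 2) ∂(gaussianReal 0 (1 / 2))) ^ 2 = (1 - c)⁻¹ := by
  have h2 : (1 / 2 : ℝ≥0) ≠ 0 := by norm_num
  have hre : 0 < (1 - c).re := by simpa using hc
  have h1 : ∀ x : ℝ, gaussianPDFReal 0 (1 / 2) x • Complex.exp (c * (x : ℂ) ^ 2) =
      ((Real.sqrt Real.pi)⁻¹ : ℝ) * Complex.exp (-(1 - c) * (x : ℂ) ^ 2) := by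
    intro x
    have e1 : (2 * Real.pi * ((1 / 2 : ℝ≥0) : ℝ)) = Real.pi := by push_cast; ring
    have e2 : -(x - 0) ^ 2 / (2 * ((1 / 2 : ℝ≥0) : ℝ)) = -x ^ 2 := by push_cast; ring
    rw [gaussianPDFReal, e1, e2, Complex.real_smul]
    push_cast
    rw [mul_assoc, ← Complex.exp_add]
    congr 2; ring
  rw [integral_gaussianReal_eq_integral_smul h2]
  simp only [h1]
  rw [integral_const_mul, integral_gaussian_complex hre, mul_pow, ← Complex.cpow_nat_mul]
  have hpi : (Real.pi : ℂ) ≠ 0 := by exact_mod_cast Real.pi_ne_zero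
  have e3 : (((Real.sqrt Real.pi)⁻¹ : ℝ) : ℂ) ^ 2 = (Real.pi : ℂ)⁻¹ := by
    rw [← Complex.ofReal_pow, inv_pow, Real.sq_sqrt Real.pi_pos.le, Complex.ofReal_inv]
  rw [e3]
  norm_num
  field_simp

lemma integral_exp_mul_normSq {c : ℂ} (hc : c.re < 1) :
    ∫ z : ℂ, Complex.exp (c * (‖z‖ ^ 2 : ℝ)) ∂stdComplexGaussian = (1 - c)⁻¹ := by
  have h1 : ∀ p : ℝ × ℝ, Complex.exp (c * (‖(⟨p.1, p.2⟩ : ℂ)‖ ^ 2 : ℝ)) =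
      Complex.exp (c * (p.1 : ℂ) ^ 2) * Complex.exp (c * (p.2 : ℂ) ^ 2) := by
    intro p
    rw [← Complex.exp_add, ← Complex.normSq_eq_norm_sq, Complex.normSq_apply]
    push_cast
    congr 1; ring
  rw [integral_stdComplexGaussian]
  simp only [h1]
  rw [integral_prod_mul (fun x : ℝ => Complex.exp (c * (x : ℂ) ^ 2))
    (fun x : ℝ => Complex.exp (c * (x : ℂ) ^ 2)), ← sq, integral_exp_mul_sq_gaussianReal hc]

/-! ### Finite-dimensional Gaussian quadratic forms -/

/-- The standard Gaussian law on `ℂ^M`. -/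
def stdComplexGaussianPi (M : ℕ) : Measure (EuclideanSpace ℂ (Fin M)) :=
  (Measure.pi fun _ : Fin M => stdComplexGaussian).map (WithLp.toLp 2)

instance (M : ℕ) : IsProbabilityMeasure (stdComplexGaussianPi M) :=
  Measure.isProbabilityMeasure_map (by fun_prop)

lemma charFun_stdComplexGaussianPi {M : ℕ} (t : EuclideanSpace ℂ (Fin M)) :
    charFun (stdComplexGaussianPi M) t = Complex.exp (-(‖t‖ ^ 2 : ℝ) / 4) := by
  have h := charFun_pi (μ := fun _ : Fin M => stdComplexGaussian) t
  have h2 : ∏ i, charFun stdComplexGaussian (t i) = Complex.exp (-(‖t‖ ^ 2 : ℝ) / 4) := by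
    simp only [charFun_stdComplexGaussian]
    rw [← Complex.exp_sum, EuclideanSpace.norm_sq_eq]
    push_cast
    rw [← Finset.sum_div, Finset.sum_neg_distrib]
  rw [← h2]
  exact h

/-- The characteristic function depends only on the norm, hence the law is unitarily invariant. -/
lemma map_stdComplexGaussianPi {M : ℕ}
    (f : EuclideanSpace ℂ (Fin M) ≃ₗᵢ[ℂ] EuclideanSpace ℂ (Fin M)) :
    (stdComplexGaussianPi M).map f = stdComplexGaussianPi M := by
  have hf : Measurable f := f.continuous.measurable
  have := Measure.isProbabilityMeasure_map (μ := stdComplexGaussianPi M) hf.aemeasurable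
  refine Measure.ext_of_charFun (funext fun t => ?_)
  have h1 : charFun ((stdComplexGaussianPi M).map f) t =
      charFun (stdComplexGaussianPi M) (f.symm t) := by
    rw [charFun_apply, charFun_apply, integral_map hf.aemeasurable
      (Continuous.aestronglyMeasurable (by fun_prop))]
    congr 1
    ext x
    congr 3
    have h : ∀ x y : EuclideanSpace ℂ (Fin M), ⟪x, y⟫_ℝ = (⟪x, y⟫_ℂ).re := by
      intro x y
      simp [PiLp.inner_apply, Complex.inner]
    rw [h, h]
    conv_lhs => rw [← f.apply_symm_apply t]
    rw [f.inner_map_map]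
  rw [h1, charFun_stdComplexGaussianPi, charFun_stdComplexGaussianPi, f.symm.norm_map]

section Diagonalization

variable {ι : Type*} [Fintype ι] {M : ℕ}

/-- Spectral theorem for the Hermitian operator ∑ c_p ⟪u_p, ·⟫ u_p. Its trace and Hilbert–Schmidt
norm, computed from the vectors u_p and from the eigenvalues, give the mean and variance identities.
-/
lemma exists_orthonormalBasis_sum_norm_inner_sq (c : ι → ℝ)
    (u : ι → EuclideanSpace ℂ (Fin M)) :
    ∃ (e : OrthonormalBasis (Fin M) ℂ (EuclideanSpace ℂ (Fin M))) (l : Fin M → ℝ),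
      (∀ x, ∑ p, c p * ‖⟪u p, x⟫_ℂ‖ ^ 2 = ∑ i, l i * ‖⟪e i, x⟫_ℂ‖ ^ 2) ∧
      ∑ i, l i = ∑ p, c p * ‖u p‖ ^ 2 ∧
      ∑ i, l i ^ 2 = ∑ p, ∑ q, c p * c q * ‖⟪u p, u q⟫_ℂ‖ ^ 2 := by
  let T : EuclideanSpace ℂ (Fin M) →ₗ[ℂ] EuclideanSpace ℂ (Fin M) :=
    ∑ p, (c p : ℂ) • (innerSL ℂ (u p)).toLinearMap.smulRight (u p)
  have hT : ∀ x, T x = ∑ p, ((c p : ℂ) * ⟪u p, x⟫_ℂ) • u p := by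
    intro x
    simp only [T, LinearMap.sum_apply]
    refine Finset.sum_congr rfl fun p _ => ?_
    simp only [mul_smul]
    rfl
  have hTi : ∀ x y, ⟪x, T y⟫_ℂ = ∑ p, (c p : ℂ) * (⟪x, u p⟫_ℂ * ⟪u p, y⟫_ℂ) := by
    intro x y
    rw [hT, inner_sum]
    refine Finset.sum_congr rfl fun p _ => ?_
    rw [inner_smul_right]; ring
  have hsymm : T.IsSymmetric := by
    intro x y
    rw [hTi, ← inner_conj_symm, hTi, map_sum]
    refine Finset.sum_congr rfl fun p _ => ?_
    simp only [map_mul, inner_conj_symm, Complex.conj_ofReal]; ring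
  have hn : Module.finrank ℂ (EuclideanSpace ℂ (Fin M)) = M := by simp
  set e := hsymm.eigenvectorBasis hn with he
  set l := hsymm.eigenvalues hn with hl
  have hTe : ∀ i, T (e i) = (l i : ℂ) • e i := hsymm.apply_eigenvectorBasis hn
  have hq : ∀ x, (((∑ p, c p * ‖⟪u p, x⟫_ℂ‖ ^ 2 : ℝ)) : ℂ) = ⟪x, T x⟫_ℂ := by
    intro x
    rw [hTi]
    push_cast
    refine Finset.sum_congr rfl fun p _ => ?_
    rw [← Complex.ofReal_pow, ← Complex.normSq_eq_norm_sq, ← Complex.mul_conj, inner_conj_symm,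
      mul_comm ⟪u p, x⟫_ℂ]
  have hli : ∀ i, l i = ∑ p, c p * ‖⟪u p, e i⟫_ℂ‖ ^ 2 := by
    intro i
    have h := hq (e i)
    rw [hTe, inner_smul_right, inner_self_eq_norm_sq_to_K, e.norm_eq_one] at h
    simp only [Complex.coe_algebraMap, Complex.ofReal_one, one_pow, mul_one] at h
    exact_mod_cast h.symm
  refine ⟨e, l, fun x => ?_, ?_, ?_⟩
  · have h1 : ⟪x, T x⟫_ℂ = ∑ i, (l i : ℂ) * ‖⟪e i, x⟫_ℂ‖ ^ 2 := by
      rw [← e.sum_inner_mul_inner]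
      refine Finset.sum_congr rfl fun i _ => ?_
      rw [← hsymm, hTe, inner_smul_left, Complex.conj_ofReal, ← Complex.ofReal_pow,
        ← Complex.normSq_eq_norm_sq, ← Complex.mul_conj, inner_conj_symm]
      ring
    rw [← hq] at h1
    exact_mod_cast h1
  · simp only [hli]
    rw [Finset.sum_comm]
    refine Finset.sum_congr rfl fun p _ => ?_
    rw [← Finset.mul_sum, e.sum_sq_norm_inner_left]
  · have h1 : ∀ i, ((l i ^ 2 : ℝ) : ℂ) = ∑ p, ∑ q, (c p * c q : ℂ) * (⟪u q, u p⟫_ℂ *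
        (⟪u p, e i⟫_ℂ * ⟪e i, u q⟫_ℂ)) := by
      intro i
      have h2 : ⟪T (e i), T (e i)⟫_ℂ = ((l i ^ 2 : ℝ) : ℂ) := by
        rw [hTe, inner_smul_left, inner_smul_right, inner_self_eq_norm_sq_to_K, e.norm_eq_one,
          Complex.conj_ofReal]
        simp [sq]
      rw [← h2, hTi]
      refine Finset.sum_congr rfl fun p _ => ?_
      rw [hsymm, hTi, Finset.sum_mul, Finset.mul_sum]
      refine Finset.sum_congr rfl fun q _ => ?_
      ring
    have h2 : ((∑ i, l i ^ 2 : ℝ) : ℂ) =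
        ((∑ p, ∑ q, c p * c q * ‖⟪u p, u q⟫_ℂ‖ ^ 2 : ℝ) : ℂ) := by
      rw [Complex.ofReal_sum]
      simp only [h1]
      rw [Finset.sum_comm, Complex.ofReal_sum]
      refine Finset.sum_congr rfl fun p _ => ?_
      rw [Finset.sum_comm, Complex.ofReal_sum]
      refine Finset.sum_congr rfl fun q _ => ?_
      rw [← Finset.mul_sum, ← Finset.mul_sum, e.sum_inner_mul_inner, ← inner_conj_symm (u q),
        mul_comm (conj _), Complex.mul_conj, Complex.normSq_eq_norm_sq]
      push_cast; rfl
    exact_mod_cast h2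

/-- Unitary invariance makes the coordinates in the eigenbasis independent standard complex
Gaussians, so the transform factors. -/
lemma integral_exp_quadratic (e : OrthonormalBasis (Fin M) ℂ (EuclideanSpace ℂ (Fin M)))
    (l : Fin M → ℝ) {c : ℂ} (hc : ∀ i, (c * l i).re < 1) :
    ∫ x, Complex.exp (c * (∑ i, l i * (‖⟪e i, x⟫_ℂ‖ ^ 2 - 1) : ℝ)) ∂(stdComplexGaussianPi M) =
      ∏ i, (1 - c * l i)⁻¹ * Complex.exp (-(c * l i)) := by
  have h1 : ∀ x : EuclideanSpace ℂ (Fin M),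
      Complex.exp (c * (∑ i, l i * (‖⟪e i, x⟫_ℂ‖ ^ 2 - 1) : ℝ)) =
      (fun y : EuclideanSpace ℂ (Fin M) => ∏ i, Complex.exp (c * l i * (‖y i‖ ^ 2 : ℝ)) *
        Complex.exp (-(c * l i))) (e.repr x) := by
    intro x
    simp only [← Complex.exp_add, ← Complex.exp_sum, e.repr_apply_apply]
    congr 1
    push_cast
    rw [Finset.mul_sum]
    exact Finset.sum_congr rfl fun i _ => by ring
  have h2 := integral_map (μ := stdComplexGaussianPi M) (φ := e.repr)
    e.repr.continuous.measurable.aemeasurable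
    (f := fun y : EuclideanSpace ℂ (Fin M) => ∏ i, Complex.exp (c * l i * (‖y i‖ ^ 2 : ℝ)) *
        Complex.exp (-(c * l i))) (Continuous.aestronglyMeasurable (by fun_prop))
  rw [integral_congr_ae (ae_of_all _ h1), ← h2, map_stdComplexGaussianPi,
    stdComplexGaussianPi, integral_map (by fun_prop)
    (Continuous.aestronglyMeasurable (by fun_prop))]
  rw [integral_fintype_prod_eq_prod
    (fun i z => Complex.exp (c * l i * (‖z‖ ^ 2 : ℝ)) * Complex.exp (-(c * l i)))]
  refine Finset.prod_congr rfl fun i _ => ?_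
  rw [integral_mul_const, integral_exp_mul_normSq (hc i)]

end Diagonalization

end

section

open scoped ComplexConjugate Topology InnerProductSpace

/-! ### Exponential moments and quantitative normal approximation -/

section QuadraticForms

variable {ι : Type*} [Fintype ι] {M : ℕ}

lemma inv_one_sub_mul_exp_neg_le {x : ℝ} (hx : |x| ≤ 1 / 2) :
    (1 - x)⁻¹ * Real.exp (-x) ≤ Real.exp (2 * x ^ 2) := by
  have h1 : 0 < 1 - x := by linarith [le_abs_self x]
  have h := Real.abs_log_sub_add_sum_range_le (x := x) (by linarith) 1
  simp only [Finset.sum_range_one, Nat.cast_zero, zero_add, pow_one, div_one, Nat.reduceAdd,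
    sq_abs] at h
  have h2 : x ^ 2 / (1 - |x|) ≤ 2 * x ^ 2 := by
    rw [div_le_iff₀ (by linarith)]
    nlinarith [sq_nonneg x]
  have h3 : -Real.log (1 - x) - x ≤ 2 * x ^ 2 := by
    have := neg_abs_le (x + Real.log (1 - x)); linarith
  calc (1 - x)⁻¹ * Real.exp (-x) = Real.exp (-Real.log (1 - x) - x) := by
        rw [sub_eq_add_neg (-Real.log (1 - x)) x, Real.exp_add, Real.exp_neg (Real.log _),
          Real.exp_log h1]
    _ ≤ _ := Real.exp_le_exp.mpr h3

/-- Put w = it - t²/2. The difference equals the first product times 1 - (1 - it)e^w, whose Taylor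
expansion has no terms in t or t². The third-order remainders give 3/2 · 4/9 + 3/4 ≤ 2. -/
lemma norm_inv_one_sub_mul_exp_sub_le {t : ℝ} (ht : |t| ≤ 1 / 2) :
    ‖(1 - Complex.I * t)⁻¹ * Complex.exp (-(Complex.I * t)) - Complex.exp (-(t ^ 2 / 2 : ℝ))‖ ≤
      2 * |t| ^ 3 := by
  have hI : ‖Complex.I * t‖ = |t| := by simp
  have h1 : 1 ≤ ‖1 - Complex.I * t‖ := by
    have := Complex.abs_re_le_norm (1 - Complex.I * t)
    simpa using this
  have h1' : ‖1 - Complex.I * t‖ ≤ 3 / 2 := by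
    have := norm_sub_le (1 : ℂ) (Complex.I * t)
    rw [hI, norm_one] at this; linarith
  have h0 : 1 - Complex.I * t ≠ 0 := by
    intro h; rw [h, norm_zero] at h1; linarith
  set w : ℂ := Complex.I * t - (t ^ 2 / 2 : ℝ) with hw
  have ht0 := abs_nonneg t
  have hwn : ‖w‖ ≤ 5 / 4 * |t| := by
    have e0 : ‖((t ^ 2 / 2 : ℝ) : ℂ)‖ = |t| ^ 2 / 2 := by
      rw [Complex.norm_real, Real.norm_eq_abs, abs_of_nonneg (by positivity), sq_abs]
    have := norm_sub_le (Complex.I * t) ((t ^ 2 / 2 : ℝ) : ℂ)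
    rw [hI, e0] at this
    nlinarith
  have hw1 : ‖w‖ ≤ 1 := by linarith
  have h2 := Complex.exp_bound hw1 (n := 3) (by norm_num)
  simp only [Finset.sum_range_succ, Finset.sum_range_zero, Nat.factorial, pow_zero, pow_one] at h2
  norm_num at h2
  have h3 : ‖w‖ ^ 3 ≤ 2 * |t| ^ 3 := by
    calc ‖w‖ ^ 3 ≤ (5 / 4 * |t|) ^ 3 := by gcongr
      _ ≤ 2 * |t| ^ 3 := by ring_nf; nlinarith [pow_nonneg ht0 3]
  have h4 : (1 - Complex.I * t)⁻¹ * Complex.exp (-(Complex.I * t)) -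
      Complex.exp (-(t ^ 2 / 2 : ℝ)) = (1 - Complex.I * t)⁻¹ * Complex.exp (-(Complex.I * t)) *
        (1 - (1 - Complex.I * t) * Complex.exp w) := by
    rw [mul_sub, mul_one, sub_right_inj, hw, sub_eq_add_neg (Complex.I * t), Complex.exp_add,
      Complex.exp_neg (Complex.I * t)]
    have := Complex.exp_ne_zero (Complex.I * t)
    field_simp
  have h5 : 1 - (1 - Complex.I * t) * Complex.exp w =
      -((1 - Complex.I * t) * (Complex.exp w - (1 + w + w ^ 2 / 2))) -
        t ^ 3 * (Complex.I / 2 - 3 / 8 * t - Complex.I * t ^ 2 / 8) := by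
    have : (1 - Complex.I * t) * (1 + w + w ^ 2 / 2) =
        1 + t ^ 3 * (Complex.I / 2 - 3 / 8 * t - Complex.I * t ^ 2 / 8) := by
      rw [hw]; push_cast
      ring_nf
      simp only [Complex.I_sq, Complex.I_pow_three]
      ring
    linear_combination -this
  have h6 : ‖(t : ℂ) ^ 3 * (Complex.I / 2 - 3 / 8 * t - Complex.I * t ^ 2 / 8)‖ ≤
      3 / 4 * |t| ^ 3 := by
    have a1 := norm_sub_le (Complex.I / 2 - 3 / 8 * (t : ℂ)) (Complex.I * t ^ 2 / 8)
    have a2 := norm_sub_le (Complex.I / 2) (3 / 8 * (t : ℂ))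
    have e1 : ‖Complex.I / 2‖ = 1 / 2 := by simp
    have e2 : ‖3 / 8 * (t : ℂ)‖ = 3 / 8 * |t| := by simp
    have e3 : ‖Complex.I * t ^ 2 / 8‖ = |t| ^ 2 / 8 := by simp
    rw [norm_mul, norm_pow, Complex.norm_real, Real.norm_eq_abs, mul_comm]
    gcongr
    nlinarith
  have h7 : ‖(1 - Complex.I * t)⁻¹ * Complex.exp (-(Complex.I * t))‖ ≤ 1 := by
    rw [norm_mul, norm_inv, Complex.norm_exp]
    simpa using inv_le_one_of_one_le₀ h1
  rw [h4, norm_mul]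
  have h8 : ‖1 - (1 - Complex.I * t) * Complex.exp w‖ ≤ 2 * |t| ^ 3 := by
    rw [h5]
    refine (norm_sub_le _ _).trans ?_
    rw [norm_neg, norm_mul]
    have h9 : ‖Complex.exp w - (1 + w + w ^ 2 / 2)‖ ≤ 4 / 9 * |t| ^ 3 := by
      refine h2.trans ?_
      linarith
    have h10 := mul_le_mul h1' h9 (norm_nonneg _) (by norm_num)
    have h11 := pow_nonneg ht0 3
    nlinarith
  nlinarith [norm_nonneg (1 - (1 - Complex.I * t) * Complex.exp w)]

lemma norm_prod_sub_prod_le {κ : Type*} (s : Finset κ) (f g : κ → ℂ) (hf : ∀ i, ‖f i‖ ≤ 1)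
    (hg : ∀ i, ‖g i‖ ≤ 1) : ‖∏ i ∈ s, f i - ∏ i ∈ s, g i‖ ≤ ∑ i ∈ s, ‖f i - g i‖ := by
  classical
  induction s using Finset.induction_on with
  | empty => simp
  | insert a s ha ih =>
    rw [Finset.prod_insert ha, Finset.prod_insert ha, Finset.sum_insert ha]
    have e : f a * ∏ i ∈ s, f i - g a * ∏ i ∈ s, g i =
        (f a - g a) * ∏ i ∈ s, f i + g a * (∏ i ∈ s, f i - ∏ i ∈ s, g i) := by ring
    have hp : ‖∏ i ∈ s, f i‖ ≤ 1 := by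
      rw [norm_prod]
      exact Finset.prod_le_one (fun i _ => norm_nonneg _) fun i _ => hf i
    rw [e]
    refine (norm_add_le _ _).trans ?_
    rw [norm_mul, norm_mul]
    exact add_le_add (mul_le_of_le_one_right (norm_nonneg _) hp)
      ((mul_le_of_le_one_left (norm_nonneg _) (hg a)).trans ih)

/-- The centered quadratic form `∑ c_p (|⟪u_p, x⟫|² - |u_p|²)`. -/
def centeredForm (c : ι → ℝ) (u : ι → EuclideanSpace ℂ (Fin M)) (x : EuclideanSpace ℂ (Fin M)) :
    ℝ :=
  ∑ p, c p * (‖⟪u p, x⟫_ℂ‖ ^ 2 - ‖u p‖ ^ 2)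

/-- The variance of the centered quadratic form under the standard Gaussian law. -/
def formVariance (c : ι → ℝ) (u : ι → EuclideanSpace ℂ (Fin M)) : ℝ :=
  ∑ p, ∑ q, c p * c q * ‖⟪u p, u q⟫_ℂ‖ ^ 2

@[fun_prop]
lemma continuous_centeredForm (c : ι → ℝ) (u : ι → EuclideanSpace ℂ (Fin M)) :
    Continuous (centeredForm c u) := by
  unfold centeredForm
  fun_prop

lemma exists_diagonalization (c : ι → ℝ) (u : ι → EuclideanSpace ℂ (Fin M)) :
    ∃ (e : OrthonormalBasis (Fin M) ℂ (EuclideanSpace ℂ (Fin M))) (l : Fin M → ℝ),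
      (∀ x, ∑ p, c p * ‖⟪u p, x⟫_ℂ‖ ^ 2 = ∑ i, l i * ‖⟪e i, x⟫_ℂ‖ ^ 2) ∧
      centeredForm c u = (fun x => ∑ i, l i * (‖⟪e i, x⟫_ℂ‖ ^ 2 - 1)) ∧
      ∑ i, l i ^ 2 = formVariance c u := by
  obtain ⟨e, l, h1, h2, h3⟩ := exists_orthonormalBasis_sum_norm_inner_sq c u
  refine ⟨e, l, h1, funext fun x => ?_, h3⟩
  simp only [centeredForm, mul_sub, Finset.sum_sub_distrib, mul_one, h1, h2]

/-- The hypothesis bounds the sum of (s l_i)², hence each |s l_i| by 1/2, so each eigenvalue factor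
is at most e^{2(s l_i)²}. The product sees only the variance. -/
lemma lintegral_exp_centeredForm_le (c : ι → ℝ) (u : ι → EuclideanSpace ℂ (Fin M)) {s : ℝ}
    (hs : s ^ 2 * formVariance c u ≤ 1 / 4) :
    ∫⁻ x, ENNReal.ofReal (Real.exp (s * centeredForm c u x)) ∂(stdComplexGaussianPi M) ≤
      ENNReal.ofReal (Real.exp (2 * (s ^ 2 * formVariance c u))) := by
  obtain ⟨e, l, -, h2, h3⟩ := exists_diagonalization c u
  have hl : ∀ i, |s * l i| ≤ 1 / 2 := by
    intro i
    rw [← h3, Finset.mul_sum] at hs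
    have : s ^ 2 * l i ^ 2 ≤ 1 / 4 := (Finset.single_le_sum (f := fun i => s ^ 2 * l i ^ 2)
      (fun j _ => by positivity) (Finset.mem_univ i)).trans hs
    apply abs_le_of_sq_le_sq _ (by norm_num)
    nlinarith
  have h4 := integral_exp_quadratic e l (c := (s : ℂ)) (fun i => by
    rw [← Complex.ofReal_mul, Complex.ofReal_re]; linarith [le_abs_self (s * l i), hl i])
  have h5 : ∫ x, Real.exp (s * centeredForm c u x) ∂(stdComplexGaussianPi M) =
      ∏ i, (1 - s * l i)⁻¹ * Real.exp (-(s * l i)) := by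
    have e1 : ∀ x, Complex.exp (s * (∑ i, l i * (‖⟪e i, x⟫_ℂ‖ ^ 2 - 1) : ℝ)) =
        ((Real.exp (s * centeredForm c u x) : ℝ) : ℂ) := by
      intro x; rw [h2]; push_cast; rfl
    simp only [e1] at h4
    rw [integral_complex_ofReal] at h4
    have : ∏ i, (1 - (s : ℂ) * l i)⁻¹ * Complex.exp (-((s : ℂ) * l i)) =
      ((∏ i, (1 - s * l i)⁻¹ * Real.exp (-(s * l i)) : ℝ) : ℂ) := by push_cast; rfl
    rw [this] at h4
    exact_mod_cast h4
  have hpos : 0 < ∏ i, (1 - s * l i)⁻¹ * Real.exp (-(s * l i)) := by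
    refine Finset.prod_pos fun i _ => ?_
    have : 0 < 1 - s * l i := by linarith [le_abs_self (s * l i), hl i]
    positivity
  -- A nonintegrable function would have Bochner integral 0, whereas the product formula is
  -- positive.
  have hint : Integrable (fun x => Real.exp (s * centeredForm c u x))
      (stdComplexGaussianPi M) := by
    by_contra h
    rw [integral_undef h] at h5
    linarith
  rw [← ofReal_integral_eq_lintegral_ofReal hint (ae_of_all _ fun x => (Real.exp_pos _).le), h5]
  apply ENNReal.ofReal_le_ofReal
  rw [← h3, Finset.mul_sum, Finset.mul_sum, Real.exp_sum]
  refine Finset.prod_le_prod (fun i _ => ?_) fun i _ => ?_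
  · have : 0 < 1 - s * l i := by linarith [le_abs_self (s * l i), hl i]
    positivity
  · rw [← mul_pow]
    exact inv_one_sub_mul_exp_neg_le (hl i)

/-- Testing the form on unit eigenvectors bounds every eigenvalue by L. Each factor is off by at
most 2|l|³ ≤ 2L l², and a product of numbers in the unit disk changes by at most the sum of these
errors. -/
lemma norm_integral_exp_centeredForm_sub_le (c : ι → ℝ) (u : ι → EuclideanSpace ℂ (Fin M)) {L : ℝ}
    (hL : L ≤ 1 / 2) (hb : ∀ x, |∑ p, c p * ‖⟪u p, x⟫_ℂ‖ ^ 2| ≤ L * ‖x‖ ^ 2) :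
    ‖∫ x, Complex.exp (Complex.I * centeredForm c u x) ∂(stdComplexGaussianPi M) -
      Complex.exp (-(formVariance c u / 2 : ℝ))‖ ≤ 2 * L * formVariance c u := by
  obtain ⟨e, l, h1, h2, h3⟩ := exists_diagonalization c u
  have hl : ∀ i, |l i| ≤ L := by
    intro i
    have h := hb (e i)
    rw [h1, e.norm_eq_one] at h
    have e2 : ∑ j, l j * ‖⟪e j, e i⟫_ℂ‖ ^ 2 = l i := by
      rw [Finset.sum_eq_single i]
      · simp
      · intro j _ hj
        rw [e.inner_eq_zero hj]; simp
      · simp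
    rw [e2] at h
    simpa using h
  have h4 := integral_exp_quadratic e l (c := Complex.I) (fun i => by simp)
  rw [h2, h4, ← h3, Finset.mul_sum]
  have h5 : Complex.exp (-((∑ i, l i ^ 2) / 2 : ℝ)) =
      ∏ i, Complex.exp (-(l i ^ 2 / 2 : ℝ)) := by
    rw [← Complex.exp_sum]
    congr 1
    push_cast
    rw [Finset.sum_neg_distrib, Finset.sum_div]
  rw [h5]
  refine (norm_prod_sub_prod_le _ _ _ (fun i => ?_) fun i => ?_).trans
    (Finset.sum_le_sum fun i _ => ?_)
  · rw [norm_mul, norm_inv, Complex.norm_exp]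
    have := Complex.abs_re_le_norm (1 - Complex.I * l i)
    simp only [Complex.sub_re, Complex.one_re, Complex.mul_re, Complex.I_re, zero_mul,
      Complex.I_im, Complex.ofReal_im, mul_zero, sub_zero, abs_one] at this
    simpa using inv_le_one_of_one_le₀ this
  · rw [← Complex.ofReal_neg, ← Complex.ofReal_exp, Complex.norm_real, Real.norm_eq_abs, Real.abs_exp]
    exact Real.exp_le_one_iff.mpr (by have := sq_nonneg (l i); linarith)
  · refine (norm_inv_one_sub_mul_exp_sub_le ((hl i).trans hL)).trans ?_
    have : |l i| ^ 3 = |l i| * l i ^ 2 := by rw [pow_succ, sq_abs]; ring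
    rw [this]
    nlinarith [hl i, sq_nonneg (l i), mul_le_mul_of_nonneg_right (hl i) (sq_nonneg (l i))]

end QuadraticForms

end

section

open scoped ComplexConjugate Topology InnerProductSpace

/-! ### Quadratic forms in infinitely many Gaussian variables -/

lemma lintegral_enorm_stdComplexGaussian_lt_top : ∫⁻ z, ‖z‖ₑ ∂stdComplexGaussian < ⊤ := by
  have h := integral_exp_mul_normSq (c := ((1 / 2 : ℝ) : ℂ)) (by norm_num)
  have hi : Integrable (fun z : ℂ => Complex.exp (((1 / 2 : ℝ) : ℂ) * (‖z‖ ^ 2 : ℝ)))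
      stdComplexGaussian := by
    by_contra hc
    rw [integral_undef hc] at h
    norm_num at h
  refine lt_of_le_of_lt (lintegral_mono fun z => ?_) hi.2
  rw [enorm_le_iff_norm_le]
  dsimp only
  rw [← Complex.ofReal_mul, ← Complex.ofReal_exp, Complex.norm_real,
    Real.norm_eq_abs, Real.abs_exp]
  have := Real.add_one_le_exp (1 / 2 * ‖z‖ ^ 2)
  nlinarith [sq_nonneg (‖z‖ - 1)]

lemma Tempered.of_tsum_ne_top {a : ℕ → ℂ} (h : ∑' k, ‖a k‖ₑ / 2 ^ k ≠ ⊤) : Tempered a := by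
  refine ⟨(∑' k, ‖a k‖ₑ / 2 ^ k).toReal, ENNReal.toReal_nonneg, fun k => ?_⟩
  have h1 : ‖a k‖ₑ / 2 ^ k ≤ ∑' k, ‖a k‖ₑ / 2 ^ k := ENNReal.le_tsum k
  have h2 := ENNReal.toReal_mono h h1
  rw [ENNReal.toReal_div, toReal_enorm] at h2
  simp only [ENNReal.toReal_pow, ENNReal.toReal_ofNat] at h2
  rwa [div_le_iff₀ (by positivity)] at h2

section InfiniteForms

variable {Ω : Type*} [MeasurableSpace Ω] {P : Measure Ω} {ζ : ℕ → Ω → ℂ}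

/-- The sum of |ζ_k| 2^{-k} has finite expectation, so it is almost surely finite and bounds every
term. Independence plays no role. -/
lemma ae_tempered (hlaw : ∀ k, HasLaw (ζ k) stdComplexGaussian P) :
    ∀ᵐ ω ∂P, Tempered (fun k => ζ k ω) := by
  have hm : ∀ k, AEMeasurable (fun ω => ‖ζ k ω‖ₑ / 2 ^ k) P := fun k =>
    (hlaw k).aemeasurable.enorm.div_const _
  have h : ∫⁻ ω, ∑' k, ‖ζ k ω‖ₑ / 2 ^ k ∂P ≠ ⊤ := by
    rw [lintegral_tsum hm]
    have e : ∀ k, ∫⁻ ω, ‖ζ k ω‖ₑ / 2 ^ k ∂P =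
        (∫⁻ z, ‖z‖ₑ ∂stdComplexGaussian) * (1 / 2 : ENNReal) ^ k := by
      intro k
      simp only [div_eq_mul_inv, one_mul]
      rw [lintegral_mul_const'' _ (hlaw k).aemeasurable.enorm, ENNReal.inv_pow,
        ← (hlaw k).map_eq, lintegral_map' (by fun_prop) (hlaw k).aemeasurable]
    simp only [e]
    rw [ENNReal.tsum_mul_left, ENNReal.tsum_geometric]
    refine ENNReal.mul_ne_top lintegral_enorm_stdComplexGaussian_lt_top.ne ?_
    norm_num
  filter_upwards [ae_lt_top' (AEMeasurable.tsum hm) h] with ω hω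
  exact Tempered.of_tsum_ne_top hω.ne

/-- The vector of the first `M` coefficients. -/
def truncate (a : ℕ → ℂ) (M : ℕ) : EuclideanSpace ℂ (Fin M) := WithLp.toLp 2 fun i => a i

lemma map_truncate (hlaw : ∀ k, HasLaw (ζ k) stdComplexGaussian P) (hindep : iIndepFun ζ P)
    (M : ℕ) : P.map (fun ω => truncate (fun k => ζ k ω) M) = stdComplexGaussianPi M := by
  have h1 : iIndepFun (fun i : Fin M => ζ i) P := hindep.precomp Fin.val_injective
  have hm : ∀ i : Fin M, AEMeasurable (ζ i) P := fun i => (hlaw i).aemeasurable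
  have h2 := h1.map_fun_eq_pi_map hm
  simp only [(hlaw _).map_eq] at h2
  rw [stdComplexGaussianPi, ← h2, AEMeasurable.map_map_of_aemeasurable (by fun_prop) (by fun_prop)]
  rfl

lemma aemeasurable_truncate (hlaw : ∀ k, HasLaw (ζ k) stdComplexGaussian P) (M : ℕ) :
    AEMeasurable (fun ω => truncate (fun k => ζ k ω) M) P := by
  have hm : ∀ i : Fin M, AEMeasurable (ζ i) P := fun i => (hlaw i).aemeasurable
  unfold truncate
  fun_prop

variable {ι : Type*}

/-- The truncations of the conjugated coefficient vectors. -/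
def truncateConj (v : ι → ℕ → ℂ) (M : ℕ) (p : ι) : EuclideanSpace ℂ (Fin M) :=
  truncate (fun k => conj (v p k)) M

lemma inner_truncate (a b : ℕ → ℂ) (M : ℕ) :
    ⟪truncate a M, truncate b M⟫_ℂ = ∑ k ∈ Finset.range M, b k * conj (a k) := by
  rw [PiLp.inner_apply, Finset.sum_range]
  rfl

lemma Tempered.summable_mul {a : ℕ → ℂ} (ha : Tempered a) {v : ℕ → ℂ}
    (hv : Summable fun k => 2 ^ k * ‖v k‖) : Summable fun k => a k * v k := by
  obtain ⟨C, hC, h⟩ := ha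
  refine Summable.of_norm_bounded (hv.mul_left C) fun k => ?_
  rw [norm_mul, ← mul_assoc]
  exact mul_le_mul_of_nonneg_right (h k) (norm_nonneg _)

lemma tendsto_inner_truncateConj {v : ι → ℕ → ℂ} (hv : ∀ p, Summable fun k => 2 ^ k * ‖v p k‖)
    {a : ℕ → ℂ} (ha : Tempered a) (p : ι) :
    Tendsto (fun M => ⟪truncateConj v M p, truncate a M⟫_ℂ) atTop (𝓝 (∑' k, a k * v p k)) := by
  simp only [truncateConj, inner_truncate, Complex.conj_conj]
  exact (ha.summable_mul (hv p)).hasSum.tendsto_sum_nat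

lemma tendsto_inner_truncateConj_self {v : ι → ℕ → ℂ} {B : ι → ι → ℂ}
    (hB : ∀ p q, HasSum (fun k => v p k * conj (v q k)) (B p q)) (p q : ι) :
    Tendsto (fun M => ⟪truncateConj v M p, truncateConj v M q⟫_ℂ) atTop (𝓝 (B p q)) := by
  simp only [truncateConj, inner_truncate, Complex.conj_conj]
  simpa only [mul_comm] using (hB p q).tendsto_sum_nat

variable [Fintype ι]

/-- The centered quadratic form `∑ c_p (|∑ₖ v_{p,k} a_k|² - 1)` of a coefficient sequence. -/
def seriesForm (c : ι → ℝ) (v : ι → ℕ → ℂ) (a : ℕ → ℂ) : ℝ :=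
  ∑ p, c p * (‖∑' k, a k * v p k‖ ^ 2 - 1)

lemma tendsto_centeredForm {v : ι → ℕ → ℂ} (hv : ∀ p, Summable fun k => 2 ^ k * ‖v p k‖)
    {B : ι → ι → ℂ} (hB : ∀ p q, HasSum (fun k => v p k * conj (v q k)) (B p q))
    (hB1 : ∀ p, B p p = 1) (c : ι → ℝ) {a : ℕ → ℂ} (ha : Tempered a) :
    Tendsto (fun M => centeredForm c (truncateConj v M) (truncate a M)) atTop
      (𝓝 (seriesForm c v a)) := by
  refine tendsto_finsetSum _ fun p _ => ?_
  refine Tendsto.const_mul _ (Tendsto.sub ((tendsto_inner_truncateConj hv ha p).norm.pow 2) ?_)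
  have h := (tendsto_inner_truncateConj_self hB p p).norm
  rw [hB1, norm_one] at h
  refine h.congr fun M => ?_
  rw [inner_self_eq_norm_sq_to_K]
  simp

lemma tendsto_formVariance {v : ι → ℕ → ℂ} {B : ι → ι → ℂ}
    (hB : ∀ p q, HasSum (fun k => v p k * conj (v q k)) (B p q)) (c : ι → ℝ) :
    Tendsto (fun M => formVariance c (truncateConj v M)) atTop
      (𝓝 (∑ p, ∑ q, c p * c q * ‖B p q‖ ^ 2)) :=
  tendsto_finsetSum _ fun p _ => tendsto_finsetSum _ fun q _ =>
    ((tendsto_inner_truncateConj_self hB p q).norm.pow 2).const_mul _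

lemma aemeasurable_seriesForm (hlaw : ∀ k, HasLaw (ζ k) stdComplexGaussian P) {v : ι → ℕ → ℂ}
    (hv : ∀ p, Summable fun k => 2 ^ k * ‖v p k‖) {B : ι → ι → ℂ}
    (hB : ∀ p q, HasSum (fun k => v p k * conj (v q k)) (B p q))
    (hB1 : ∀ p, B p p = 1) (c : ι → ℝ) :
    AEMeasurable (fun ω => seriesForm c v (fun k => ζ k ω)) P := by
  refine aemeasurable_of_tendsto_metrizable_ae atTop
    (f := fun M ω => centeredForm c (truncateConj v M) (truncate (fun k => ζ k ω) M))
    (fun M => (continuous_centeredForm c _).measurable.comp_aemeasurable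
      (aemeasurable_truncate hlaw M)) ?_
  filter_upwards [ae_tempered hlaw] with ω hω
  exact tendsto_centeredForm hv hB hB1 c hω

/-- Fatou's lemma along finite truncations of the coefficient sequence. -/
lemma lintegral_exp_seriesForm_le (hlaw : ∀ k, HasLaw (ζ k) stdComplexGaussian P)
    (hindep : iIndepFun ζ P) {v : ι → ℕ → ℂ} (hv : ∀ p, Summable fun k => 2 ^ k * ‖v p k‖)
    {B : ι → ι → ℂ} (hB : ∀ p q, HasSum (fun k => v p k * conj (v q k)) (B p q))
    (hB1 : ∀ p, B p p = 1) (c : ι → ℝ) {s : ℝ}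
    (hs : s ^ 2 * ∑ p, ∑ q, c p * c q * ‖B p q‖ ^ 2 < 1 / 4) :
    ∫⁻ ω, ENNReal.ofReal (Real.exp (s * seriesForm c v (fun k => ζ k ω))) ∂P ≤
      ENNReal.ofReal (Real.exp (2 * (s ^ 2 * ∑ p, ∑ q, c p * c q * ‖B p q‖ ^ 2))) := by
  have hvar := (tendsto_formVariance hB c).const_mul (s ^ 2)
  set F : ℕ → Ω → ENNReal := fun M ω => ENNReal.ofReal
    (Real.exp (s * centeredForm c (truncateConj v M) (truncate (fun k => ζ k ω) M)))
  have hmeas : ∀ M, Measurable (fun x => ENNReal.ofReal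
      (Real.exp (s * centeredForm c (truncateConj v M) x))) := fun M =>
    ENNReal.measurable_ofReal.comp (Continuous.measurable (by fun_prop))
  have hFm : ∀ M, AEMeasurable (F M) P := fun M =>
    (hmeas M).comp_aemeasurable (aemeasurable_truncate hlaw M)
  have hlim : ∀ᵐ ω ∂P, Tendsto (fun M => F M ω) atTop
      (𝓝 (ENNReal.ofReal (Real.exp (s * seriesForm c v (fun k => ζ k ω))))) := by
    filter_upwards [ae_tempered hlaw] with ω hω
    exact (ENNReal.continuous_ofReal.comp Real.continuous_exp).continuousAt.tendsto.comp
      ((tendsto_centeredForm hv hB hB1 c hω).const_mul s)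
  calc ∫⁻ ω, ENNReal.ofReal (Real.exp (s * seriesForm c v (fun k => ζ k ω))) ∂P
      = ∫⁻ ω, liminf (fun M => F M ω) atTop ∂P := by
        refine lintegral_congr_ae ?_
        filter_upwards [hlim] with ω hω
        exact hω.liminf_eq.symm
    _ ≤ liminf (fun M => ∫⁻ ω, F M ω ∂P) atTop := lintegral_liminf_le' hFm
    _ ≤ liminf (fun M => ENNReal.ofReal (Real.exp (2 * (s ^ 2 *
          formVariance c (truncateConj v M))))) atTop := by
        refine liminf_le_liminf ?_
        -- The strict inequality in the hypothesis passes to the truncated variances for large M.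
        filter_upwards [hvar.eventually_lt_const hs] with M hM
        have := lintegral_exp_centeredForm_le c (truncateConj v M) hM.le
        rwa [← map_truncate hlaw hindep M, lintegral_map' (hmeas M).aemeasurable
          (aemeasurable_truncate hlaw M)] at this
    _ = _ := (((ENNReal.continuous_ofReal.comp Real.continuous_exp).continuousAt.tendsto.comp
          (hvar.const_mul 2))).liminf_eq

variable [IsProbabilityMeasure P]

/-- The operator bound is uniform in the truncation level, so the finite-dimensional estimate
survives dominated convergence. -/
lemma norm_integral_exp_seriesForm_sub_le (hlaw : ∀ k, HasLaw (ζ k) stdComplexGaussian P)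
    (hindep : iIndepFun ζ P) {v : ι → ℕ → ℂ} (hv : ∀ p, Summable fun k => 2 ^ k * ‖v p k‖)
    {B : ι → ι → ℂ} (hB : ∀ p q, HasSum (fun k => v p k * conj (v q k)) (B p q))
    (hB1 : ∀ p, B p p = 1) (c : ι → ℝ) {L : ℝ} (hL : L ≤ 1 / 2)
    (hb : ∀ M (x : EuclideanSpace ℂ (Fin M)),
      |∑ p, c p * ‖⟪truncateConj v M p, x⟫_ℂ‖ ^ 2| ≤ L * ‖x‖ ^ 2) :
    ‖∫ ω, Complex.exp (Complex.I * seriesForm c v (fun k => ζ k ω)) ∂P -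
      Complex.exp (-((∑ p, ∑ q, c p * c q * ‖B p q‖ ^ 2) / 2 : ℝ))‖ ≤
      2 * L * ∑ p, ∑ q, c p * c q * ‖B p q‖ ^ 2 := by
  have hvar := tendsto_formVariance hB c
  have hcont : ∀ M, Continuous (fun x : EuclideanSpace ℂ (Fin M) =>
      Complex.exp (Complex.I * centeredForm c (truncateConj v M) x)) := fun M => by fun_prop
  have h1 : Tendsto (fun M => ∫ ω, Complex.exp (Complex.I *
      centeredForm c (truncateConj v M) (truncate (fun k => ζ k ω) M)) ∂P) atTop
      (𝓝 (∫ ω, Complex.exp (Complex.I * seriesForm c v (fun k => ζ k ω)) ∂P)) := by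
    refine tendsto_integral_of_dominated_convergence (fun _ => 1)
      (fun M => ((hcont M).measurable.comp_aemeasurable
        (aemeasurable_truncate hlaw M)).aestronglyMeasurable)
      (integrable_const 1) (fun M => ae_of_all _ fun ω => ?_) ?_
    · rw [Complex.norm_exp]; simp
    · filter_upwards [ae_tempered hlaw] with ω hω
      have hcon : Continuous fun x : ℝ => Complex.exp (Complex.I * x) := by fun_prop
      exact hcon.continuousAt.tendsto.comp (tendsto_centeredForm hv hB hB1 c hω)
  have hcon : Continuous fun x : ℝ => Complex.exp (-(x / 2 : ℝ)) := by fun_prop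
  have h2 := hcon.continuousAt.tendsto.comp hvar
  refine le_of_tendsto_of_tendsto' (h1.sub h2).norm (hvar.const_mul (2 * L)) fun M => ?_
  have := norm_integral_exp_centeredForm_sub_le c (truncateConj v M) hL (hb M)
  rwa [← map_truncate hlaw hindep M, integral_map (aemeasurable_truncate hlaw M)
    (hcont M).aestronglyMeasurable] at this

end InfiniteForms

/-! ### Moments from exponential moments -/

lemma lintegral_pow_le_of_lintegral_exp_le {Ω : Type*} [MeasurableSpace Ω] {P : Measure Ω}
    {X : Ω → ℝ} (hX : AEMeasurable X P) {s : ℝ} (hs : 0 < s) {C : ENNReal}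
    (h1 : ∫⁻ ω, ENNReal.ofReal (Real.exp (s * X ω)) ∂P ≤ C)
    (h2 : ∫⁻ ω, ENNReal.ofReal (Real.exp (-s * X ω)) ∂P ≤ C) (q : ℕ) :
    ∫⁻ ω, ENNReal.ofReal (|X ω| ^ q) ∂P ≤ ENNReal.ofReal (q.factorial / s ^ q) * (2 * C) := by
  have hb : ∀ x : ℝ, |x| ^ q ≤ q.factorial / s ^ q * (Real.exp (s * x) + Real.exp (-s * x)) := by
    intro x
    have h3 := Real.pow_div_factorial_le_exp (s * |x|) (by positivity) q
    have h4 : Real.exp (s * |x|) ≤ Real.exp (s * x) + Real.exp (-s * x) := by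
      rcases abs_cases x with ⟨h, -⟩ | ⟨h, -⟩ <;> rw [h]
      · linarith [Real.exp_pos (-s * x)]
      · rw [mul_neg, neg_mul]; linarith [Real.exp_pos (s * x)]
    have hq : (0 : ℝ) < q.factorial := by positivity
    rw [div_mul_eq_mul_div, le_div_iff₀ (by positivity)]
    rw [div_le_iff₀ hq, mul_pow] at h3
    nlinarith
  calc ∫⁻ ω, ENNReal.ofReal (|X ω| ^ q) ∂P
      ≤ ∫⁻ ω, ENNReal.ofReal (q.factorial / s ^ q) * (ENNReal.ofReal (Real.exp (s * X ω)) +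
          ENNReal.ofReal (Real.exp (-s * X ω))) ∂P := by
        refine lintegral_mono fun ω => ?_
        rw [← ENNReal.ofReal_add (Real.exp_pos _).le (Real.exp_pos _).le,
          ← ENNReal.ofReal_mul (by positivity)]
        exact ENNReal.ofReal_le_ofReal (hb _)
    _ = ENNReal.ofReal (q.factorial / s ^ q) * (∫⁻ ω, ENNReal.ofReal (Real.exp (s * X ω)) ∂P +
          ∫⁻ ω, ENNReal.ofReal (Real.exp (-s * X ω)) ∂P) := by
        rw [lintegral_const_mul'' _ (by fun_prop), lintegral_add_left' (by fun_prop)]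
    _ ≤ _ := by rw [two_mul]; gcongr

/-- Gaussian-type exponential moments near the origin control all moments by the variance proxy. -/
lemma lintegral_pow_le_of_exp_moments {Ω : Type*} [MeasurableSpace Ω] {P : Measure Ω}
    {X : Ω → ℝ} (hX : AEMeasurable X P) {v : ℝ} (hv : 0 < v)
    (h : ∀ s : ℝ, s ^ 2 * v ≤ 1 / 8 →
      ∫⁻ ω, ENNReal.ofReal (Real.exp (s * X ω)) ∂P ≤ 2) (p : ℕ) :
    ∫⁻ ω, ENNReal.ofReal (|X ω| ^ (2 * p)) ∂P ≤
      ENNReal.ofReal (4 * (2 * p).factorial * (8 * v) ^ p) := by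
  -- This s saturates s² v ≤ 1/8, so that the bound on the moment of order 2p scales like v^p.
  set s : ℝ := (Real.sqrt (8 * v))⁻¹ with hs
  have hs0 : 0 < s := by positivity
  have hs2 : s ^ 2 = (8 * v)⁻¹ := by rw [hs, inv_pow, Real.sq_sqrt (by positivity)]
  have hsv : s ^ 2 * v ≤ 1 / 8 := by rw [hs2]; field_simp; norm_num
  refine (lintegral_pow_le_of_lintegral_exp_le hX hs0 (h s hsv)
    (h (-s) (by rwa [neg_sq])) (2 * p)).trans_eq ?_
  have : (2 * 2 : ENNReal) = ENNReal.ofReal 4 := by norm_num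
  rw [this, ← ENNReal.ofReal_mul (by positivity), pow_mul, hs2, inv_pow, div_inv_eq_mul]
  congr 1; ring

end

section

open scoped ComplexConjugate Topology InnerProductSpace

/-! ### The fluctuation fields as quadratic forms -/

lemma summable_displacement (n : ℕ) (z : ℂ) : Summable fun k => 2 ^ k * ‖displacement n k z‖ := by
  obtain ⟨u, hu, -, h⟩ := exists_summable_bound n ‖z‖
  refine Summable.of_nonneg_of_le (fun k => by positivity) (fun k => ?_)
    (hu.mul_left ‖(Real.exp (-‖z‖ ^ 2 / 2) : ℂ) / (Real.sqrt (n.factorial : ℝ) : ℂ)‖)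
  have e : displacement n k z = (Real.exp (-‖z‖ ^ 2 / 2) : ℂ) / (Real.sqrt (n.factorial : ℝ) : ℂ) *
      (complexHermite n k z / (Real.sqrt (k.factorial : ℝ) : ℂ)) := by
    rw [displacement, div_mul_div_comm]
  rw [e, norm_mul, mul_left_comm]
  exact mul_le_mul_of_nonneg_left (h k z le_rfl).1 (norm_nonneg _)

lemma Tempered.landauFun_eq {a : ℕ → ℂ} (ha : Tempered a) (n : ℕ) :
    landauFun a n = fun z => (Real.sqrt (n.factorial : ℝ) : ℂ)⁻¹ * hermiteSeries a n z := by
  funext z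
  rw [landauFun, ha.raising_iterate]

lemma Tempered.normalizedFun_eq {a : ℕ → ℂ} (ha : Tempered a) (n : ℕ) (z : ℂ) :
    normalizedFun a n z = ∑' k, a k * displacement n k z := by
  simp only [normalizedFun, ha.landauFun_eq, hermiteSeries]
  rw [← tsum_mul_left, ← tsum_mul_left]
  refine tsum_congr fun k => ?_
  rw [displacement]
  ring

lemma Tempered.contDiff_normalizedFun {a : ℕ → ℂ} (ha : Tempered a) (n : ℕ) :
    ContDiff ℝ 1 (normalizedFun a n) := by
  have e : normalizedFun a n = fun z => (Real.exp (-‖z‖ ^ 2 / 2) : ℂ) *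
      ((Real.sqrt (n.factorial : ℝ) : ℂ)⁻¹ * hermiteSeries a n z) := by
    funext z; rw [normalizedFun, ha.landauFun_eq]
  rw [e]
  refine ContDiff.mul ?_ (contDiff_const.mul (ha.contDiff_hermiteSeries n))
  refine Complex.ofRealCLM.contDiff.comp (Real.contDiff_exp.comp ?_)
  exact ((contDiff_norm_sq ℝ).neg).div_const 2

lemma Tempered.contDiff_fluctuation {a : ℕ → ℂ} (ha : Tempered a) (z₀ : ℂ) (N : ℕ) :
    ContDiff ℝ 1 (fluctuation a z₀ N) := by
  unfold fluctuation averagedField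
  refine contDiff_const.mul (ContDiff.sub (contDiff_const.mul (ContDiff.sum fun n _ => ?_))
    contDiff_const)
  refine ContDiff.norm_sq ℝ ((ha.contDiff_normalizedFun n).comp ?_)
  exact contDiff_const.add (contDiff_const.mul contDiff_id)

/-- The points at which the fields are evaluated. -/
def scaledPoint (z₀ : ℂ) (N : ℕ) (ξ : ℂ) : ℂ := z₀ + (Real.sqrt N : ℂ) * ξ

section FluctuationForms

variable {J : Type*}

/-- The coefficient vectors of `X_n(z₀ + √N ξ_j)`. -/
def fluctuationVec (z₀ : ℂ) (N : ℕ) (ξ : J → ℂ) (p : Fin N × J) (k : ℕ) : ℂ :=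
  displacement p.1 k (scaledPoint z₀ N (ξ p.2))

/-- The coefficients of the quadratic form of `∑ c_j 𝒢_N(ξ_j)`. -/
def fluctuationCoeff (N : ℕ) (c : J → ℝ) (p : Fin N × J) : ℝ := c p.2 / Real.sqrt N

lemma summable_fluctuationVec (z₀ : ℂ) (N : ℕ) (ξ : J → ℂ) (p : Fin N × J) :
    Summable fun k => 2 ^ k * ‖fluctuationVec z₀ N ξ p k‖ :=
  summable_displacement _ _

/-- The Gram matrix of the coefficient vectors. -/
def fluctuationGram (z₀ : ℂ) (N : ℕ) (ξ : J → ℂ) (p q : Fin N × J) : ℂ :=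
  Complex.exp (Complex.I * (scaledPoint z₀ N (ξ p.2) * conj (scaledPoint z₀ N (ξ q.2))).im) *
    conj (displacement q.1 p.1 (scaledPoint z₀ N (ξ q.2) - scaledPoint z₀ N (ξ p.2)))

lemma hasSum_fluctuationGram (z₀ : ℂ) (N : ℕ) (ξ : J → ℂ) (p q : Fin N × J) :
    HasSum (fun k => fluctuationVec z₀ N ξ p k * conj (fluctuationVec z₀ N ξ q k))
      (fluctuationGram z₀ N ξ p q) :=
  hasSum_displacement_mul _ _ _ _

lemma fluctuationGram_self (z₀ : ℂ) (N : ℕ) (ξ : J → ℂ) (p : Fin N × J) :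
    fluctuationGram z₀ N ξ p p = 1 := by
  have h := hasSum_displacement_mul_self (p.1 : ℕ) p.1 (scaledPoint z₀ N (ξ p.2))
  rw [if_pos rfl] at h
  exact (hasSum_fluctuationGram z₀ N ξ p p).unique h

/-- In modulus the phase disappears, the base point cancels in the difference, and radiality leaves
only the distance. -/
lemma norm_fluctuationGram (z₀ : ℂ) (N : ℕ) (ξ : J → ℂ) (p q : Fin N × J) :
    ‖fluctuationGram z₀ N ξ p q‖ =
      ‖displacement q.1 p.1 ((Real.sqrt N * ‖ξ p.2 - ξ q.2‖ : ℝ) : ℂ)‖ := by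
  have e : ‖scaledPoint z₀ N (ξ q.2) - scaledPoint z₀ N (ξ p.2)‖ =
      Real.sqrt N * ‖ξ p.2 - ξ q.2‖ := by
    rw [scaledPoint, scaledPoint, add_sub_add_left_eq_sub, ← mul_sub, norm_mul, norm_sub_rev,
      Complex.norm_real, Real.norm_eq_abs, abs_of_nonneg (Real.sqrt_nonneg _)]
  rw [fluctuationGram, norm_mul, RCLike.norm_conj, norm_displacement_eq, e, Complex.norm_exp]
  simp

variable [Fintype J]

lemma Tempered.sum_fluctuation {a : ℕ → ℂ} (ha : Tempered a) (z₀ : ℂ) {N : ℕ} (hN : 1 ≤ N)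
    (c : J → ℝ) (ξ : J → ℂ) : ∑ j, c j * fluctuation a z₀ N (ξ j) =
      seriesForm (fluctuationCoeff N c) (fluctuationVec z₀ N ξ) a := by
  have hN0 : (0 : ℝ) < N := by exact_mod_cast hN
  have hs : Real.sqrt N * Real.sqrt N = N := Real.mul_self_sqrt hN0.le
  have hs0 : Real.sqrt N ≠ 0 := (Real.sqrt_pos.mpr hN0).ne'
  rw [seriesForm, Fintype.sum_prod_type_right]
  refine Finset.sum_congr rfl fun j _ => ?_
  have e : ∀ n : Fin N, ∑' k, a k * fluctuationVec z₀ N ξ (n, j) k =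
      normalizedFun a n (scaledPoint z₀ N (ξ j)) := fun n => (ha.normalizedFun_eq _ _).symm
  simp only [fluctuationCoeff, e]
  rw [← Finset.mul_sum, Finset.sum_sub_distrib,
    ← Finset.sum_range (fun n => ‖normalizedFun a n (scaledPoint z₀ N (ξ j))‖ ^ 2), fluctuation,
    averagedField]
  simp only [Finset.sum_const, Finset.card_univ, Fintype.card_fin, nsmul_eq_mul, mul_one]
  change c j * (Real.sqrt N * (1 / N * (∑ n ∈ Finset.range N,
    ‖normalizedFun a n (scaledPoint z₀ N (ξ j))‖ ^ 2) - 1)) = _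
  have h1 : Real.sqrt N * (1 / N) = 1 / Real.sqrt N := by
    rw [mul_one_div, div_eq_div_iff hN0.ne' hs0, hs, one_mul]
  have h2 : Real.sqrt N = N * (1 / Real.sqrt N) := by
    rw [mul_one_div, eq_div_iff hs0, hs]
  rw [mul_sub, ← mul_assoc, h1, mul_one]
  nth_rewrite 2 [h2]
  ring

/-- The prelimiting covariance of `∑ c_j 𝒢_N(ξ_j)`. -/
def prelimitVariance (N : ℕ) (c : J → ℝ) (ξ : J → ℂ) : ℝ :=
  ∑ i, ∑ j, c i * c j * prelimitKernel N ‖ξ i - ξ j‖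

lemma sum_fluctuationGram (z₀ : ℂ) (N : ℕ) (c : J → ℝ) (ξ : J → ℂ) :
    ∑ p, ∑ q, fluctuationCoeff N c p * fluctuationCoeff N c q * ‖fluctuationGram z₀ N ξ p q‖ ^ 2 =
      prelimitVariance N c ξ := by
  simp only [norm_fluctuationGram, Fintype.sum_prod_type_right, fluctuationCoeff]
  rw [prelimitVariance]
  refine Finset.sum_congr rfl fun i _ => ?_
  rw [Finset.sum_comm]
  refine Finset.sum_congr rfl fun j _ => ?_
  rw [prelimitKernel, Finset.sum_comm, Finset.sum_range, Finset.mul_sum, Finset.mul_sum]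
  refine Finset.sum_congr rfl fun n _ => ?_
  rw [Finset.sum_range, Finset.mul_sum, Finset.mul_sum]
  refine Finset.sum_congr rfl fun m _ => ?_
  rw [div_mul_div_comm, Real.mul_self_sqrt (Nat.cast_nonneg N)]
  ring

/-- Bessel's inequality for the rows of the displacement matrices. -/
lemma sum_norm_inner_displacement_le (N M : ℕ) (z : ℂ) (x : EuclideanSpace ℂ (Fin M)) :
    ∑ n : Fin N, ‖⟪truncate (fun k => conj (displacement n k z)) M, x⟫_ℂ‖ ^ 2 ≤ ‖x‖ ^ 2 := by
  -- Truncated rows are no longer orthonormal. Extending x by zero to ℓ² allows Bessel's inequality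
  -- for the full rows without changing the inner products.
  let X : ℕ → ℂ := fun k => if h : k < M then x ⟨k, h⟩ else 0
  have hX : Memℓp X 2 := by
    refine memℓp_gen (summable_of_ne_finset_zero (s := Finset.range M) fun k hk => ?_)
    rw [Finset.mem_range] at hk
    simp [X, hk]
  have hV : ∀ n : ℕ, Memℓp (fun k => conj (displacement n k z)) 2 := fun n => by
    refine memℓp_gen ?_
    simpa using (hasSum_normSq_displacement n z).summable
  let V : Fin N → lp (fun _ : ℕ => ℂ) 2 := fun n => ⟨_, hV n⟩
  have horth : Orthonormal ℂ V := by
    rw [orthonormal_iff_ite]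
    intro n m
    rw [lp.inner_eq_tsum]
    have h := (hasSum_displacement_mul_self (n : ℕ) m z).tsum_eq
    simp only [← Fin.ext_iff] at h
    rw [← h]
    exact tsum_congr fun k => by simp [V, mul_comm]
  have h := horth.sum_inner_products_le (x := ⟨X, hX⟩) (s := Finset.univ)
  have e1 : ‖(⟨X, hX⟩ : lp (fun _ : ℕ => ℂ) 2)‖ ^ 2 = ‖x‖ ^ 2 := by
    have h2 := lp.norm_rpow_eq_tsum (p := 2) (by norm_num) (⟨X, hX⟩ : lp (fun _ : ℕ => ℂ) 2)
    simp only [ENNReal.toReal_ofNat, Real.rpow_ofNat] at h2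
    rw [h2, tsum_eq_sum (s := Finset.range M), Finset.sum_range, EuclideanSpace.norm_sq_eq]
    · exact Finset.sum_congr rfl fun k _ => by simp [X]
    · intro k hk
      rw [Finset.mem_range] at hk
      simp [X, hk]
  have e2 : ∀ n, ⟪V n, (⟨X, hX⟩ : lp (fun _ : ℕ => ℂ) 2)⟫_ℂ =
      ⟪truncate (fun k => conj (displacement n k z)) M, x⟫_ℂ := by
    intro n
    rw [lp.inner_eq_tsum, tsum_eq_sum (s := Finset.range M), Finset.sum_range, PiLp.inner_apply]
    · exact Finset.sum_congr rfl fun k _ => by simp [X, V, truncate]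
    · intro k hk
      rw [Finset.mem_range] at hk
      simp [X, hk]
  simpa only [e1, e2] using h

/-- For each j the N rows at one point are orthonormal, so its form has norm at most |c_j|/√N. This
smallness of all eigenvalues replaces a Lindeberg condition. -/
lemma abs_sum_fluctuationCoeff_le (z₀ : ℂ) (N : ℕ) (c : J → ℝ) (ξ : J → ℂ) (M : ℕ)
    (x : EuclideanSpace ℂ (Fin M)) :
    |∑ p, fluctuationCoeff N c p * ‖⟪truncateConj (fluctuationVec z₀ N ξ) M p, x⟫_ℂ‖ ^ 2| ≤
      (∑ j, |c j|) / Real.sqrt N * ‖x‖ ^ 2 := by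
  rw [Fintype.sum_prod_type_right, Finset.sum_div, Finset.sum_mul]
  refine (Finset.abs_sum_le_sum_abs _ _).trans (Finset.sum_le_sum fun j _ => ?_)
  simp only [fluctuationCoeff]
  rw [← Finset.mul_sum, abs_mul, abs_div, abs_of_nonneg (Real.sqrt_nonneg _)]
  refine mul_le_mul_of_nonneg_left ?_ (by positivity)
  rw [abs_of_nonneg (Finset.sum_nonneg fun _ _ => by positivity)]
  exact sum_norm_inner_displacement_le N M (scaledPoint z₀ N (ξ j)) x

variable {Ω : Type*} [MeasurableSpace Ω] {P : Measure Ω} {ζ : ℕ → Ω → ℂ}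

lemma aemeasurable_fluctuation (hlaw : ∀ k, HasLaw (ζ k) stdComplexGaussian P) (z₀ : ℂ) (N : ℕ)
    (ξ : ℂ) : AEMeasurable (fun ω => fluctuation (fun k => ζ k ω) z₀ N ξ) P := by
  rcases Nat.eq_zero_or_pos N with rfl | hN
  · simp only [fluctuation, Nat.cast_zero, Real.sqrt_zero, zero_mul]
    exact aemeasurable_const
  · refine (aemeasurable_seriesForm hlaw (summable_fluctuationVec z₀ N _)
      (hasSum_fluctuationGram z₀ N fun _ : Unit => ξ) (fluctuationGram_self z₀ N _)
      (fluctuationCoeff N fun _ => 1)).congr ?_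
    filter_upwards [ae_tempered hlaw] with ω hω
    have := hω.sum_fluctuation z₀ hN (fun _ : Unit => 1) (fun _ => ξ)
    simpa using this.symm

lemma lintegral_exp_sum_fluctuation_le (hlaw : ∀ k, HasLaw (ζ k) stdComplexGaussian P)
    (hindep : iIndepFun ζ P) (z₀ : ℂ) {N : ℕ} (hN : 1 ≤ N) (c : J → ℝ) (ξ : J → ℂ) {s : ℝ}
    (hs : s ^ 2 * prelimitVariance N c ξ ≤ 1 / 8) :
    ∫⁻ ω, ENNReal.ofReal (Real.exp (s * ∑ j, c j * fluctuation (fun k => ζ k ω) z₀ N (ξ j))) ∂P ≤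
      2 := by
  have h := lintegral_exp_seriesForm_le hlaw hindep (s := s) (summable_fluctuationVec z₀ N _)
    (hasSum_fluctuationGram z₀ N ξ) (fluctuationGram_self z₀ N ξ) (fluctuationCoeff N c)
    (by rw [sum_fluctuationGram]; linarith)
  rw [sum_fluctuationGram] at h
  calc _ = _ := lintegral_congr_ae (by
        filter_upwards [ae_tempered hlaw] with ω hω
        rw [hω.sum_fluctuation z₀ hN])
    _ ≤ _ := h
    _ ≤ ENNReal.ofReal 2 := by
        refine ENNReal.ofReal_le_ofReal ?_
        have h1 : Real.exp (2 * (s ^ 2 * prelimitVariance N c ξ)) ≤ Real.exp (1 / 4 : ℝ) :=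
          Real.exp_le_exp.mpr (by linarith)
        have h2 := Real.exp_bound_div_one_sub_of_interval (x := 1 / 4) (by norm_num) (by norm_num)
        norm_num at h2 ⊢
        linarith
    _ = 2 := by norm_num

lemma lintegral_sub_fluctuation_pow_le (hlaw : ∀ k, HasLaw (ζ k) stdComplexGaussian P)
    (hindep : iIndepFun ζ P) (z₀ : ℂ) {N : ℕ} (hN : 1 ≤ N) (ξ η : ℂ) {p : ℕ} (hp : p ≠ 0) :
    ∫⁻ ω, ENNReal.ofReal (|fluctuation (fun k => ζ k ω) z₀ N ξ -
        fluctuation (fun k => ζ k ω) z₀ N η| ^ (2 * p)) ∂P ≤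
      ENNReal.ofReal (4 * (2 * p).factorial * 32 ^ p * ‖ξ - η‖ ^ p) := by
  rcases eq_or_ne ξ η with rfl | hne
  · simp [hp]
  have hr : 0 < ‖ξ - η‖ := norm_pos_iff.mpr (sub_ne_zero.mpr hne)
  have hm := (aemeasurable_fluctuation hlaw z₀ N ξ).sub (aemeasurable_fluctuation hlaw z₀ N η)
  -- The increment has variance 2(1 - κ_N) ≤ 4‖ξ - η‖, whence v, and 8v gives the factor 32^p.
  have h := lintegral_pow_le_of_exp_moments hm (v := 4 * ‖ξ - η‖) (by positivity) (fun s hs => ?_) p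
  · refine h.trans_eq ?_
    congr 1; ring
  · have h2 := lintegral_exp_sum_fluctuation_le hlaw hindep z₀ hN (s := s) ![1, -1] ![ξ, η] (by
      have h1 := one_sub_prelimitKernel_le hN hr.le
      have e : prelimitVariance N ![1, -1] ![ξ, η] = 2 * (1 - prelimitKernel N ‖ξ - η‖) := by
        simp [prelimitVariance, Fin.sum_univ_two, prelimitKernel_zero hN, norm_sub_rev η ξ]
        ring
      rw [e]
      nlinarith [sq_nonneg s])
    simpa [Fin.sum_univ_two, ← sub_eq_add_neg] using h2

lemma lintegral_fluctuation_pow_le (hlaw : ∀ k, HasLaw (ζ k) stdComplexGaussian P)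
    (hindep : iIndepFun ζ P) (z₀ : ℂ) {N : ℕ} (hN : 1 ≤ N) (ξ : ℂ) (p : ℕ) :
    ∫⁻ ω, ENNReal.ofReal (|fluctuation (fun k => ζ k ω) z₀ N ξ| ^ (2 * p)) ∂P ≤
      ENNReal.ofReal (4 * (2 * p).factorial * 8 ^ p) := by
  have h := lintegral_pow_le_of_exp_moments (aemeasurable_fluctuation hlaw z₀ N ξ) one_pos
    (fun s hs => ?_) p
  · simpa using h
  · have h2 := lintegral_exp_sum_fluctuation_le hlaw hindep z₀ hN (s := s) (fun _ : Unit => 1)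
      (fun _ => ξ) (by simpa [prelimitVariance, prelimitKernel_zero hN] using hs)
    simpa using h2

variable [IsProbabilityMeasure P]

lemma tendsto_integral_exp_sum_fluctuation (hlaw : ∀ k, HasLaw (ζ k) stdComplexGaussian P)
    (hindep : iIndepFun ζ P) (z₀ : ℂ) (c : J → ℝ) (ξ : J → ℂ) :
    Tendsto (fun N : ℕ => ∫ ω, Complex.exp (Complex.I *
      (∑ j, c j * fluctuation (fun k => ζ k ω) z₀ N (ξ j) : ℝ)) ∂P) atTop
      (𝓝 (Complex.exp (-((∑ i, ∑ j, c i * c j * overlapKernel ‖ξ i - ξ j‖) / 2 : ℝ)))) := by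
  have hvar : Tendsto (fun N => prelimitVariance N c ξ) atTop
      (𝓝 (∑ i, ∑ j, c i * c j * overlapKernel ‖ξ i - ξ j‖)) :=
    tendsto_finsetSum _ fun i _ => tendsto_finsetSum _ fun j _ =>
      (tendsto_prelimitKernel _).const_mul _
  have hsqrt : Tendsto (fun N : ℕ => Real.sqrt N) atTop atTop :=
    Real.tendsto_sqrt_atTop.comp tendsto_natCast_atTop_atTop
  have hL : Tendsto (fun N : ℕ => (∑ j, |c j|) / Real.sqrt N) atTop (𝓝 0) :=
    tendsto_const_nhds.div_atTop hsqrt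
  have hcon : Continuous fun x : ℝ => Complex.exp (-(x / 2 : ℝ)) := by fun_prop
  have h2 := hcon.continuousAt.tendsto.comp hvar
  have h3 := (hL.const_mul 2).mul hvar
  rw [mul_zero, zero_mul] at h3
  refine h2.congr_dist ?_
  refine squeeze_zero' (Eventually.of_forall fun N => dist_nonneg) ?_ h3
  filter_upwards [eventually_ge_atTop 1, hL.eventually_le_const (show (0 : ℝ) < 1 / 2 by norm_num)]
    with N hN hLN
  have h := norm_integral_exp_seriesForm_sub_le hlaw hindep (summable_fluctuationVec z₀ N _)
    (hasSum_fluctuationGram z₀ N ξ) (fluctuationGram_self z₀ N ξ) (fluctuationCoeff N c) hLN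
    (abs_sum_fluctuationCoeff_le z₀ N c ξ)
  rw [sum_fluctuationGram] at h
  rw [dist_comm, dist_eq_norm]
  refine le_of_eq_of_le ?_ h
  congr 2
  refine integral_congr_ae ?_
  filter_upwards [ae_tempered hlaw] with ω hω
  rw [hω.sum_fluctuation z₀ hN]

end FluctuationForms

end

section

open scoped Topology

/-! ### Dyadic chaining -/

section Dyadic

/-- The dyadic approximation of `x` from below at level `m`. -/
def dyadicFloor (m : ℕ) (x : ℝ) : ℝ := (⌊2 ^ m * x⌋₊ : ℝ) / 2 ^ m

lemma dyadicFloor_index_lt (m : ℕ) {x : ℝ} (h1 : x < 1) : ⌊2 ^ m * x⌋₊ < 2 ^ m := by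
  have h2 : (0 : ℝ) < 2 ^ m := by positivity
  rw [Nat.floor_lt' (by positivity)]
  push_cast
  nlinarith

lemma dyadicFloor_succ_index (m : ℕ) {x : ℝ} (h0 : 0 ≤ x) :
    2 * ⌊2 ^ m * x⌋₊ ≤ ⌊2 ^ (m + 1) * x⌋₊ ∧ ⌊2 ^ (m + 1) * x⌋₊ ≤ 2 * ⌊2 ^ m * x⌋₊ + 1 := by
  have h2 : (0 : ℝ) ≤ 2 ^ m * x := by positivity
  have h3 := Nat.floor_le h2
  have h4 := Nat.lt_floor_add_one (2 ^ m * x)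
  have e : (2 : ℝ) ^ (m + 1) * x = 2 * (2 ^ m * x) := by ring
  rw [e]
  constructor
  · apply Nat.le_floor
    push_cast
    linarith
  · rw [← Nat.lt_succ_iff, Nat.floor_lt (by positivity)]
    push_cast
    linarith

lemma dyadicFloor_index_le (m : ℕ) {x y : ℝ} (hx : 0 ≤ x) (hxy : |x - y| ≤ (1 / 2) ^ m) :
    ⌊2 ^ m * x⌋₊ ≤ ⌊2 ^ m * y⌋₊ + 1 := by
  have h2 : (0 : ℝ) < 2 ^ m := by positivity
  have h3 := Nat.floor_le (show (0 : ℝ) ≤ 2 ^ m * x by positivity)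
  have h4 := Nat.lt_floor_add_one (2 ^ m * y)
  have h5 : 2 ^ m * (x - y) ≤ 1 := by
    calc 2 ^ m * (x - y) ≤ 2 ^ m * (1 / 2) ^ m := by
          gcongr; exact (le_abs_self _).trans hxy
      _ = 1 := by rw [← mul_pow]; norm_num
  have h6 : (⌊2 ^ m * x⌋₊ : ℝ) < (⌊2 ^ m * y⌋₊ + 1 + 1 : ℕ) := by
    push_cast
    linarith
  have := Nat.cast_lt.mp h6
  omega

/-- The increments of `h` over the edges of the level-`m` dyadic grid are at most `A r ^ m`. -/
def DyadicBound (h : ℝ → ℝ → ℝ) (A r : ℝ) : Prop :=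
  ∀ m i j : ℕ, i ≤ 2 ^ m → j ≤ 2 ^ m →
    |h ((i + 1 : ℕ) / 2 ^ m) (j / 2 ^ m) - h (i / 2 ^ m) (j / 2 ^ m)| ≤ A * r ^ m ∧
    |h (i / 2 ^ m) ((j + 1 : ℕ) / 2 ^ m) - h (i / 2 ^ m) (j / 2 ^ m)| ≤ A * r ^ m

variable {h : ℝ → ℝ → ℝ} {A r : ℝ}

lemma DyadicBound.abs_grid_sub_le (hb : DyadicBound h A r) (hA : 0 ≤ A) (hr : 0 ≤ r) (m : ℕ)
    {i i' j j' : ℕ} (hi : i ≤ 2 ^ m) (hi' : i' ≤ 2 ^ m) (hj : j ≤ 2 ^ m) (hj' : j' ≤ 2 ^ m)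
    (h1 : i ≤ i' + 1) (h2 : i' ≤ i + 1) (h3 : j ≤ j' + 1) (h4 : j' ≤ j + 1) :
    |h (i' / 2 ^ m) (j' / 2 ^ m) - h (i / 2 ^ m) (j / 2 ^ m)| ≤ 2 * A * r ^ m := by
  have hE : 0 ≤ A * r ^ m := by positivity
  have hx : |h (i' / 2 ^ m) (j / 2 ^ m) - h (i / 2 ^ m) (j / 2 ^ m)| ≤ A * r ^ m := by
    rcases (by omega : i' = i ∨ i' = i + 1 ∨ i = i' + 1) with rfl | rfl | rfl
    · simpa using hE
    · exact (hb m i j hi hj).1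
    · rw [abs_sub_comm]; exact (hb m i' j hi' hj).1
  have hy : |h (i' / 2 ^ m) (j' / 2 ^ m) - h (i' / 2 ^ m) (j / 2 ^ m)| ≤ A * r ^ m := by
    rcases (by omega : j' = j ∨ j' = j + 1 ∨ j = j' + 1) with rfl | rfl | rfl
    · simpa using hE
    · exact (hb m i' j hi' hj).2
    · rw [abs_sub_comm]; exact (hb m i' j' hi' hj').2
  have := abs_sub_le (h (i' / 2 ^ m) (j' / 2 ^ m)) (h (i' / 2 ^ m) (j / 2 ^ m))
    (h (i / 2 ^ m) (j / 2 ^ m))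
  linarith

/-- The limit of `h` along the dyadic approximations of `(x, y)`. -/
def dyadicLim (h : ℝ → ℝ → ℝ) (x y : ℝ) : ℝ :=
  limUnder atTop fun m => h (dyadicFloor m x) (dyadicFloor m y)

/-- The level-m approximation is itself a point of the level m + 1 grid, at most one edge away in
each coordinate. -/
lemma DyadicBound.dist_succ_le (hb : DyadicBound h A r) (hA : 0 ≤ A) (hr : 0 ≤ r) (hr1 : r ≤ 1)
    {x y : ℝ} (hx : 0 ≤ x) (hx1 : x < 1) (hy : 0 ≤ y) (hy1 : y < 1) (m : ℕ) :
    dist (h (dyadicFloor m x) (dyadicFloor m y)) (h (dyadicFloor (m + 1) x) (dyadicFloor (m + 1) y))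
      ≤ 2 * A * r ^ m := by
  have ex : ∀ x : ℝ, dyadicFloor m x = ((2 * ⌊2 ^ m * x⌋₊ : ℕ) : ℝ) / 2 ^ (m + 1) := by
    intro x
    rw [dyadicFloor, pow_succ]
    push_cast
    field_simp
  have bx := dyadicFloor_succ_index m hx
  have by' := dyadicFloor_succ_index m hy
  have lx := dyadicFloor_index_lt m hx1
  have ly := dyadicFloor_index_lt m hy1
  have lx' := dyadicFloor_index_lt (m + 1) hx1
  have ly' := dyadicFloor_index_lt (m + 1) hy1
  have e2 : 2 ^ (m + 1) = 2 * 2 ^ m := by ring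
  rw [ex, ex, dist_comm, Real.dist_eq]
  refine (hb.abs_grid_sub_le hA hr (m + 1) (by omega) lx'.le (by omega) ly'.le (by omega) (by omega)
    (by omega) (by omega)).trans ?_
  rw [pow_succ]
  have : r ^ m * r ≤ r ^ m := mul_le_of_le_one_right (by positivity) hr1
  gcongr

lemma DyadicBound.tendsto_dyadicLim (hb : DyadicBound h A r) (hA : 0 ≤ A) (hr : 0 ≤ r)
    (hr1 : r < 1) {x y : ℝ} (hx : 0 ≤ x) (hx1 : x < 1) (hy : 0 ≤ y) (hy1 : y < 1) :
    Tendsto (fun m => h (dyadicFloor m x) (dyadicFloor m y)) atTop (𝓝 (dyadicLim h x y)) :=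
  (cauchySeq_of_le_geometric r (2 * A) hr1
    (hb.dist_succ_le hA hr hr1.le hx hx1 hy hy1)).tendsto_limUnder

/-- At level m the two approximations are grid neighbours, costing 2A r^m; the two geometric tails
from there to the limits cost 2A r^m/(1 - r) each. -/
lemma DyadicBound.abs_dyadicLim_sub_le (hb : DyadicBound h A r) (hA : 0 ≤ A) (hr : 0 ≤ r)
    (hr1 : r < 1) {x y x' y' : ℝ} (hx : 0 ≤ x) (hx1 : x < 1) (hy : 0 ≤ y) (hy1 : y < 1)
    (hx' : 0 ≤ x') (hx1' : x' < 1) (hy' : 0 ≤ y') (hy1' : y' < 1) {m : ℕ}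
    (hdx : |x - x'| ≤ (1 / 2) ^ m) (hdy : |y - y'| ≤ (1 / 2) ^ m) :
    |dyadicLim h x y - dyadicLim h x' y'| ≤ (4 / (1 - r) + 2) * A * r ^ m := by
  have h1 := dist_le_of_le_geometric_of_tendsto r (2 * A) hr1
    (hb.dist_succ_le hA hr hr1.le hx hx1 hy hy1) (hb.tendsto_dyadicLim hA hr hr1 hx hx1 hy hy1) m
  have h2 := dist_le_of_le_geometric_of_tendsto r (2 * A) hr1
    (hb.dist_succ_le hA hr hr1.le hx' hx1' hy' hy1')
    (hb.tendsto_dyadicLim hA hr hr1 hx' hx1' hy' hy1') m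
  have h3 := hb.abs_grid_sub_le hA hr m (dyadicFloor_index_lt m hx1').le (dyadicFloor_index_lt m hx1).le
    (dyadicFloor_index_lt m hy1').le (dyadicFloor_index_lt m hy1).le
    (dyadicFloor_index_le m hx' (by rwa [abs_sub_comm])) (dyadicFloor_index_le m hx hdx)
    (dyadicFloor_index_le m hy' (by rwa [abs_sub_comm])) (dyadicFloor_index_le m hy hdy)
  change |h (dyadicFloor m x) (dyadicFloor m y) - h (dyadicFloor m x') (dyadicFloor m y')| ≤ _ at h3
  rw [Real.dist_eq, abs_sub_comm] at h1
  rw [Real.dist_eq] at h2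
  have h4 := abs_sub_le (dyadicLim h x y) (h (dyadicFloor m x) (dyadicFloor m y))
    (dyadicLim h x' y')
  have h5 := abs_sub_le (h (dyadicFloor m x) (dyadicFloor m y))
    (h (dyadicFloor m x') (dyadicFloor m y')) (dyadicLim h x' y')
  have e : (4 / (1 - r) + 2) * A * r ^ m =
      2 * A * r ^ m / (1 - r) + 2 * A * r ^ m + 2 * A * r ^ m / (1 - r) := by ring
  rw [e]
  linarith

lemma DyadicBound.abs_dyadicLim_sub_le_rpow {β : ℝ} (hβ : 0 < β)
    (hb : DyadicBound h A ((1 / 2) ^ β)) (hA : 0 ≤ A) {x y x' y' : ℝ} (hx : 0 ≤ x) (hx1 : x < 1)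
    (hy : 0 ≤ y) (hy1 : y < 1) (hx' : 0 ≤ x') (hx1' : x' < 1) (hy' : 0 ≤ y') (hy1' : y' < 1)
    {d : ℝ} (hd : 0 < d) (hdx : |x - x'| ≤ d) (hdy : |y - y'| ≤ d) :
    |dyadicLim h x y - dyadicLim h x' y'| ≤
      (4 / (1 - (1 / 2) ^ β) + 2) * A * (2 * d) ^ β := by
  have hr1 : (1 / 2 : ℝ) ^ β < 1 := Real.rpow_lt_one (by norm_num) (by norm_num) hβ
  have hr0 : (0 : ℝ) ≤ (1 / 2 : ℝ) ^ β := by positivity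
  have hC : 0 ≤ (4 / (1 - (1 / 2 : ℝ) ^ β) + 2) * A := by
    have : 0 < 1 - (1 / 2 : ℝ) ^ β := by linarith
    positivity
  rcases le_or_gt d 1 with hd1 | hd1
  -- The level satisfies 2^{-(m+1)} < d ≤ 2^{-m}, hence 2^{-m} < 2d; distances above 1 are handled
  -- at level 0.
  · obtain ⟨m, hm1, hm2⟩ := exists_nat_pow_near_of_lt_one hd hd1 (y := 1 / 2)
      (by norm_num) (by norm_num)
    refine (hb.abs_dyadicLim_sub_le hA hr0 hr1 hx hx1 hy hy1 hx' hx1' hy' hy1'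
      (hdx.trans hm2) (hdy.trans hm2)).trans ?_
    refine mul_le_mul_of_nonneg_left ?_ hC
    rw [← Real.rpow_natCast, ← Real.rpow_mul (by norm_num), mul_comm, Real.rpow_mul (by norm_num),
      Real.rpow_natCast]
    refine Real.rpow_le_rpow (by positivity) ?_ hβ.le
    rw [pow_succ] at hm1
    linarith
  · refine (hb.abs_dyadicLim_sub_le hA hr0 hr1 hx hx1 hy hy1 hx' hx1' hy' hy1' (m := 0)
      ?_ ?_).trans ?_
    · rw [pow_zero, abs_le]; constructor <;> linarith
    · rw [pow_zero, abs_le]; constructor <;> linarith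
    · rw [pow_zero]
      exact mul_le_mul_of_nonneg_left (Real.one_le_rpow (by linarith) hβ.le) hC

lemma tendsto_dyadicFloor {x : ℝ} (hx : 0 ≤ x) :
    Tendsto (fun m => dyadicFloor m x) atTop (𝓝 x) := by
  have h2 : Tendsto (fun m : ℕ => (2 : ℝ) ^ m) atTop atTop :=
    tendsto_pow_atTop_atTop_of_one_lt (by norm_num)
  have := (tendsto_nat_floor_mul_div_atTop hx).comp h2
  simpa only [dyadicFloor, Function.comp_def, mul_comm] using this

lemma abs_dyadicFloor_sub_le (m : ℕ) {x : ℝ} (hx : 0 ≤ x) :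
    |dyadicFloor m x - x| ≤ (1 / 2) ^ m := by
  have h2 : (0 : ℝ) < 2 ^ m := by positivity
  have h3 := Nat.floor_le (show (0 : ℝ) ≤ 2 ^ m * x by positivity)
  have h4 := Nat.lt_floor_add_one (2 ^ m * x)
  rw [dyadicFloor, abs_sub_comm, abs_of_nonneg, one_div, inv_pow, ← one_div, sub_le_iff_le_add,
    ← add_div, le_div_iff₀ h2]
  · linarith
  · rw [sub_nonneg, div_le_iff₀ h2]; linarith

/-- The weighted sum of the `q`-th powers of all dyadic increments. -/
def dyadicVariation (q : ℕ) (r : ℝ) (h : ℝ → ℝ → ℝ) : ENNReal :=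
  ∑' m : ℕ, ∑ i ∈ Finset.range (2 ^ m + 1), ∑ j ∈ Finset.range (2 ^ m + 1),
    ENNReal.ofReal (((r ^ m)⁻¹) ^ q) *
      (ENNReal.ofReal (|h ((i + 1 : ℕ) / 2 ^ m) (j / 2 ^ m) - h (i / 2 ^ m) (j / 2 ^ m)| ^ q) +
      ENNReal.ofReal (|h (i / 2 ^ m) ((j + 1 : ℕ) / 2 ^ m) - h (i / 2 ^ m) (j / 2 ^ m)| ^ q))

lemma dyadicBound_of_dyadicVariation_le {q : ℕ} (hq : q ≠ 0) (hr : 0 < r) (hA : 0 ≤ A)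
    (hv : dyadicVariation q r h ≤ ENNReal.ofReal (A ^ q)) : DyadicBound h A r := by
  intro m i j hi hj
  have key : ∀ d : ℝ, 0 ≤ d → ENNReal.ofReal (((r ^ m)⁻¹) ^ q) * ENNReal.ofReal (d ^ q) ≤
      ENNReal.ofReal (A ^ q) → d ≤ A * r ^ m := by
    intro d hd h1
    rw [← ENNReal.ofReal_mul (by positivity), ENNReal.ofReal_le_ofReal_iff (by positivity),
      ← mul_pow] at h1
    have := (pow_le_pow_iff_left₀ (by positivity) hA hq).mp h1
    rwa [inv_mul_le_iff₀ (by positivity), mul_comm] at this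
  have h1 : ENNReal.ofReal (((r ^ m)⁻¹) ^ q) *
      (ENNReal.ofReal (|h ((i + 1 : ℕ) / 2 ^ m) (j / 2 ^ m) - h (i / 2 ^ m) (j / 2 ^ m)| ^ q) +
      ENNReal.ofReal (|h (i / 2 ^ m) ((j + 1 : ℕ) / 2 ^ m) - h (i / 2 ^ m) (j / 2 ^ m)| ^ q)) ≤
      ENNReal.ofReal (A ^ q) := by
    refine le_trans ?_ hv
    refine le_trans ?_ (ENNReal.le_tsum m)
    refine le_trans ?_ (Finset.single_le_sum (f := fun i => ∑ j ∈ Finset.range (2 ^ m + 1), _)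
      (fun _ _ => zero_le) (Finset.mem_range.mpr (Nat.lt_succ_of_le hi)))
    exact Finset.single_le_sum (f := fun j : ℕ => ENNReal.ofReal (((r ^ m)⁻¹) ^ q) *
      (ENNReal.ofReal (|h ((i + 1 : ℕ) / 2 ^ m) (j / 2 ^ m) - h (i / 2 ^ m) (j / 2 ^ m)| ^ q) +
      ENNReal.ofReal (|h (i / 2 ^ m) ((j + 1 : ℕ) / 2 ^ m) - h (i / 2 ^ m) (j / 2 ^ m)| ^ q)))
      (fun _ _ => zero_le) (Finset.mem_range.mpr (Nat.lt_succ_of_le hj))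
  exact ⟨key _ (abs_nonneg _) ((mul_le_mul_right le_self_add _).trans h1),
    key _ (abs_nonneg _) ((mul_le_mul_right le_add_self _).trans h1)⟩

end Dyadic

/-! ### Random fields with moment bounds -/

section RandomFields

/-- The affine parametrization of the square of half side `R` by the unit square. -/
def squareMap (R x y : ℝ) : ℂ := ⟨-R + 2 * R * x, -R + 2 * R * y⟩

lemma norm_squareMap_sub_le {R : ℝ} (hR : 0 ≤ R) (x y x' y' : ℝ) :
    ‖squareMap R x y - squareMap R x' y'‖ ≤ 2 * R * (|x - x'| + |y - y'|) := by
  refine (Complex.norm_le_abs_re_add_abs_im _).trans_eq ?_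
  have e1 : (squareMap R x y - squareMap R x' y').re = 2 * R * (x - x') := by
    simp only [squareMap, Complex.sub_re]; ring
  have e2 : (squareMap R x y - squareMap R x' y').im = 2 * R * (y - y') := by
    simp only [squareMap, Complex.sub_im]; ring
  rw [e1, e2, abs_mul (2 * R), abs_mul (2 * R), abs_of_nonneg (by positivity : 0 ≤ 2 * R)]
  ring

variable {Ω : Type*} [MeasurableSpace Ω] {P : Measure Ω} {X : ℂ → Ω → ℝ}

/-- The restriction of a path to the square of half side `R`, in unit coordinates. -/
def squarePath (X : ℂ → Ω → ℝ) (R : ℝ) (ω : Ω) (x y : ℝ) : ℝ := X (squareMap R x y) ω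

lemma aemeasurable_dyadicVariation (hX : ∀ ξ, AEMeasurable (X ξ) P) (R : ℝ) (q : ℕ) (r : ℝ) :
    AEMeasurable (fun ω => dyadicVariation q r (squarePath X R ω)) P := by
  unfold dyadicVariation squarePath
  refine AEMeasurable.tsum fun m => ?_
  fun_prop

/-- Level m has at most 4 · 4^m base points with two edges each, edge moments of order 2^{-mp} and
weight r^{-2pm}. The levels form a geometric series of ratio 4 r^{-2p} 2^{-p}. -/
lemma lintegral_dyadicVariation_le (hX : ∀ ξ, AEMeasurable (X ξ) P) {C : ℝ} (hC : 0 ≤ C) {p : ℕ}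
    (hm : ∀ ξ η, ∫⁻ ω, ENNReal.ofReal (|X ξ ω - X η ω| ^ (2 * p)) ∂P ≤
      ENNReal.ofReal (C * ‖ξ - η‖ ^ p)) {R : ℝ} (hR : 0 ≤ R) {r : ℝ} (hr : 0 < r)
    (hrp : 4 * (r⁻¹ ^ (2 * p) * (1 / 2) ^ p) < 1) :
    ∫⁻ ω, dyadicVariation (2 * p) r (squarePath X R ω) ∂P ≤
      ENNReal.ofReal (8 * C * (2 * R) ^ p * (1 - 4 * (r⁻¹ ^ (2 * p) * (1 / 2) ^ p))⁻¹) := by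
  have hinc : ∀ ξ η (m : ℕ), ‖ξ - η‖ ≤ 2 * R * (1 / 2) ^ m →
      ∫⁻ ω, ENNReal.ofReal (|X ξ ω - X η ω| ^ (2 * p)) ∂P ≤
        ENNReal.ofReal (C * (2 * R) ^ p * ((1 / 2) ^ p) ^ m) := by
    intro ξ η m h
    refine (hm ξ η).trans (ENNReal.ofReal_le_ofReal ?_)
    rw [mul_assoc, ← pow_mul, mul_comm p m, pow_mul, ← mul_pow]
    gcongr
  have hstep : ∀ m i : ℕ, |((i + 1 : ℕ) : ℝ) / 2 ^ m - i / 2 ^ m| = (1 / 2) ^ m := by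
    intro m i
    rw [← sub_div]
    push_cast
    rw [add_sub_cancel_left, abs_of_nonneg (by positivity), one_div_pow]
  set ρ := 4 * (r⁻¹ ^ (2 * p) * (1 / 2) ^ p) with hρ
  have hρ0 : 0 ≤ ρ := by positivity
  have hterm : ∀ m : ℕ, ∫⁻ ω, ∑ i ∈ Finset.range (2 ^ m + 1), ∑ j ∈ Finset.range (2 ^ m + 1),
      ENNReal.ofReal (((r ^ m)⁻¹) ^ (2 * p)) *
      (ENNReal.ofReal (|squarePath X R ω ((i + 1 : ℕ) / 2 ^ m) (j / 2 ^ m) -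
        squarePath X R ω (i / 2 ^ m) (j / 2 ^ m)| ^ (2 * p)) +
      ENNReal.ofReal (|squarePath X R ω (i / 2 ^ m) ((j + 1 : ℕ) / 2 ^ m) -
        squarePath X R ω (i / 2 ^ m) (j / 2 ^ m)| ^ (2 * p))) ∂P ≤
      ENNReal.ofReal (8 * C * (2 * R) ^ p * ρ ^ m) := by
    intro m
    have hsm : ∀ x y, AEMeasurable (fun ω => squarePath X R ω x y) P := fun x y => hX _
    rw [lintegral_finsetSum' _ (fun i _ => by fun_prop)]
    have hone : ∀ i ∈ Finset.range (2 ^ m + 1), ∫⁻ ω, ∑ j ∈ Finset.range (2 ^ m + 1),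
      ENNReal.ofReal (((r ^ m)⁻¹) ^ (2 * p)) *
      (ENNReal.ofReal (|squarePath X R ω ((i + 1 : ℕ) / 2 ^ m) (j / 2 ^ m) -
        squarePath X R ω (i / 2 ^ m) (j / 2 ^ m)| ^ (2 * p)) +
      ENNReal.ofReal (|squarePath X R ω (i / 2 ^ m) ((j + 1 : ℕ) / 2 ^ m) -
        squarePath X R ω (i / 2 ^ m) (j / 2 ^ m)| ^ (2 * p))) ∂P ≤
      (2 ^ m + 1 : ℕ) • ENNReal.ofReal (((r ^ m)⁻¹) ^ (2 * p) *
        (2 * (C * (2 * R) ^ p * ((1 / 2) ^ p) ^ m))) := by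
      intro i _
      rw [lintegral_finsetSum' _ (fun j _ => by fun_prop)]
      refine (Finset.sum_le_card_nsmul _ _ _ fun j _ => ?_).trans_eq (by rw [Finset.card_range])
      rw [lintegral_const_mul'' _ (by fun_prop), lintegral_add_left' (by fun_prop),
        ENNReal.ofReal_mul (by positivity), two_mul (C * _ * _), ENNReal.ofReal_add (by positivity)
        (by positivity)]
      refine mul_le_mul_right (add_le_add (hinc _ _ m ?_) (hinc _ _ m ?_)) _
      · refine (norm_squareMap_sub_le hR _ _ _ _).trans_eq ?_
        rw [hstep, sub_self, abs_zero, add_zero]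
      · refine (norm_squareMap_sub_le hR _ _ _ _).trans_eq ?_
        rw [hstep, sub_self, abs_zero, zero_add]
    refine (Finset.sum_le_card_nsmul _ _ _ hone).trans ?_
    rw [Finset.card_range, smul_smul, nsmul_eq_mul, ← ENNReal.ofReal_natCast,
      ← ENNReal.ofReal_mul (by positivity)]
    refine ENNReal.ofReal_le_ofReal ?_
    have h1 : ((r ^ m)⁻¹) ^ (2 * p) = (r⁻¹ ^ (2 * p)) ^ m := by
      rw [← inv_pow, ← pow_mul, ← pow_mul, mul_comm]
    have h2 : (((2 ^ m + 1) * (2 ^ m + 1) : ℕ) : ℝ) ≤ 4 * 4 ^ m := by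
      have h3 : (1 : ℝ) ≤ 2 ^ m := one_le_pow₀ (by norm_num)
      have h4 : (4 : ℝ) ^ m = 2 ^ m * 2 ^ m := by rw [← mul_pow]; norm_num
      push_cast
      rw [h4]; nlinarith
    calc _ ≤ 4 * 4 ^ m * (((r ^ m)⁻¹) ^ (2 * p) * (2 * (C * (2 * R) ^ p * ((1 / 2) ^ p) ^ m))) :=
          mul_le_mul_of_nonneg_right h2 (by positivity)
      _ = 8 * C * (2 * R) ^ p * ρ ^ m := by
          rw [h1, hρ, mul_pow, mul_pow]; ring
  unfold dyadicVariation
  rw [lintegral_tsum (fun m => by unfold squarePath; fun_prop)]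
  refine (ENNReal.tsum_le_tsum hterm).trans_eq ?_
  rw [← ENNReal.ofReal_tsum_of_nonneg (fun m => by positivity)
    ((summable_geometric_of_lt_one hρ0 hrp).mul_left _), tsum_mul_left,
    tsum_geometric_of_lt_one hρ0 hrp]

/-- The moments of the errors are summable in m, so the errors tend to 0 almost surely. This
identifies the limit along dyadic points with the original variable at each fixed point. -/
lemma ae_tendsto_dyadicFloor (hX : ∀ ξ, AEMeasurable (X ξ) P) {C : ℝ} (hC : 0 ≤ C) {p : ℕ}
    (hp : p ≠ 0) (hm : ∀ ξ η, ∫⁻ ω, ENNReal.ofReal (|X ξ ω - X η ω| ^ (2 * p)) ∂P ≤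
      ENNReal.ofReal (C * ‖ξ - η‖ ^ p)) {R : ℝ} (hR : 0 ≤ R) {x y : ℝ} (hx : 0 ≤ x) (hy : 0 ≤ y) :
    ∀ᵐ ω ∂P, Tendsto (fun m => squarePath X R ω (dyadicFloor m x) (dyadicFloor m y)) atTop
      (𝓝 (squarePath X R ω x y)) := by
  have hterm : ∀ m : ℕ, ∫⁻ ω, ENNReal.ofReal (|squarePath X R ω (dyadicFloor m x) (dyadicFloor m y)
      - squarePath X R ω x y| ^ (2 * p)) ∂P ≤ ENNReal.ofReal (C * (4 * R) ^ p * ((1 / 2) ^ p) ^ m) := by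
    intro m
    refine (hm _ _).trans (ENNReal.ofReal_le_ofReal ?_)
    rw [mul_assoc, ← pow_mul, mul_comm p m, pow_mul, ← mul_pow]
    have h1 := norm_squareMap_sub_le hR (dyadicFloor m x) (dyadicFloor m y) x y
    have h2 := abs_dyadicFloor_sub_le m hx
    have h3 := abs_dyadicFloor_sub_le m hy
    gcongr
    nlinarith
  have hgeo : (1 / 2 : ℝ) ^ p < 1 := pow_lt_one₀ (by norm_num) (by norm_num) hp
  have hsum : ∫⁻ ω, ∑' m, ENNReal.ofReal (|squarePath X R ω (dyadicFloor m x) (dyadicFloor m y)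
      - squarePath X R ω x y| ^ (2 * p)) ∂P ≠ ⊤ := by
    rw [lintegral_tsum (fun m => by unfold squarePath; fun_prop)]
    refine ne_top_of_le_ne_top ?_ (ENNReal.tsum_le_tsum hterm)
    rw [← ENNReal.ofReal_tsum_of_nonneg (fun m => by positivity)
      ((summable_geometric_of_lt_one (by positivity) hgeo).mul_left _)]
    exact ENNReal.ofReal_ne_top
  filter_upwards [ae_lt_top' (AEMeasurable.tsum fun m => by unfold squarePath; fun_prop) hsum]
    with ω hω
  have h1 := ENNReal.tendsto_atTop_zero_of_tsum_ne_top hω.ne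
  have h2 := (ENNReal.tendsto_toReal ENNReal.zero_ne_top).comp h1
  have h3 : Tendsto (fun m => |squarePath X R ω (dyadicFloor m x) (dyadicFloor m y)
      - squarePath X R ω x y| ^ (2 * p)) atTop (𝓝 0) := by
    refine h2.congr fun m => ?_
    simp only [Function.comp_apply]
    rw [ENNReal.toReal_ofReal (by positivity)]
  have h4 := h3.rpow_const (p := ((2 * p : ℕ) : ℝ)⁻¹) (Or.inr (by positivity))
  rw [Real.zero_rpow (by positivity)] at h4
  rw [tendsto_iff_dist_tendsto_zero]
  refine h4.congr fun m => ?_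
  rw [Real.dist_eq, Real.pow_rpow_inv_natCast (abs_nonneg _) (by positivity)]

end RandomFields

end

section

open scoped Topology

/-! ### Hölder versions of random fields -/

section Versions

/-- The open square of half side `R`. -/
def openSquare (R : ℝ) : Set ℂ := {ξ | |ξ.re| < R ∧ |ξ.im| < R}

lemma exists_subset_openSquare (K : TopologicalSpace.Compacts ℂ) :
    ∃ R : ℝ, 0 < R ∧ (K : Set ℂ) ⊆ openSquare R := by
  obtain ⟨R, hR⟩ := K.isCompact.isBounded.subset_ball 0
  refine ⟨max R 1, by positivity, fun ξ hξ => ?_⟩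
  have h := hR hξ
  rw [mem_ball_zero_iff] at h
  exact ⟨((Complex.abs_re_le_norm ξ).trans_lt h).trans_le (le_max_left _ _),
    ((Complex.abs_im_le_norm ξ).trans_lt h).trans_le (le_max_left _ _)⟩

/-- The coordinate inverse to `squareMap`. -/
def unitCoord (R t : ℝ) : ℝ := (t + R) / (2 * R)

lemma unitCoord_nonneg {R t : ℝ} (ht : |t| < R) : 0 ≤ unitCoord R t := by
  have := abs_lt.mp ht
  have hR : 0 < R := (abs_nonneg t).trans_lt ht
  exact div_nonneg (by linarith) (by positivity)

lemma unitCoord_lt_one {R t : ℝ} (ht : |t| < R) : unitCoord R t < 1 := by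
  have := abs_lt.mp ht
  have hR : 0 < R := (abs_nonneg t).trans_lt ht
  rw [unitCoord, div_lt_one (by positivity)]
  linarith

lemma abs_unitCoord_sub {R : ℝ} (hR : 0 < R) (s t : ℝ) :
    |unitCoord R s - unitCoord R t| = |s - t| / (2 * R) := by
  rw [unitCoord, unitCoord, ← sub_div, add_sub_add_right_eq_sub, abs_div,
    abs_of_pos (by positivity : 0 < 2 * R)]

lemma squareMap_unitCoord {R : ℝ} (hR : 0 < R) (ξ : ℂ) :
    squareMap R (unitCoord R ξ.re) (unitCoord R ξ.im) = ξ := by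
  apply Complex.ext <;> simp only [squareMap, unitCoord] <;> field_simp <;> ring

/-- The field obtained from `f` on dyadic points of the square of half side `R` by continuity. -/
def dyadicVersion (R : ℝ) (f : ℂ → ℝ) (ξ : ℂ) : ℝ :=
  dyadicLim (fun x y => f (squareMap R x y)) (unitCoord R ξ.re) (unitCoord R ξ.im)

/-- The constant in the chaining estimate. -/
def chainConst (β R : ℝ) : ℝ := (4 / (1 - (1 / 2) ^ β) + 2) * (1 / R) ^ β

lemma chainConst_nonneg {β R : ℝ} (hβ : 0 < β) (hR : 0 < R) : 0 ≤ chainConst β R := by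
  have hr1 : (1 / 2 : ℝ) ^ β < 1 := Real.rpow_lt_one (by norm_num) (by norm_num) hβ
  have : 0 < 1 - (1 / 2 : ℝ) ^ β := by linarith
  unfold chainConst
  positivity

lemma abs_dyadicVersion_sub_le {R β A : ℝ} (hβ : 0 < β) (hR : 0 < R) (hA : 0 ≤ A) {f : ℂ → ℝ}
    (hb : DyadicBound (fun x y => f (squareMap R x y)) A ((1 / 2) ^ β)) {ξ η : ℂ}
    (hξ : ξ ∈ openSquare R) (hη : η ∈ openSquare R) :
    |dyadicVersion R f ξ - dyadicVersion R f η| ≤ chainConst β R * A * ‖ξ - η‖ ^ β := by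
  rcases eq_or_ne ξ η with rfl | hne
  · simp [Real.zero_rpow hβ.ne']
  have hd : 0 < ‖ξ - η‖ := norm_pos_iff.mpr (sub_ne_zero.mpr hne)
  refine (hb.abs_dyadicLim_sub_le_rpow hβ hA (unitCoord_nonneg hξ.1) (unitCoord_lt_one hξ.1)
    (unitCoord_nonneg hξ.2) (unitCoord_lt_one hξ.2) (unitCoord_nonneg hη.1)
    (unitCoord_lt_one hη.1) (unitCoord_nonneg hη.2) (unitCoord_lt_one hη.2)
    (d := ‖ξ - η‖ / (2 * R)) (by positivity) ?_ ?_).trans_eq ?_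
  · rw [abs_unitCoord_sub hR]
    gcongr
    exact Complex.abs_re_le_norm (ξ - η)
  · rw [abs_unitCoord_sub hR]
    gcongr
    exact Complex.abs_im_le_norm (ξ - η)
  · have e : 2 * (‖ξ - η‖ / (2 * R)) = 1 / R * ‖ξ - η‖ := by field_simp
    rw [e, Real.mul_rpow (by positivity) (by positivity), chainConst]
    ring

lemma dyadicVersion_eq_of_tendsto {R : ℝ} (hR : 0 < R) {f : ℂ → ℝ} {ξ : ℂ}
    (h : Tendsto (fun m => f (squareMap R (dyadicFloor m (unitCoord R ξ.re))
      (dyadicFloor m (unitCoord R ξ.im)))) atTop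
      (𝓝 (f (squareMap R (unitCoord R ξ.re) (unitCoord R ξ.im))))) : dyadicVersion R f ξ = f ξ := by
  rw [squareMap_unitCoord hR] at h
  exact h.limUnder_eq

lemma dyadicVersion_eq_of_continuous {R : ℝ} (hR : 0 < R) {f : ℂ → ℝ} (hf : Continuous f) {ξ : ℂ}
    (hξ : ξ ∈ openSquare R) : dyadicVersion R f ξ = f ξ := by
  apply dyadicVersion_eq_of_tendsto hR
  have hc : Continuous fun q : ℝ × ℝ => f (squareMap R q.1 q.2) := by
    have e : ∀ q : ℝ × ℝ, squareMap R q.1 q.2 =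
        ((-R + 2 * R * q.1 : ℝ) : ℂ) + ((-R + 2 * R * q.2 : ℝ) : ℂ) * Complex.I := fun q =>
      Complex.mk_eq_add_mul_I _ _
    simp only [e]
    fun_prop
  exact (hc.tendsto (unitCoord R ξ.re, unitCoord R ξ.im)).comp
    ((tendsto_dyadicFloor (unitCoord_nonneg hξ.1)).prodMk_nhds
      (tendsto_dyadicFloor (unitCoord_nonneg hξ.2)))

/-- With r = 2^{-β} the ratio is 4 · 2^{(2β-1)p}, which falls below 1 for large p exactly because β
< 1/2. -/
lemma exists_chaining_exponent {β : ℝ} (hβ : β < 1 / 2) :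
    ∃ p : ℕ, p ≠ 0 ∧ 4 * ((((1 / 2 : ℝ) ^ β)⁻¹) ^ (2 * p) * (1 / 2) ^ p) < 1 := by
  set b : ℝ := (((1 / 2 : ℝ) ^ β)⁻¹) ^ 2 * (1 / 2) with hb
  have hb0 : 0 ≤ b := by positivity
  have hb1 : b < 1 := by
    have : b = (1 / 2 : ℝ) ^ (1 - 2 * β) := by
      rw [hb, ← Real.rpow_neg (by norm_num), ← Real.rpow_natCast, ← Real.rpow_mul (by norm_num)]
      nth_rewrite 2 [← Real.rpow_one (1 / 2 : ℝ)]
      rw [← Real.rpow_add (by norm_num)]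
      congr 1; push_cast; ring
    rw [this]
    exact Real.rpow_lt_one (by norm_num) (by norm_num) (by linarith)
  obtain ⟨p, hp⟩ := exists_pow_lt_of_lt_one (show (0 : ℝ) < 1 / 4 by norm_num) hb1
  have e : (((1 / 2 : ℝ) ^ β)⁻¹) ^ (2 * p) * (1 / 2) ^ p = b ^ p := by
    rw [hb, mul_pow, ← pow_mul]
  refine ⟨p, ?_, by rw [e]; linarith⟩
  rintro rfl
  norm_num at hp

lemma holderWith_of_le {K : TopologicalSpace.Compacts ℂ} {α : ℝ≥0} {g : K → ℝ} {C : ℝ}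
    (hC : 0 ≤ C) (h : ∀ x y, |g x - g y| ≤ C * dist x y ^ (α : ℝ)) :
    HolderWith C.toNNReal α g := by
  intro x y
  have h1 := h x y
  rw [← Real.dist_eq] at h1
  rw [edist_nndist, edist_nndist, ← ENNReal.coe_rpow_of_nonneg _ α.coe_nonneg, ← ENNReal.coe_mul,
    ENNReal.coe_le_coe, ← NNReal.coe_le_coe]
  push_cast
  rw [Real.coe_toNNReal C hC]
  exact h1

variable {Ω : Type*} [MeasurableSpace Ω] {P : Measure Ω} {X : ℂ → Ω → ℝ}

lemma exists_memHolder_version (hX : ∀ ξ, AEMeasurable (X ξ) P)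
    (hm : ∀ p : ℕ, p ≠ 0 → ∃ C : ℝ, 0 ≤ C ∧ ∀ ξ η,
      ∫⁻ ω, ENNReal.ofReal (|X ξ ω - X η ω| ^ (2 * p)) ∂P ≤ ENNReal.ofReal (C * ‖ξ - η‖ ^ p))
    (K : TopologicalSpace.Compacts ℂ) {α : ℝ≥0} (hα0 : 0 < α) (hα : (α : ℝ) < 1 / 2) :
    ∃ Y : ℂ → Ω → ℝ, (∀ ξ, Y ξ =ᵐ[P] X ξ) ∧ ∀ ω, MemHolder α (fun x : K => Y x ω) := by
  classical
  obtain ⟨R, hR, hK⟩ := exists_subset_openSquare K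
  obtain ⟨p, hp, hpα⟩ := exists_chaining_exponent hα
  obtain ⟨C, hC, hmC⟩ := hm p hp
  have hα0' : (0 : ℝ) < α := hα0
  set r : ℝ := (1 / 2 : ℝ) ^ (α : ℝ) with hr
  have hr0 : 0 < r := by positivity
  have hfin : ∀ᵐ ω ∂P, dyadicVariation (2 * p) r (squarePath X R ω) < ⊤ :=
    ae_lt_top' (aemeasurable_dyadicVariation hX R _ _) (ne_top_of_le_ne_top ENNReal.ofReal_ne_top
      (lintegral_dyadicVariation_le hX hC hmC hR.le hr0 hpα))
  -- Inside the square the field is rebuilt from its dyadic values, and set to 0 on the null event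
  -- of infinite variation, so that every path on K is Hölder; outside it is unchanged.
  set Y : ℂ → Ω → ℝ := fun ξ ω => if ξ ∈ openSquare R then
    (if dyadicVariation (2 * p) r (squarePath X R ω) < ⊤ then dyadicVersion R (fun ξ => X ξ ω) ξ
      else 0) else X ξ ω with hY
  refine ⟨Y, fun ξ => ?_, fun ω => ?_⟩
  · by_cases hξ : ξ ∈ openSquare R
    · filter_upwards [hfin, ae_tendsto_dyadicFloor hX hC hp hmC hR.le (unitCoord_nonneg hξ.1)
        (unitCoord_nonneg hξ.2)] with ω h1 h2
      simp only [hY, if_pos hξ, if_pos h1]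
      exact dyadicVersion_eq_of_tendsto hR h2
    · exact ae_of_all _ fun ω => by simp only [hY, if_neg hξ]
  · by_cases hω : dyadicVariation (2 * p) r (squarePath X R ω) < ⊤
    · set A : ℝ := ((dyadicVariation (2 * p) r (squarePath X R ω)).toReal) ^ (((2 * p : ℕ) : ℝ)⁻¹)
      have hA : 0 ≤ A := by positivity
      have hb : DyadicBound (squarePath X R ω) A r := by
        refine dyadicBound_of_dyadicVariation_le (q := 2 * p) (by positivity) hr0 hA ?_
        rw [Real.rpow_inv_natCast_pow ENNReal.toReal_nonneg (by positivity),
          ENNReal.ofReal_toReal hω.ne]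
      refine (holderWith_of_le (C := chainConst α R * A)
        (mul_nonneg (chainConst_nonneg hα0' hR) hA) fun ξ η => ?_).memHolder
      simp only [hY, if_pos (hK ξ.2), if_pos (hK η.2), if_pos hω, Subtype.dist_eq, dist_eq_norm]
      exact abs_dyadicVersion_sub_le hα0' hR hA hb (hK ξ.2) (hK η.2)
    · refine (holderWith_of_le (C := 0) le_rfl fun ξ η => ?_).memHolder
      simp [hY, if_pos (hK ξ.2), if_pos (hK η.2), if_neg hω]

/-- The functions on `K` that are bounded by `T` and `β`-Hölder with constant `T`. -/
def holderBall (K : TopologicalSpace.Compacts ℂ) (β T : ℝ) : Set C(K, ℝ) :=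
  {f | (∀ x, |f x| ≤ T) ∧ ∀ x y : K, |f x - f y| ≤ T * dist x y ^ β}

lemma ENNReal_markov_pow {Y : Ω → ENNReal} (hY : AEMeasurable Y P) {q : ℕ} {T : ℝ} (hT : 0 < T)
    {D : ENNReal} (h : ∫⁻ ω, Y ω ∂P ≤ D) :
    P {ω | ENNReal.ofReal (T ^ q) ≤ Y ω} ≤ D / ENNReal.ofReal (T ^ q) := by
  refine (meas_ge_le_lintegral_div hY ?_ ENNReal.ofReal_ne_top).trans (by gcongr)
  rw [ENNReal.ofReal_ne_zero_iff]
  positivity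

/-- Uniform tightness: moment bounds put most of the mass of a continuous random field in a
Hölder ball, with constants depending only on the moment bounds. -/
lemma exists_holderBall_compl_le (K : TopologicalSpace.Compacts ℂ) {β : ℝ} (hβ0 : 0 < β)
    (hβ : β < 1 / 2) (C : ℕ → ℝ) (hC : ∀ p, 0 ≤ C p) {ε : ENNReal} (hε : 0 < ε) :
    ∃ T : ℝ, ∀ (X : ℂ → Ω → ℝ), (∀ ξ, AEMeasurable (X ξ) P) →
      (∀ᵐ ω ∂P, Continuous fun ξ => X ξ ω) →
      (∀ p ≠ 0, ∀ ξ η, ∫⁻ ω, ENNReal.ofReal (|X ξ ω - X η ω| ^ (2 * p)) ∂P ≤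
        ENNReal.ofReal (C p * ‖ξ - η‖ ^ p)) →
      (∀ p, ∀ ξ, ∫⁻ ω, ENNReal.ofReal (|X ξ ω| ^ (2 * p)) ∂P ≤ ENNReal.ofReal (C p)) →
      P {ω | continuousPath K (fun ξ => X ξ ω) ∉ holderBall K β T} ≤ ε := by
  obtain ⟨R, hR, hK⟩ := exists_subset_openSquare K
  obtain ⟨p, hp, hpβ⟩ := exists_chaining_exponent hβ
  set r : ℝ := (1 / 2 : ℝ) ^ β with hr
  have hr0 : 0 < r := by positivity
  -- D bounds the expectation of |X_0|^{2p} plus the dyadic variation; Markov's inequality at n^{2p}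
  -- then bounds the exceptional probability by D/n^{2p}.
  set D : ℝ := C p + 8 * C p * (2 * R) ^ p * (1 - 4 * (r⁻¹ ^ (2 * p) * (1 / 2) ^ p))⁻¹ with hD
  have hlim : Tendsto (fun n : ℕ => ENNReal.ofReal (D / ((n : ℝ) ^ (2 * p)))) atTop (𝓝 0) := by
    rw [← ENNReal.ofReal_zero]
    refine (ENNReal.continuous_ofReal.tendsto 0).comp (tendsto_const_nhds.div_atTop ?_)
    exact (tendsto_pow_atTop (by positivity)).comp tendsto_natCast_atTop_atTop
  obtain ⟨n, hn1, hn⟩ := ((eventually_ge_atTop 1).and (hlim.eventually_le_const hε)).exists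
  have hn0 : (0 : ℝ) < n := by exact_mod_cast hn1
  set c := chainConst β R with hc
  have hc0 : 0 ≤ c := chainConst_nonneg hβ0 hR
  have hdiam : ∀ ξ ∈ K, ‖ξ‖ ≤ 2 * R := by
    intro ξ hξ
    have := Complex.norm_le_abs_re_add_abs_im ξ
    linarith [(hK hξ).1, (hK hξ).2]
  -- On the good event n bounds |X_0| and the dyadic constant, c n is the Hölder constant, and c n
  -- (2R)^β bounds the oscillation between 0 and a point of K.
  refine ⟨n + c * n * (2 * R) ^ β + c * n, fun X hX hcont hm1 hm0 => ?_⟩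
  set Y : Ω → ENNReal := fun ω => ENNReal.ofReal (|X 0 ω| ^ (2 * p)) +
    dyadicVariation (2 * p) r (squarePath X R ω) with hY
  have hYm : AEMeasurable Y P := by
    have := aemeasurable_dyadicVariation hX R (2 * p) r
    have := hX 0
    fun_prop
  have hYint : ∫⁻ ω, Y ω ∂P ≤ ENNReal.ofReal D := by
    have h0 : 0 < 1 - 4 * (r⁻¹ ^ (2 * p) * (1 / 2) ^ p) := by linarith
    have h1 := hX 0
    have h2 := hC p
    rw [hY, lintegral_add_left' (by fun_prop), hD, ENNReal.ofReal_add h2 (by positivity)]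
    exact add_le_add (hm0 p 0) (lintegral_dyadicVariation_le hX h2 (hm1 p hp) hR.le hr0 hpβ)
  have hmarkov := ENNReal_markov_pow hYm hn0 hYint (q := 2 * p)
  rw [← ENNReal.ofReal_div_of_pos (by positivity)] at hmarkov
  refine (measure_mono_ae ?_).trans (hmarkov.trans hn)
  filter_upwards [hcont] with ω hω hbad
  by_contra hlt
  apply hbad
  have hlt' : Y ω ≤ ENNReal.ofReal ((n : ℝ) ^ (2 * p)) := (not_le.mp hlt).le
  have hb : DyadicBound (squarePath X R ω) n r :=
    dyadicBound_of_dyadicVariation_le (q := 2 * p) (by positivity) hr0 hn0.le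
      (le_add_self.trans hlt')
  have h0 : |X 0 ω| ≤ n := by
    have := (le_self_add.trans hlt' : ENNReal.ofReal (|X 0 ω| ^ (2 * p)) ≤ _)
    rw [ENNReal.ofReal_le_ofReal_iff (by positivity)] at this
    exact (pow_le_pow_iff_left₀ (abs_nonneg _) hn0.le (by positivity)).mp this
  have hinc : ∀ ξ ∈ openSquare R, ∀ η ∈ openSquare R,
      |X ξ ω - X η ω| ≤ c * n * ‖ξ - η‖ ^ β := by
    intro ξ hξ η hη
    have := abs_dyadicVersion_sub_le (f := fun ξ => X ξ ω) hβ0 hR hn0.le hb hξ hη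
    rwa [dyadicVersion_eq_of_continuous hR hω hξ, dyadicVersion_eq_of_continuous hR hω hη] at this
  -- The origin need not lie in K; the increment bound holds on the whole square.
  have hz : (0 : ℂ) ∈ openSquare R := by simp [openSquare, hR]
  have hpath : ∀ x : K, continuousPath K (fun ξ => X ξ ω) x = X x ω := by
    intro x
    have h : Continuous fun x : K => X x ω := hω.comp continuous_subtype_val
    rw [continuousPath, dif_pos h]
    rfl
  have hcn : 0 ≤ c * n := by positivity
  refine ⟨fun x => ?_, fun x y => ?_⟩
  · rw [hpath]
    have h1 := hinc x (hK x.2) 0 hz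
    have h2 : ‖(x : ℂ) - 0‖ ^ β ≤ (2 * R) ^ β := by
      rw [sub_zero]
      exact Real.rpow_le_rpow (norm_nonneg _) (hdiam x x.2) hβ0.le
    have h3 := mul_le_mul_of_nonneg_left h2 hcn
    have h4 := abs_sub_abs_le_abs_sub (X x ω) (X 0 ω)
    linarith
  · rw [hpath, hpath, Subtype.dist_eq, dist_eq_norm]
    refine (hinc x (hK x.2) y (hK y.2)).trans ?_
    refine mul_le_mul_of_nonneg_right ?_ (by positivity)
    have : 0 ≤ c * n * (2 * R) ^ β := by positivity
    linarith

end Versions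

end

section

open scoped Topology

/-! ### The path spaces -/

section PathSpaces

variable {K : TopologicalSpace.Compacts ℂ}

lemma holderBall_mono {β S T : ℝ} (h : S ≤ T) : holderBall K β S ⊆ holderBall K β T :=
  fun _ hf => ⟨fun x => (hf.1 x).trans h, fun x y =>
    (hf.2 x y).trans (mul_le_mul_of_nonneg_right h (by positivity))⟩

/-- Arzelà–Ascoli: the common modulus T t^β gives equicontinuity, and the defining inequalities are
closed in a product of compact intervals. -/
lemma isCompact_holderBall {β : ℝ} (hβ : 0 < β) (T : ℝ) : IsCompact (holderBall K β T) := by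
  have htend : Tendsto (fun t : ℝ => T * t ^ β) (𝓝 0) (𝓝 0) := by
    have h : Continuous fun t : ℝ => T * t ^ β :=
      continuous_const.mul (Real.continuous_rpow_const hβ.le)
    have := h.tendsto 0
    rwa [Real.zero_rpow hβ.ne', mul_zero] at this
  refine ArzelaAscoli.isCompact_of_equicontinuous _ ?_ ?_
  · have e : ContinuousMap.toFun '' holderBall K β T =
        (Set.univ.pi fun _ : K => Set.Icc (-T) T) ∩
          {f | ∀ x y : K, |f x - f y| ≤ T * dist x y ^ β} := by
      ext f
      constructor
      · rintro ⟨g, hg, rfl⟩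
        exact ⟨fun x _ => abs_le.mp (hg.1 x), hg.2⟩
      · rintro ⟨h1, h2⟩
        refine ⟨⟨f, ?_⟩, ⟨fun x => abs_le.mpr (h1 x trivial), h2⟩, rfl⟩
        rw [continuous_iff_continuousAt]
        intro x
        refine tendsto_iff_dist_tendsto_zero.mpr ?_
        refine squeeze_zero (fun _ => dist_nonneg) (fun y => h2 y x) ?_
        exact htend.comp (tendsto_iff_dist_tendsto_zero.mp tendsto_id)
    rw [e]
    refine (isCompact_univ_pi fun _ => isCompact_Icc).inter_right ?_
    simp only [Set.ofPred_forall]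
    exact isClosed_iInter fun x => isClosed_iInter fun y =>
      isClosed_le (by fun_prop) continuous_const
  · refine Metric.equicontinuous_of_continuity_modulus (fun t => T * t ^ β) htend _ ?_
    intro x y f
    exact f.2.2 x y

open Classical in
/-- The element of the Hölder space given by `f`, and `0` if `f` is not Hölder continuous. -/
def toHolderSpace (α : ℝ≥0) (f : C(K, ℝ)) : HolderSpace K α :=
  if h : MemHolder α f then ⟨f, h⟩ else 0

lemma toHolderSpace_of_memHolder {α : ℝ≥0} {f : C(K, ℝ)} (h : MemHolder α f) :
    toHolderSpace α f = ⟨f, h⟩ := dif_pos h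

lemma toHolderSpace_of_not_memHolder {α : ℝ≥0} {f : C(K, ℝ)} (h : ¬ MemHolder α f) :
    toHolderSpace α f = 0 := dif_neg h

lemma holderPath_eq (α : ℝ≥0) (g : ℂ → ℝ) :
    holderPath K α g = toHolderSpace α (continuousPath K g) := by
  by_cases h1 : Continuous fun x : K => g x
  · have e : continuousPath K g = ⟨fun x : K => g x, h1⟩ := dif_pos h1
    rw [e]
    by_cases h2 : MemHolder α fun x : K => g x
    · exact (dif_pos ⟨h1, h2⟩).trans (toHolderSpace_of_memHolder h2).symm
    · exact (dif_neg fun h => h2 h.2).trans (toHolderSpace_of_not_memHolder h2).symm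
  · have e : continuousPath K g = 0 := dif_neg h1
    rw [e]
    exact (dif_neg fun h => h1 h.1).trans (toHolderSpace_of_memHolder memHolder_zero).symm

lemma nonneg_of_mem_holderBall {β T : ℝ} {f : C(K, ℝ)} (hf : f ∈ holderBall K β T) (x : K) :
    0 ≤ T :=
  (abs_nonneg _).trans (hf.1 x)

/-- An increment of f - g is bounded both by 2‖f - g‖ and by 2T d^β. Taking the geometric mean with
weights 1 - α/β and α/β produces d^α with a constant that vanishes with ‖f - g‖. -/
lemma interpolation_bound {α β T : ℝ} (hα : 0 < α) (hαβ : α < β) {f g : C(K, ℝ)}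
    (hf : f ∈ holderBall K β T) (hg : g ∈ holderBall K β T) (x y : K) :
    |(f - g) x - (f - g) y| ≤
      ((2 * ‖f - g‖) ^ (1 - α / β) * (2 * T) ^ (α / β)) * dist x y ^ α := by
  have hT := nonneg_of_mem_holderBall hf x
  have hβ : 0 < β := hα.trans hαβ
  have hθ0 : 0 ≤ α / β := by positivity
  have hθ1 : 0 ≤ 1 - α / β := by rw [sub_nonneg, div_le_one hβ]; exact hαβ.le
  set u := |(f - g) x - (f - g) y| with hu
  have hu0 : 0 ≤ u := abs_nonneg _
  have h1 : u ≤ 2 * ‖f - g‖ := by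
    have := abs_sub ((f - g) x) ((f - g) y)
    have h2 := (f - g).norm_coe_le_norm x
    have h3 := (f - g).norm_coe_le_norm y
    rw [Real.norm_eq_abs] at h2 h3
    linarith
  have h2 : u ≤ 2 * T * dist x y ^ β := by
    have h3 := hf.2 x y
    have h4 := hg.2 x y
    have h5 : (f - g) x - (f - g) y = (f x - f y) - (g x - g y) := by
      simp only [ContinuousMap.sub_apply]; ring
    rw [hu, h5]
    have := abs_sub (f x - f y) (g x - g y)
    linarith
  calc u = u ^ (1 - α / β) * u ^ (α / β) := by
        rcases hu0.eq_or_lt with h | h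
        · rw [← h, Real.zero_rpow (by positivity : α / β ≠ 0), mul_zero]
        · rw [← Real.rpow_add h, sub_add_cancel, Real.rpow_one]
    _ ≤ (2 * ‖f - g‖) ^ (1 - α / β) * (2 * T * dist x y ^ β) ^ (α / β) := by gcongr
    _ = _ := by
        rw [Real.mul_rpow (x := 2 * T) (by positivity) (by positivity), ← Real.rpow_mul dist_nonneg,
          mul_div_cancel₀ _ hβ.ne']
        ring

lemma memHolder_of_mem_holderBall {α : ℝ≥0} {β T : ℝ} (hα : 0 < α) (hαβ : (α : ℝ) < β)
    {f : C(K, ℝ)} (hf : f ∈ holderBall K β T) : MemHolder α f := by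
  rcases isEmpty_or_nonempty K with hK | ⟨⟨x⟩⟩
  · exact ⟨0, fun x => hK.elim x⟩
  have hT := nonneg_of_mem_holderBall hf x
  have h0 : (0 : C(K, ℝ)) ∈ holderBall K β T := ⟨fun x => by simpa using hT, fun x y => by
    simp only [ContinuousMap.zero_apply, sub_self, abs_zero]; positivity⟩
  have h := interpolation_bound (by exact_mod_cast hα) hαβ hf h0
  simp only [sub_zero] at h
  exact (holderWith_of_le (by positivity) h).memHolder

lemma norm_holderSpace_eq {α : ℝ≥0} (f : HolderSpace K α) :
    ‖f‖ = ‖f.toContinuousMap‖ + (nnHolderNorm α f.toContinuousMap : ℝ) := rfl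

/-- On a β-Hölder ball uniform convergence implies convergence in the α-Hölder norm, by
interpolation. Compactness and Borel measurability thereby pass from C(K) to C^{0,α}(K). -/
lemma continuousOn_toHolderSpace {α : ℝ≥0} {β T : ℝ} (hα : 0 < α) (hαβ : (α : ℝ) < β) :
    ContinuousOn (toHolderSpace α) (holderBall K β T) := by
  intro f hf
  have hα' : (0 : ℝ) < α := by exact_mod_cast hα
  have hβ : 0 < β := hα'.trans hαβ
  have hθ1 : 0 < 1 - α / β := by rw [sub_pos, div_lt_one hβ]; exact hαβ
  rw [ContinuousWithinAt, tendsto_iff_norm_sub_tendsto_zero]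
  have hlim : Tendsto (fun g : C(K, ℝ) => ‖g - f‖ +
      (2 * ‖g - f‖) ^ (1 - α / β) * (2 * T) ^ (α / β)) (𝓝[holderBall K β T] f) (𝓝 0) := by
    have hc : Continuous fun g : C(K, ℝ) => ‖g - f‖ +
        (2 * ‖g - f‖) ^ (1 - α / β) * (2 * T) ^ (α / β) := by
      refine Continuous.add (by fun_prop) (Continuous.mul ?_ continuous_const)
      exact (Real.continuous_rpow_const hθ1.le).comp (by fun_prop)
    have := hc.tendsto f
    rw [sub_self, norm_zero, mul_zero, Real.zero_rpow hθ1.ne', zero_mul, add_zero] at this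
    exact this.mono_left nhdsWithin_le_nhds
  refine squeeze_zero' (Eventually.of_forall fun _ => norm_nonneg _) ?_ hlim
  filter_upwards [self_mem_nhdsWithin] with g hg
  have mf := memHolder_of_mem_holderBall hα hαβ hf
  have mg := memHolder_of_mem_holderBall hα hαβ hg
  have e : (toHolderSpace α g - toHolderSpace α f).toContinuousMap = g - f := by
    rw [toHolderSpace_of_memHolder mf, toHolderSpace_of_memHolder mg]
    rfl
  rw [norm_holderSpace_eq, e]
  refine add_le_add le_rfl ?_
  rcases isEmpty_or_nonempty K with hK | ⟨⟨x⟩⟩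
  · have : (nnHolderNorm α (g - f : C(K, ℝ)) : ℝ) = 0 := by
      simp [nnHolderNorm, eHolderNorm_of_isEmpty]
    rw [this]
    have hs : g - f = 0 := Subsingleton.elim _ _
    rw [hs, norm_zero, mul_zero, Real.zero_rpow hθ1.ne', zero_mul]
  have hT := nonneg_of_mem_holderBall hf x
  have hC : 0 ≤ (2 * ‖g - f‖) ^ (1 - α / β) * (2 * T) ^ (α / β) := by positivity
  have := HolderWith.nnholderNorm_le (holderWith_of_le hC (interpolation_bound hα' hαβ hg hf))
  rw [← NNReal.coe_le_coe, Real.coe_toNNReal _ hC] at this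
  exact this

open Classical in
/-- The restriction of `toHolderSpace` to functions in some Hölder ball of larger exponent, which
is Borel measurable. -/
lemma exists_measurable_eqOn_toHolderSpace {α : ℝ≥0} {β : ℝ} (hα : 0 < α) (hαβ : (α : ℝ) < β) :
    ∃ Φ : C(K, ℝ) → HolderSpace K α, Measurable Φ ∧
      ∀ n : ℕ, ∀ f ∈ holderBall K β n, Φ f = toHolderSpace α f := by
  have hβ : 0 < β := lt_of_le_of_lt α.coe_nonneg hαβ
  have hclosed : ∀ n : ℕ, IsClosed (holderBall K β n) := fun n => (isCompact_holderBall hβ n).isClosed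
  refine ⟨fun f => if ∃ n : ℕ, f ∈ holderBall K β n then toHolderSpace α f else 0, ?_,
    fun n f hf => if_pos ⟨n, hf⟩⟩
  -- Cutting off outside the nth ball gives a Borel map, since the inclusion is continuous on a
  -- closed set; the cutoffs converge pointwise, being eventually constant.
  refine measurable_of_tendsto_metrizable (f := fun n : ℕ =>
    (holderBall K β n).piecewise (toHolderSpace α) (fun _ => 0)) (fun n => ?_) ?_
  · exact (continuousOn_toHolderSpace hα hαβ).measurable_piecewise continuousOn_const
      (hclosed n).measurableSet
  · rw [tendsto_pi_nhds]
    intro f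
    by_cases hf : ∃ n : ℕ, f ∈ holderBall K β n
    · rw [if_pos hf]
      obtain ⟨n, hn⟩ := hf
      refine tendsto_const_nhds.congr' ?_
      filter_upwards [eventually_ge_atTop n] with m hm
      rw [Set.piecewise_eq_of_mem]
      exact holderBall_mono (by exact_mod_cast hm) hn
    · rw [if_neg hf]
      refine tendsto_const_nhds.congr fun m => ?_
      rw [Set.piecewise_eq_of_notMem]
      exact fun h => hf ⟨m, h⟩

variable {Ω : Type*} [MeasurableSpace Ω] {P : Measure Ω}

/-- Evaluation on a countable dense set is a continuous injection of the Polish space C(K), hence a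
measurable embedding. -/
lemma aemeasurable_continuousMap_of_eval {F : Ω → C(K, ℝ)}
    (h : ∀ x : K, AEMeasurable (fun ω => F ω x) P) : AEMeasurable F P := by
  obtain ⟨D, hDc, hD⟩ := TopologicalSpace.exists_countable_dense K
  have := hDc.to_subtype
  let E : C(K, ℝ) → D → ℝ := fun f d => f d
  have hE : Continuous E := continuous_pi fun d => continuous_eval_const _
  have hinj : Function.Injective E := by
    intro f g hfg
    refine ContinuousMap.ext fun x => ?_
    have : Set.EqOn f g D := fun d hd => congrFun hfg ⟨d, hd⟩
    exact congrFun (Continuous.ext_on hD f.continuous g.continuous this) x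
  rw [← (hE.measurableEmbedding hinj).aemeasurable_comp_iff]
  exact aemeasurable_pi_lambda _ fun d => h d

lemma aemeasurable_continuousPath {X : ℂ → Ω → ℝ} (hX : ∀ ξ, AEMeasurable (X ξ) P)
    (hc : ∀ᵐ ω ∂P, Continuous fun ξ => X ξ ω) :
    AEMeasurable (fun ω => continuousPath K fun ξ => X ξ ω) P := by
  refine aemeasurable_continuousMap_of_eval fun x => (hX x).congr ?_
  filter_upwards [hc] with ω hω
  have h : Continuous fun x : K => X x ω := hω.comp continuous_subtype_val
  rw [continuousPath, dif_pos h]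
  rfl

/-- Weak convergence in `C(K)` from tightness and convergence of the characteristic functions of
the finite-dimensional distributions. -/
lemma tendsto_of_tight_of_tendsto_eval {μ : ℕ → ProbabilityMeasure C(K, ℝ)}
    (ht : IsTightMeasureSet {(μ n : Measure C(K, ℝ)) | n}) {ν : ProbabilityMeasure C(K, ℝ)}
    (h : ∀ w : K →₀ ℝ, Tendsto (fun n => ∫ f, Complex.exp (Complex.I *
      (w.sum fun x c => c * f x : ℝ)) ∂(μ n : Measure C(K, ℝ))) atTop
      (𝓝 (∫ f, Complex.exp (Complex.I * (w.sum fun x c => c * f x : ℝ))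
        ∂(ν : Measure C(K, ℝ))))) :
    Tendsto μ atTop (𝓝 ν) := by
  -- The discrete topology on finitely supported weights reduces joint continuity of the pairing to
  -- continuity in f. The trigonometric polynomials of this pairing form a separating algebra,
  -- enough for tight sequences.
  let : TopologicalSpace (K →₀ ℝ) := ⊥
  have : DiscreteTopology (K →₀ ℝ) := ⟨rfl⟩
  let L : C(K, ℝ) →ₗ[ℝ] (K →₀ ℝ) →ₗ[ℝ] ℝ := LinearMap.mk₂ ℝ
    (fun f w => w.sum fun x c => c * f x)
    (fun f g w => by simp [mul_add, Finsupp.sum_add])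
    (fun c f w => by simp [Finsupp.sum, Finset.mul_sum, mul_left_comm])
    (fun f v w => Finsupp.sum_add_index' (by simp) (by intros; ring))
    (fun c f w => by
      rw [Finsupp.sum_smul_index (by simp)]
      simp [Finsupp.sum, Finset.mul_sum, mul_assoc])
  have hL : Continuous fun p : C(K, ℝ) × (K →₀ ℝ) => L p.1 p.2 := by
    rw [continuous_prod_of_discrete_right]
    intro w
    change Continuous fun f : C(K, ℝ) => ∑ x ∈ w.support, w x * f x
    exact continuous_finsetSum _ fun x _ => continuous_const.mul (continuous_eval_const x)
  have hL0 : ∀ f : C(K, ℝ), f ≠ 0 → L f ≠ 0 := by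
    intro f hf hLf
    refine hf (ContinuousMap.ext fun x => ?_)
    have : L f (Finsupp.single x 1) = 0 := by rw [hLf]; rfl
    simpa [L] using this
  refine ProbabilityMeasure.tendsto_of_tight_of_separatesPoints ht (𝕜 := ℂ)
    (A := BoundedContinuousFunction.charPoly Real.continuous_probChar (L := L) hL)
    (BoundedContinuousFunction.separatesPoints_charPoly _ Real.probChar_ne_one _ hL0) ?_
  intro g hg
  rw [BoundedContinuousFunction.mem_charPoly] at hg
  obtain ⟨w, hw⟩ := hg
  have hint : ∀ (ρ : ProbabilityMeasure C(K, ℝ)) (v : K →₀ ℝ), Integrable (fun f : C(K, ℝ) =>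
      Complex.exp (Complex.I * (v.sum fun x c => c * f x : ℝ))) (ρ : Measure C(K, ℝ)) := by
    intro ρ v
    have hc : Continuous fun f : C(K, ℝ) => L f v :=
      hL.comp (continuous_id.prodMk continuous_const)
    refine Integrable.of_bound (C := 1) (Continuous.aestronglyMeasurable ?_) (ae_of_all _ fun f => ?_)
    · change Continuous fun f : C(K, ℝ) => Complex.exp (Complex.I * (L f v : ℝ))
      fun_prop
    · rw [Complex.norm_exp]; simp
  have h_eq : ∀ ρ : ProbabilityMeasure C(K, ℝ), ∫ f, g f ∂(ρ : Measure C(K, ℝ)) =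
      w.coeff.sum fun v z => z * ∫ f, Complex.exp (Complex.I * (v.sum fun x c => c * f x : ℝ))
        ∂(ρ : Measure C(K, ℝ)) := by
    intro ρ
    simp_rw [hw, Finsupp.sum]
    rw [integral_finsetSum]
    · refine Finset.sum_congr rfl fun v _ => ?_
      rw [integral_const_mul]
      congr 2
      funext f
      rw [Real.probChar_apply, mul_comm Complex.I]
      rfl
    · intro v _
      refine Integrable.const_mul ?_ _
      refine (hint ρ v).congr (ae_of_all _ fun f => ?_)
      simp only [Real.probChar_apply, mul_comm Complex.I]
      rfl
  simp_rw [h_eq]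
  exact tendsto_finsetSum _ fun v _ => (h v).const_mul _

end PathSpaces

end

section

open scoped Topology InnerProductSpace

/-! ### The overlap area of two unit disks -/

section Lens

lemma overlapKernel_of_two_le {r : ℝ} (hr : 2 ≤ r) : overlapKernel r = 0 := by
  have h : Disjoint (Metric.ball (0 : ℂ) 1) (Metric.ball (r : ℂ) 1) := by
    refine Metric.ball_disjoint_ball ?_
    rw [dist_zero_left, Complex.norm_real, Real.norm_eq_abs]
    linarith [le_abs_self r]
  rw [overlapKernel, h.inter_eq, measure_empty]
  simp

/-- The upper boundary of the lens. -/
def lensHeight (r x : ℝ) : ℝ := min (Real.sqrt (1 - x ^ 2)) (Real.sqrt (1 - (x - r) ^ 2))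

lemma continuous_lensHeight (r : ℝ) : Continuous (lensHeight r) := by
  unfold lensHeight
  fun_prop

lemma volume_lens (r : ℝ) :
    volume (Metric.ball (0 : ℂ) 1 ∩ Metric.ball (r : ℂ) 1) =
      volume (regionBetween (-lensHeight r) (lensHeight r) (Set.Ioo (r - 1) 1)) := by
  rw [← Complex.volume_preserving_equiv_real_prod.symm.measure_preimage
    (Metric.isOpen_ball.inter Metric.isOpen_ball).measurableSet.nullMeasurableSet]
  congr 1
  ext ⟨x, y⟩
  have e1 : ∀ a : ℝ, (⟨x, y⟩ : ℂ) ∈ Metric.ball (a : ℂ) 1 ↔ (x - a) ^ 2 + y ^ 2 < 1 := by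
    intro a
    rw [mem_ball_iff_norm, ← sq_lt_one_iff₀ (norm_nonneg _), ← Complex.normSq_eq_norm_sq,
      Complex.normSq_apply]
    simp [sq]
  have e0 := e1 0
  rw [Complex.ofReal_zero, sub_zero] at e0
  change ((⟨x, y⟩ : ℂ) ∈ Metric.ball (0 : ℂ) 1 ∧ (⟨x, y⟩ : ℂ) ∈ Metric.ball (r : ℂ) 1) ↔ _
  rw [e0, e1]
  simp only [regionBetween, Set.mem_ofPred_eq, Set.mem_Ioo, Pi.neg_apply]
  rw [← abs_lt, lensHeight, lt_min_iff, Real.lt_sqrt (abs_nonneg y), Real.lt_sqrt (abs_nonneg y),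
    sq_abs]
  constructor
  · rintro ⟨h1, h2⟩
    have h3 : x < 1 := (abs_lt_of_sq_lt_sq' (by nlinarith [sq_nonneg y]) zero_le_one).2
    have h4 : -1 < x - r :=
      (abs_lt_of_sq_lt_sq' (show (x - r) ^ 2 < 1 ^ 2 by nlinarith [sq_nonneg y]) zero_le_one).1
    exact ⟨⟨by linarith, h3⟩, by linarith, by linarith⟩
  · rintro ⟨-, h1, h2⟩
    exact ⟨by linarith, by linarith⟩

lemma integral_sqrt_one_sub_sq {a : ℝ} (h0 : 0 ≤ a) (h1 : a ≤ 1) :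
    ∫ x in a..1, Real.sqrt (1 - x ^ 2) =
      (Real.arccos a - a * Real.sqrt (1 - a ^ 2)) / 2 := by
  have hF : ∀ x ∈ Set.Ioo a 1, HasDerivAt
      (fun x => (x * Real.sqrt (1 - x ^ 2) - Real.arccos x) / 2) (Real.sqrt (1 - x ^ 2)) x := by
    intro x hx
    have hpos : 0 < 1 - x ^ 2 := by nlinarith [hx.1, hx.2]
    have hs : Real.sqrt (1 - x ^ 2) * Real.sqrt (1 - x ^ 2) = 1 - x ^ 2 :=
      Real.mul_self_sqrt hpos.le
    have hs0 : Real.sqrt (1 - x ^ 2) ≠ 0 := (Real.sqrt_pos.mpr hpos).ne'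
    have d1 : HasDerivAt (fun x : ℝ => 1 - x ^ 2) (-(2 * x)) x := by
      simpa using ((hasDerivAt_pow 2 x).const_sub 1)
    have d2 := (hasDerivAt_id x).mul (d1.sqrt hpos.ne')
    have d3 := Real.hasDerivAt_arccos (x := x) (by linarith [hx.1]) (by linarith [hx.2])
    convert! ((d2.sub d3).div_const 2) using 1
    simp only [id]
    field_simp
    rw [sq (Real.sqrt _), hs]
    ring
  rw [intervalIntegral.integral_eq_sub_of_hasDerivAt_of_le h1 ?_ hF
    (Continuous.intervalIntegrable (by fun_prop) _ _)]
  · simp only [Real.arccos_one]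
    norm_num
    ring
  · exact Continuous.continuousOn (((continuous_id.mul (by fun_prop)).sub
      Real.continuous_arccos).div_const 2)

/-- The lens is symmetric under x ↦ r - x; right of r/2 the circle about 0 is the lower arc, left of
it the circle about r. -/
lemma integral_lensHeight {r : ℝ} (h0 : 0 ≤ r) (h2 : r ≤ 2) :
    ∫ x in (r - 1)..1, lensHeight r x = 2 * ∫ x in (r / 2)..1, Real.sqrt (1 - x ^ 2) := by
  have hint : ∀ a b, IntervalIntegrable (lensHeight r) volume a b := fun a b =>
    (continuous_lensHeight r).intervalIntegrable a b
  have e1 : ∫ x in (r / 2)..1, lensHeight r x = ∫ x in (r / 2)..1, Real.sqrt (1 - x ^ 2) := by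
    refine intervalIntegral.integral_congr fun x hx => ?_
    rw [Set.uIcc_of_le (by linarith)] at hx
    exact min_eq_left (Real.sqrt_le_sqrt (by nlinarith [hx.1]))
  have e2 : ∫ x in (r - 1)..(r / 2), lensHeight r x =
      ∫ x in (r / 2)..1, Real.sqrt (1 - x ^ 2) := by
    have h := intervalIntegral.integral_comp_sub_left (a := r - 1) (b := r / 2)
      (fun x => Real.sqrt (1 - x ^ 2)) r
    have e : r - (r - 1) = 1 ∧ r - r / 2 = r / 2 := ⟨by ring, by ring⟩
    rw [e.1, e.2] at h
    rw [← h]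
    refine intervalIntegral.integral_congr fun x hx => ?_
    rw [Set.uIcc_of_le (by linarith)] at hx
    rw [← neg_sq (r - x), neg_sub]
    exact min_eq_right (Real.sqrt_le_sqrt (by nlinarith [hx.2]))
  rw [← intervalIntegral.integral_add_adjacent_intervals (hint _ (r / 2)) (hint _ _), e1, e2]
  ring

lemma overlapKernel_eq {r : ℝ} (h0 : 0 ≤ r) (h2 : r ≤ 2) : overlapKernel r =
    2 / Real.pi * Real.arccos (r / 2) - r / Real.pi * Real.sqrt (1 - r ^ 2 / 4) := by
  have hc := continuous_lensHeight r
  have hnn : ∀ x, 0 ≤ lensHeight r x := fun x => le_min (Real.sqrt_nonneg _) (Real.sqrt_nonneg _)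
  have hv : volume (regionBetween (-lensHeight r) (lensHeight r) (Set.Ioo (r - 1) 1)) =
      ENNReal.ofReal (∫ x in Set.Ioo (r - 1) 1, (lensHeight r - -lensHeight r) x) :=
    volume_regionBetween_eq_integral
      (hc.neg.integrableOn_Icc.mono_set Set.Ioo_subset_Icc_self)
      (hc.integrableOn_Icc.mono_set Set.Ioo_subset_Icc_self) measurableSet_Ioo
      fun x _ => by simpa using (neg_nonpos.mpr (hnn x)).trans (hnn x)
  have hI : ∫ x in Set.Ioo (r - 1) 1, (lensHeight r - -lensHeight r) x =
      2 * (Real.arccos (r / 2) - r / 2 * Real.sqrt (1 - (r / 2) ^ 2)) := by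
    rw [← integral_Ioc_eq_integral_Ioo, ← intervalIntegral.integral_of_le (by linarith)]
    have e : ∀ x, (lensHeight r - -lensHeight r) x = 2 * lensHeight r x := fun x => by
      simp only [Pi.sub_apply, Pi.neg_apply]; ring
    simp only [e]
    rw [intervalIntegral.integral_const_mul, integral_lensHeight h0 h2,
      integral_sqrt_one_sub_sq (by linarith) (by linarith)]
    ring
  have hpos : 0 ≤ ∫ x in Set.Ioo (r - 1) 1, (lensHeight r - -lensHeight r) x :=
    integral_nonneg fun x => by simpa using hnn x
  rw [overlapKernel, volume_lens, hv, ENNReal.toReal_ofReal hpos, hI, div_pow]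
  norm_num
  field_simp

end Lens

/-! ### Isonormal Gaussian processes -/

section Isonormal

/-- |e^{ia} - e^{ib}| ≤ |a - b|, and on a probability space the L¹ norm is at most the L² norm.
Gaussian characteristic functions therefore survive L² limits. -/
lemma norm_integral_exp_sub_le {Ω : Type*} [MeasurableSpace Ω] {P : Measure Ω}
    [IsProbabilityMeasure P] (f g : Lp ℝ 2 P) :
    ‖∫ ω, Complex.exp (Complex.I * (f ω : ℝ)) ∂P - ∫ ω, Complex.exp (Complex.I * (g ω : ℝ)) ∂P‖ ≤
      ‖f - g‖ := by
  have hi : ∀ f : Lp ℝ 2 P, Integrable (fun ω => Complex.exp (Complex.I * (f ω : ℝ))) P := by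
    intro f
    have hm : AEMeasurable f P := (Lp.aestronglyMeasurable f).aemeasurable
    refine Integrable.of_bound (C := 1) (AEMeasurable.aestronglyMeasurable (by fun_prop))
      (ae_of_all _ fun ω => ?_)
    rw [Complex.norm_exp]; simp
  rw [← integral_sub (hi f) (hi g), ← enorm_le_iff_norm_le]
  calc ‖∫ ω, (Complex.exp (Complex.I * (f ω : ℝ)) - Complex.exp (Complex.I * (g ω : ℝ))) ∂P‖ₑ
      ≤ ∫⁻ ω, ‖Complex.exp (Complex.I * (f ω : ℝ)) - Complex.exp (Complex.I * (g ω : ℝ))‖ₑ ∂P :=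
        enorm_integral_le_lintegral_enorm _
    _ ≤ ∫⁻ ω, ‖(f - g) ω‖ₑ ∂P := by
        refine lintegral_mono_ae ?_
        filter_upwards [Lp.coeFn_sub f g] with ω hω
        rw [hω, Pi.sub_apply, enorm_le_iff_norm_le]
        have e : Complex.exp (Complex.I * (f ω : ℝ)) - Complex.exp (Complex.I * (g ω : ℝ)) =
            Complex.exp (Complex.I * (g ω : ℝ)) *
              (Complex.exp (Complex.I * ((f ω - g ω : ℝ) : ℂ)) - 1) := by
          rw [mul_sub, mul_one, ← Complex.exp_add]
          congr 2
          push_cast; ring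
        have h1 : ‖Complex.exp (Complex.I * (g ω : ℝ))‖ = 1 := by rw [Complex.norm_exp]; simp
        rw [e, norm_mul, h1, one_mul]
        exact Real.norm_exp_I_mul_ofReal_sub_one_le
    _ = eLpNorm (f - g : Lp ℝ 2 P) 1 P := eLpNorm_one_eq_lintegral_enorm.symm
    _ ≤ eLpNorm (f - g : Lp ℝ 2 P) 2 P :=
        eLpNorm_le_eLpNorm_of_exponent_le (by norm_num) (Lp.aestronglyMeasurable _)
    _ = ‖f - g‖ₑ := (Lp.enorm_def _).symm

universe u

variable {ι : Type u}

/-- The law of independent standard real Gaussian variables. -/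
def gaussianProduct (ι : Type u) : Measure (ι → ℝ) :=
  Measure.infinitePi fun _ : ι => gaussianReal 0 1

instance : IsProbabilityMeasure (gaussianProduct ι) :=
  inferInstanceAs (IsProbabilityMeasure (Measure.infinitePi fun _ : ι => gaussianReal 0 1))

lemma measurePreserving_gaussianProduct (i : ι) :
    MeasurePreserving (fun ω : ι → ℝ => ω i) (gaussianProduct ι) (gaussianReal 0 1) :=
  measurePreserving_eval_infinitePi _ i

lemma iIndepFun_gaussianProduct : iIndepFun (fun (i : ι) (ω : ι → ℝ) => ω i) (gaussianProduct ι) :=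
  iIndepFun_infinitePi (X := fun _ x => x) fun _ => measurable_id

lemma memLp_gaussianProduct (i : ι) : MemLp (fun ω : ι → ℝ => ω i) 2 (gaussianProduct ι) :=
  (memLp_id_gaussianReal 2).comp_measurePreserving (measurePreserving_gaussianProduct i)

/-- The coordinate functions in `L²`. -/
def gaussianCoord (i : ι) : Lp ℝ 2 (gaussianProduct ι) := (memLp_gaussianProduct i).toLp

lemma integral_gaussianProduct_comp (i : ι) {f : ℝ → ℂ} (hf : Measurable f) :
    ∫ ω, f (ω i) ∂(gaussianProduct ι) = ∫ x, f x ∂(gaussianReal 0 1) := by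
  rw [← (measurePreserving_gaussianProduct i).map_eq, integral_map
    (measurePreserving_gaussianProduct i).aemeasurable hf.aestronglyMeasurable]

lemma integral_gaussianProduct_mul [DecidableEq ι] (i j : ι) :
    ∫ ω, ω i * ω j ∂(gaussianProduct ι) = if i = j then 1 else 0 := by
  have hid : ∀ i : ι, ∫ ω, ω i ∂(gaussianProduct ι) = 0 := by
    intro i
    have := integral_map (measurePreserving_gaussianProduct i).aemeasurable
      (f := fun x : ℝ => x) measurable_id.aestronglyMeasurable
    rw [(measurePreserving_gaussianProduct i).map_eq, integral_id_gaussianReal] at this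
    exact this.symm
  split_ifs with h
  · subst h
    have h1 := variance_of_integral_eq_zero (X := fun x : ℝ => x) (μ := gaussianReal 0 1)
      measurable_id.aemeasurable integral_id_gaussianReal
    have h2 := integral_map (measurePreserving_gaussianProduct i).aemeasurable
      (f := fun x : ℝ => x ^ 2) (measurable_id.pow_const 2).aestronglyMeasurable
    rw [(measurePreserving_gaussianProduct i).map_eq, ← h1, variance_fun_id_gaussianReal] at h2
    simp only [← sq]
    simpa using h2.symm
  · have h1 := (iIndepFun_gaussianProduct.indepFun h).integral_fun_mul_eq_mul_integral
      (memLp_gaussianProduct i).aestronglyMeasurable (memLp_gaussianProduct j).aestronglyMeasurable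
    rw [h1, hid, zero_mul]

lemma orthonormal_gaussianCoord : Orthonormal ℝ (gaussianCoord (ι := ι)) := by
  classical
  rw [orthonormal_iff_ite]
  intro i j
  rw [L2.inner_def, ← integral_gaussianProduct_mul i j]
  refine integral_congr_ae ?_
  filter_upwards [(memLp_gaussianProduct i).coeFn_toLp, (memLp_gaussianProduct j).coeFn_toLp]
    with ω h1 h2
  rw [gaussianCoord, gaussianCoord, h1, h2]
  simp [mul_comm]

lemma integral_exp_sum_gaussianCoord (s : Finset ι) (c : ι → ℝ) :
    ∫ ω, Complex.exp (Complex.I * ((∑ i ∈ s, c i • gaussianCoord i : Lp ℝ 2 (gaussianProduct ι)) ω :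
      ℝ)) ∂(gaussianProduct ι) = Complex.exp (-((∑ i ∈ s, c i ^ 2) / 2 : ℝ)) := by
  have h1 : (∑ i ∈ s, c i • gaussianCoord i : Lp ℝ 2 (gaussianProduct ι)) =ᵐ[gaussianProduct ι]
      fun ω => ∑ i ∈ s, c i * ω i := by
    classical
    induction s using Finset.induction_on with
    | empty =>
      simp only [Finset.sum_empty]
      exact Lp.coeFn_zero _ _ _
    | insert a s ha ih =>
      rw [Finset.sum_insert ha]
      filter_upwards [ih, Lp.coeFn_add (c a • gaussianCoord a) (∑ i ∈ s, c i • gaussianCoord i),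
        Lp.coeFn_smul (c a) (gaussianCoord a), (memLp_gaussianProduct a).coeFn_toLp]
        with ω h1 h2 h3 h4
      rw [h2, Pi.add_apply, h1, h3, Pi.smul_apply, gaussianCoord, h4, Finset.sum_insert ha,
        smul_eq_mul]
  have h2 : ∫ ω, Complex.exp (Complex.I * ((∑ i ∈ s, c i • gaussianCoord i :
      Lp ℝ 2 (gaussianProduct ι)) ω : ℝ)) ∂(gaussianProduct ι) =
      ∫ ω, ∏ i : s, Complex.exp (Complex.I * (c i * ω i : ℝ)) ∂(gaussianProduct ι) := by
    refine integral_congr_ae ?_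
    filter_upwards [h1] with ω hω
    rw [hω, ← Complex.exp_sum, ← Finset.mul_sum, ← Finset.sum_coe_sort]
    push_cast
    rfl
  have hind : iIndepFun (fun (i : s) (ω : ι → ℝ) => ω i) (gaussianProduct ι) :=
    iIndepFun_gaussianProduct.precomp Subtype.val_injective
  have hm : ∀ i : ι, Measurable fun x : ℝ => Complex.exp (Complex.I * (c i * x : ℝ)) :=
    fun i => by fun_prop
  rw [h2, hind.integral_fun_prod_comp
    (f := fun (i : s) (x : ℝ) => Complex.exp (Complex.I * (c i * x : ℝ)))
    (fun i => (measurable_pi_apply _).aemeasurable) (fun i => (hm i).aestronglyMeasurable)]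
  have h3 : ∀ i : s, ∫ ω : ι → ℝ, Complex.exp (Complex.I * (c i * ω i : ℝ)) ∂(gaussianProduct ι) =
      Complex.exp (-(c i ^ 2 / 2 : ℝ)) := by
    intro i
    rw [integral_gaussianProduct_comp (i : ι) (hm i)]
    have := charFun_gaussianReal (μ := 0) (v := 1) (c i)
    rw [charFun_apply_real] at this
    convert! this using 2
    · funext x
      congr 1; push_cast; ring
    · push_cast; simp
  simp only [h3]
  rw [Finset.prod_coe_sort s (fun i => Complex.exp (-(c i ^ 2 / 2 : ℝ))), ← Complex.exp_sum]
  congr 1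
  push_cast
  rw [Finset.sum_neg_distrib, Finset.sum_div]

/-- Every real Hilbert space embeds isometrically into a space of centered Gaussian variables. -/
lemma exists_isonormal (E : Type u) [NormedAddCommGroup E] [InnerProductSpace ℝ E]
    [CompleteSpace E] : ∃ (ι : Type u) (J : E →ₗᵢ[ℝ] Lp ℝ 2 (gaussianProduct ι)), ∀ h : E,
      ∫ ω, Complex.exp (Complex.I * (J h ω : ℝ)) ∂(gaussianProduct ι) =
        Complex.exp (-(‖h‖ ^ 2 / 2 : ℝ)) := by
  classical
  obtain ⟨w, b, -⟩ := exists_hilbertBasis ℝ E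
  -- A Hilbert basis is sent to independent standard Gaussian coordinates; the characteristic
  -- function is computed on finite partial sums and extended by continuity.
  let J : E →ₗᵢ[ℝ] Lp ℝ 2 (gaussianProduct w) :=
    (orthonormal_gaussianCoord.orthogonalFamily.linearIsometry).comp b.repr.toLinearIsometry
  have hJb : ∀ i, J (b i) = gaussianCoord i := by
    intro i
    change orthonormal_gaussianCoord.orthogonalFamily.linearIsometry (b.repr (b i)) = _
    rw [b.repr_self, OrthogonalFamily.linearIsometry_apply_single]
    simp
  refine ⟨w, J, fun h => ?_⟩
  have hs := b.hasSum_repr h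
  have h1 : Tendsto (fun s : Finset w => J (∑ i ∈ s, b.repr h i • b i)) atTop (𝓝 (J h)) :=
    (J.continuous.tendsto h).comp hs
  have h2 : Tendsto (fun s : Finset w => ∫ ω, Complex.exp (Complex.I *
      (J (∑ i ∈ s, b.repr h i • b i) ω : ℝ)) ∂(gaussianProduct w)) atTop
      (𝓝 (∫ ω, Complex.exp (Complex.I * (J h ω : ℝ)) ∂(gaussianProduct w))) := by
    rw [tendsto_iff_norm_sub_tendsto_zero] at h1 ⊢
    exact squeeze_zero (fun _ => norm_nonneg _) (fun s => norm_integral_exp_sub_le _ _) h1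
  have h3 : Tendsto (fun s : Finset w => Complex.exp (-(‖∑ i ∈ s, b.repr h i • b i‖ ^ 2 / 2 : ℝ)))
      atTop (𝓝 (Complex.exp (-(‖h‖ ^ 2 / 2 : ℝ)))) := by
    have hc : Continuous fun x : E => Complex.exp (-(‖x‖ ^ 2 / 2 : ℝ)) := by fun_prop
    exact (hc.tendsto h).comp hs
  refine tendsto_nhds_unique h2 (h3.congr fun s => ?_)
  have h4 : ‖∑ i ∈ s, b.repr h i • b i‖ ^ 2 = ∑ i ∈ s, b.repr h i ^ 2 := by
    rw [← real_inner_self_eq_norm_sq, b.orthonormal.inner_sum]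
    simp [sq]
  rw [h4, ← integral_exp_sum_gaussianCoord, map_sum]
  simp only [map_smul, hJb]

end Isonormal

end

section

open scoped Topology InnerProductSpace

/-! ### Existence of the limit field -/

section LimitField

lemma volume_ball_inter_ball (ξ η : ℂ) :
    volume (Metric.ball ξ 1 ∩ Metric.ball η 1) =
      volume (Metric.ball (0 : ℂ) 1 ∩ Metric.ball (‖ξ - η‖ : ℂ) 1) := by
  obtain ⟨c, hc⟩ : ∃ c : Circle, η - ξ = c * (‖ξ - η‖ : ℂ) :=
    ⟨Circle.exp (Complex.arg (η - ξ)), by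
      rw [Circle.coe_exp, norm_sub_rev, mul_comm]
      exact (Complex.norm_mul_exp_arg_mul_I _).symm⟩
  have hmp : MeasurePreserving (fun z : ℂ => rotation c z + ξ) volume volume :=
    (measurePreserving_add_right volume ξ).comp (rotation c).measurePreserving
  rw [← hmp.measure_preimage (Metric.isOpen_ball.inter
    Metric.isOpen_ball).measurableSet.nullMeasurableSet]
  congr 1
  ext z
  have hn : ∀ w : ℂ, ‖(c : ℂ) * w‖ = ‖w‖ := fun w => by rw [norm_mul, Circle.norm_coe, one_mul]
  have e2 : (c : ℂ) * z + ξ - η = c * (z - (‖ξ - η‖ : ℂ)) := by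
    rw [mul_sub, ← hc]; ring
  simp only [Set.mem_preimage, Set.mem_inter_iff, mem_ball_iff_norm, rotation_apply,
    add_sub_cancel_right, e2, hn, sub_zero]

/-- The normalized indicator function of the unit disk around `ξ`. -/
def diskVector (ξ : ℂ) : Lp ℝ 2 (volume : Measure ℂ) :=
  indicatorConstLp 2 (Metric.isOpen_ball (x := ξ) (ε := 1)).measurableSet
    measure_ball_lt_top.ne (Real.sqrt Real.pi)⁻¹

/-- The overlap kernel is a Gram kernel. This is its positive definiteness, and it supplies the
vectors for the isonormal construction. -/
lemma inner_diskVector (ξ η : ℂ) :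
    ⟪diskVector ξ, diskVector η⟫_ℝ = overlapKernel ‖ξ - η‖ := by
  rw [diskVector, L2.inner_indicatorConstLp_eq_inner_setIntegral, diskVector,
    integral_congr_ae (ae_restrict_of_ae indicatorConstLp_coeFn),
    integral_indicator_const _ Metric.isOpen_ball.measurableSet, overlapKernel,
    ← volume_ball_inter_ball, measureReal_restrict_apply Metric.isOpen_ball.measurableSet,
    Set.inter_comm, Measure.real]
  rw [real_inner_smul_right, real_inner_self_eq_norm_sq, norm_inv, Real.norm_eq_abs, inv_pow,
    sq_abs, Real.sq_sqrt Real.pi_pos.le, div_eq_mul_inv]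

/-- The isonormal process is evaluated at the disk vectors. Joint Gaussianity holds because a linear
functional of finitely many values is again the image of one Hilbert space vector. -/
lemma exists_isOverlapField : ∃ (Ω' : Type) (_ : MeasurableSpace Ω') (P' : Measure Ω')
    (G : ℂ → Ω' → ℝ), IsProbabilityMeasure P' ∧ IsOverlapField G P' := by
  obtain ⟨ι, J, hJ⟩ := exists_isonormal (Lp ℝ 2 (volume : Measure ℂ))
  have hm : ∀ h, AEMeasurable (J h) (gaussianProduct ι) := fun h =>
    (Lp.aestronglyMeasurable (J h)).aemeasurable
  have hlaw : ∀ h, (gaussianProduct ι).map (J h) = gaussianReal 0 (‖h‖₊ ^ 2) := by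
    intro h
    have := Measure.isProbabilityMeasure_map (μ := gaussianProduct ι) (hm h)
    refine Measure.ext_of_charFun (funext fun t => ?_)
    rw [charFun_apply_real, charFun_gaussianReal, integral_map (hm h)
      (Continuous.aestronglyMeasurable (by fun_prop))]
    have e : ∫ ω, Complex.exp (t * (J h ω : ℝ) * Complex.I) ∂(gaussianProduct ι) =
        ∫ ω, Complex.exp (Complex.I * (J (t • h) ω : ℝ)) ∂(gaussianProduct ι) := by
      refine integral_congr_ae ?_
      rw [map_smul]
      filter_upwards [Lp.coeFn_smul t (J h)] with ω hω
      rw [hω, Pi.smul_apply, smul_eq_mul]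
      congr 1; push_cast; ring
    rw [e, hJ, norm_smul, mul_pow, Real.norm_eq_abs, sq_abs]
    congr 1; push_cast; ring
  refine ⟨ι → ℝ, inferInstance, gaussianProduct ι, fun ξ => J (diskVector ξ), inferInstance,
    ⟨fun I => ⟨isGaussian_of_map_eq_gaussianReal fun L => ?_⟩⟩, fun ξ => ?_, fun ξ η => ?_⟩
  · classical
    have hmeas : AEMeasurable (fun ω => I.restrict fun ξ => J (diskVector ξ) ω)
        (gaussianProduct ι) := aemeasurable_pi_lambda _ fun ξ => hm _
    have hL : ∀ x : I → ℝ, L x = ∑ ξ, L (Pi.single ξ 1) * x ξ := by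
      intro x
      conv_lhs => rw [← Finset.univ_sum_single x, map_sum]
      refine Finset.sum_congr rfl fun ξ _ => ?_
      have : (Pi.single ξ (x ξ) : I → ℝ) = x ξ • Pi.single ξ 1 := by
        rw [← Pi.single_smul, smul_eq_mul, mul_one]
      rw [this, map_smul, smul_eq_mul, mul_comm]
    have hcomb : (fun ω => L (I.restrict fun ξ => J (diskVector ξ) ω)) =ᵐ[gaussianProduct ι]
        J (∑ ξ : I, L (Pi.single ξ 1) • diskVector ξ) := by
      have h1 : ∀ s : Finset I, (J (∑ ξ ∈ s, L (Pi.single ξ 1) • diskVector ξ) : (ι → ℝ) → ℝ)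
          =ᵐ[gaussianProduct ι]
          fun ω => ∑ ξ ∈ s, L (Pi.single ξ 1) * J (diskVector ξ) ω := by
        intro s
        induction s using Finset.induction_on with
        | empty =>
          simp only [Finset.sum_empty, map_zero]
          exact Lp.coeFn_zero _ _ _
        | insert a s ha ih =>
          rw [Finset.sum_insert ha, map_add, map_smul]
          filter_upwards [ih, Lp.coeFn_add (L (Pi.single a 1) • J (diskVector a))
            (J (∑ ξ ∈ s, L (Pi.single ξ 1) • diskVector ξ)),
            Lp.coeFn_smul (L (Pi.single a 1)) (J (diskVector a))] with ω h1 h2 h3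
          rw [h2, Pi.add_apply, h1, h3, Pi.smul_apply, Finset.sum_insert ha, smul_eq_mul]
      filter_upwards [h1 Finset.univ] with ω hω
      rw [hω, hL]
      rfl
    refine ⟨0, ‖∑ ξ : I, L (Pi.single ξ 1) • diskVector ξ‖₊ ^ 2, ?_⟩
    rw [AEMeasurable.map_map_of_aemeasurable (by fun_prop) hmeas, ← hlaw]
    exact Measure.map_congr hcomb
  · have := integral_map (hm (diskVector ξ)) (f := fun x : ℝ => x)
      measurable_id.aestronglyMeasurable
    rw [hlaw, integral_id_gaussianReal] at this
    exact this.symm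
  · rw [← inner_diskVector, ← J.inner_map_map, L2.inner_def]
    refine integral_congr_ae (ae_of_all _ fun ω => ?_)
    simp [mul_comm]

variable {Ω : Type*} [MeasurableSpace Ω] {P : Measure Ω} [IsProbabilityMeasure P]
  {G : ℂ → Ω → ℝ}

lemma overlapKernel_zero : overlapKernel 0 = 1 := by
  rw [overlapKernel_eq le_rfl (by norm_num)]
  simp only [zero_div, Real.arccos_zero, zero_mul, sub_zero]
  field_simp

/-- Linear combinations of the limit field are centered Gaussian variables. -/
lemma IsOverlapField.map_sum_eq (hG : IsOverlapField G P) (w : ℂ →₀ ℝ) :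
    P.map (fun ω => w.sum fun ξ c => c * G ξ ω) = gaussianReal 0
      (w.sum fun ξ c => w.sum fun η d => c * d * overlapKernel ‖ξ - η‖).toNNReal := by
  have hL : ∀ ξ, MemLp (G ξ) 2 P := fun ξ => (hG.isGaussianProcess.hasGaussianLaw_eval ξ).memLp_two
  have hi : ∀ ξ, Integrable (G ξ) P := fun ξ => (hL ξ).integrable (by norm_num)
  have hii : ∀ ξ η, Integrable (fun ω => G ξ ω * G η ω) P := fun ξ η => (hL ξ).integrable_mul (hL η)
  let L : (w.support → ℝ) →L[ℝ] ℝ := ∑ ξ : w.support,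
    w ξ • ContinuousLinearMap.proj (R := ℝ) (φ := fun _ : w.support => ℝ) ξ
  have hg : HasGaussianLaw (fun ω => w.sum fun ξ c => c * G ξ ω) P := by
    have := (hG.isGaussianProcess.hasGaussianLaw w.support).map_fun L
    refine this.congr (ae_of_all _ fun ω => ?_)
    simp only [L, sum_apply, smul_apply,
      ContinuousLinearMap.proj_apply, Finset.restrict, smul_eq_mul, Finsupp.sum]
    exact Finset.sum_coe_sort w.support fun ξ => w ξ * G ξ ω
  have hmean : ∫ ω, (w.sum fun ξ c => c * G ξ ω) ∂P = 0 := by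
    simp only [Finsupp.sum]
    rw [integral_finsetSum _ fun ξ _ => (hi ξ).const_mul _]
    simp [integral_const_mul, hG.centered]
  have hvar : variance (fun ω => w.sum fun ξ c => c * G ξ ω) P =
      w.sum fun ξ c => w.sum fun η d => c * d * overlapKernel ‖ξ - η‖ := by
    rw [variance_of_integral_eq_zero hg.aemeasurable hmean]
    simp only [Finsupp.sum, sq, Finset.sum_mul_sum]
    rw [integral_finsetSum]
    · refine Finset.sum_congr rfl fun ξ _ => ?_
      rw [integral_finsetSum]
      · refine Finset.sum_congr rfl fun η _ => ?_
        rw [← hG.covariance, ← integral_const_mul]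
        exact integral_congr_ae (ae_of_all _ fun ω => by ring)
      · intro η _
        exact ((hii ξ η).const_mul (w ξ * w η)).congr (ae_of_all _ fun ω => by ring)
    · intro ξ _
      refine integrable_finsetSum _ fun η _ => ?_
      exact ((hii ξ η).const_mul (w ξ * w η)).congr (ae_of_all _ fun ω => by ring)
  rw [hg.map_eq_gaussianReal, hmean, hvar]

lemma IsOverlapField.integral_exp_sum (hG : IsOverlapField G P) (w : ℂ →₀ ℝ) :
    ∫ ω, Complex.exp (Complex.I * (w.sum fun ξ c => c * G ξ ω : ℝ)) ∂P =
      Complex.exp (-((w.sum fun ξ c => w.sum fun η d => c * d * overlapKernel ‖ξ - η‖) / 2 : ℝ)) := by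
  have hm : AEMeasurable (fun ω => w.sum fun ξ c => c * G ξ ω) P :=
    Finset.aemeasurable_fun_sum _ fun ξ _ => (hG.isGaussianProcess.aemeasurable ξ).const_mul _
  have hL : ∀ ξ, MemLp (G ξ) 2 P := fun ξ => (hG.isGaussianProcess.hasGaussianLaw_eval ξ).memLp_two
  -- The variance was stored through `toNNReal`; writing it as a squared norm of disk vectors shows
  -- that nothing was truncated.
  have hpos : 0 ≤ w.sum fun ξ c => w.sum fun η d => c * d * overlapKernel ‖ξ - η‖ := by
    have : (w.sum fun ξ c => w.sum fun η d => c * d * overlapKernel ‖ξ - η‖) =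
        ‖w.sum fun ξ c => c • diskVector ξ‖ ^ 2 := by
      rw [← real_inner_self_eq_norm_sq]
      simp only [Finsupp.sum, sum_inner, inner_sum, real_inner_smul_left, real_inner_smul_right,
        inner_diskVector]
      exact Finset.sum_congr rfl fun ξ _ => Finset.sum_congr rfl fun η _ => by
        rw [norm_sub_rev η ξ]; ring
    rw [this]; positivity
  have h1 := charFun_gaussianReal (μ := 0) (v := (w.sum fun ξ c => w.sum fun η d =>
    c * d * overlapKernel ‖ξ - η‖).toNNReal) 1
  rw [← hG.map_sum_eq w, charFun_apply_real, integral_map hm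
    (Continuous.aestronglyMeasurable (by fun_prop))] at h1
  convert! h1 using 1
  · refine integral_congr_ae (ae_of_all _ fun ω => ?_)
    simp only
    congr 1; push_cast; ring
  · rw [Real.coe_toNNReal _ hpos]
    congr 1; push_cast; ring

/-- The increment is Gaussian of variance 2(1 - κ) ≤ 4‖ξ - η‖, by the Lipschitz bound inherited from
the prelimit kernels. The constants agree with those of the fluctuation fields. -/
lemma IsOverlapField.lintegral_sub_pow_le (hG : IsOverlapField G P) (ξ η : ℂ) {p : ℕ}
    (hp : p ≠ 0) : ∫⁻ ω, ENNReal.ofReal (|G ξ ω - G η ω| ^ (2 * p)) ∂P ≤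
      ENNReal.ofReal (4 * (2 * p).factorial * 32 ^ p * ‖ξ - η‖ ^ p) := by
  rcases eq_or_ne ξ η with rfl | hne
  · simp [hp]
  have hr : 0 < ‖ξ - η‖ := norm_pos_iff.mpr (sub_ne_zero.mpr hne)
  have hm := (hG.isGaussianProcess.aemeasurable ξ).sub (hG.isGaussianProcess.aemeasurable η)
  have hlaw : P.map (fun ω => G ξ ω - G η ω) =
      gaussianReal 0 (2 * (1 - overlapKernel ‖ξ - η‖)).toNNReal := by
    have h := hG.map_sum_eq (Finsupp.single ξ 1 - Finsupp.single η 1)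
    classical
    have e : ∀ f : ℂ → ℝ → ℝ, (∀ ζ, f ζ 0 = 0) →
        (Finsupp.single ξ (1 : ℝ) - Finsupp.single η 1).sum f = f ξ 1 + f η (-1) := by
      intro f hf
      have hs : (Finsupp.single ξ (1 : ℝ) - Finsupp.single η 1).support ⊆ {ξ, η} := by
        intro ζ hζ
        by_contra hc
        simp only [Finset.mem_insert, Finset.mem_singleton, not_or] at hc
        simp [Ne.symm hc.1, Ne.symm hc.2] at hζ
      rw [Finsupp.sum_of_support_subset _ hs _ fun ζ _ => hf ζ, Finset.sum_pair hne]
      congr 1 <;> simp [hne, hne.symm]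
    have hsum : (fun ω => (Finsupp.single ξ (1 : ℝ) - Finsupp.single η 1).sum
        fun ζ c => c * G ζ ω) = fun ω => G ξ ω - G η ω := funext fun ω => by
      rw [e (fun ζ c => c * G ζ ω) fun ζ => zero_mul _]; ring
    rw [hsum, e _ (fun ζ => by simp [Finsupp.sum]), e _ (fun ζ => by simp), e _ (fun ζ => by simp)] at h
    simp only [sub_self, norm_zero, overlapKernel_zero, norm_sub_rev η ξ] at h
    convert! h using 3
    ring
  have hκ : 2 * (1 - overlapKernel ‖ξ - η‖) ≤ 4 * ‖ξ - η‖ := by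
    linarith [one_sub_overlapKernel_le hr.le]
  have h := lintegral_pow_le_of_exp_moments hm (v := 4 * ‖ξ - η‖) (by positivity) (fun s hs => ?_) p
  · refine h.trans_eq ?_
    congr 1; ring
  · set v : ℝ≥0 := (2 * (1 - overlapKernel ‖ξ - η‖)).toNNReal
    have hv : (v : ℝ) ≤ 4 * ‖ξ - η‖ := by
      rw [Real.coe_toNNReal']
      exact max_le hκ (by positivity)
    have hmeas : Measurable fun x : ℝ => ENNReal.ofReal (Real.exp (s * x)) := by fun_prop
    have h1 := lintegral_map' (μ := P) hmeas.aemeasurable hm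
    change _ = ∫⁻ ω, ENNReal.ofReal (Real.exp (s * (G ξ ω - G η ω))) ∂P at h1
    change ∫⁻ ω, ENNReal.ofReal (Real.exp (s * (G ξ ω - G η ω))) ∂P ≤ 2
    have e : (G ξ - G η) = fun ω => G ξ ω - G η ω := rfl
    rw [← h1, e, hlaw, ← ofReal_integral_eq_lintegral_ofReal (integrable_exp_mul_gaussianReal s)
      (ae_of_all _ fun x => (Real.exp_pos _).le)]
    have h2 := congrFun (mgf_fun_id_gaussianReal (μ := 0) (v := v)) s
    rw [mgf] at h2
    rw [h2]
    have h3 : Real.exp (0 * s + v * s ^ 2 / 2) ≤ Real.exp (1 / 4) :=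
      Real.exp_le_exp.mpr (by nlinarith [sq_nonneg s])
    have h4 := Real.exp_bound_div_one_sub_of_interval (x := 1 / 4) (by norm_num) (by norm_num)
    refine (ENNReal.ofReal_le_ofReal (h3.trans (h4.trans (show _ ≤ (2 : ℝ) by norm_num)))).trans_eq ?_
    norm_num

end LimitField

end

section

open scoped Topology

/-! ### Tightness and convergence of the fluctuation fields -/

section Convergence

variable {Ω : Type*} [MeasurableSpace Ω] {P : Measure Ω} {ζ : ℕ → Ω → ℂ}
  {K : TopologicalSpace.Compacts ℂ}

lemma fluctuation_zero (a : ℕ → ℂ) (z₀ ξ : ℂ) : fluctuation a z₀ 0 ξ = 0 := by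
  simp [fluctuation]

lemma ae_continuous_fluctuation (hlaw : ∀ k, HasLaw (ζ k) stdComplexGaussian P) (z₀ : ℂ) :
    ∀ᵐ ω ∂P, ∀ N : ℕ, Continuous (fluctuation (fun k => ζ k ω) z₀ N) := by
  filter_upwards [ae_tempered hlaw] with ω hω N
  exact (hω.contDiff_fluctuation z₀ N).continuous

lemma aemeasurable_continuousPath_fluctuation (hlaw : ∀ k, HasLaw (ζ k) stdComplexGaussian P)
    (z₀ : ℂ) (N : ℕ) :
    AEMeasurable (fun ω => continuousPath K (fluctuation (fun k => ζ k ω) z₀ N)) P :=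
  aemeasurable_continuousPath (aemeasurable_fluctuation hlaw z₀ N)
    ((ae_continuous_fluctuation hlaw z₀).mono fun _ h => h N)

variable [IsProbabilityMeasure P]

/-- The moment constants do not depend on N, hence neither does the radius T. The field with N = 0
vanishes identically and satisfies the same bounds. -/
lemma exists_fluctuation_notMem_holderBall_le (hlaw : ∀ k, HasLaw (ζ k) stdComplexGaussian P)
    (hindep : iIndepFun ζ P) (z₀ : ℂ) (K : TopologicalSpace.Compacts ℂ) {β : ℝ} (hβ0 : 0 < β)
    (hβ : β < 1 / 2) {ε : ENNReal} (hε : 0 < ε) : ∃ T : ℝ, ∀ N : ℕ,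
      P {ω | continuousPath K (fluctuation (fun k => ζ k ω) z₀ N) ∉ holderBall K β T} ≤ ε := by
  obtain ⟨T, hT⟩ := exists_holderBall_compl_le (P := P) K hβ0 hβ
    (fun p => 4 * (2 * p).factorial * 32 ^ p) (fun p => by positivity) hε
  refine ⟨T, fun N => hT (fun ξ ω => fluctuation (fun k => ζ k ω) z₀ N ξ)
    (aemeasurable_fluctuation hlaw z₀ N) ((ae_continuous_fluctuation hlaw z₀).mono fun _ h => h N)
    (fun p hp ξ η => ?_) (fun p ξ => ?_)⟩
  · rcases Nat.eq_zero_or_pos N with rfl | hN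
    · simp [fluctuation_zero, hp]
    · exact lintegral_sub_fluctuation_pow_le hlaw hindep z₀ hN ξ η hp
  · rcases Nat.eq_zero_or_pos N with rfl | hN
    · simp only [fluctuation_zero, abs_zero, lintegral_const, measure_univ, mul_one]
      refine ENNReal.ofReal_le_ofReal (pow_le_one₀ le_rfl zero_le_one |>.trans ?_)
      have h1 : (1 : ℝ) ≤ (2 * p).factorial := by exact_mod_cast (2 * p).factorial_pos
      have h2 : (1 : ℝ) ≤ 32 ^ p := one_le_pow₀ (by norm_num)
      nlinarith
    · refine (lintegral_fluctuation_pow_le hlaw hindep z₀ hN ξ p).trans ?_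
      gcongr
      norm_num

lemma isTightMeasureSet_map_continuousPath (hlaw : ∀ k, HasLaw (ζ k) stdComplexGaussian P)
    (hindep : iIndepFun ζ P) (z₀ : ℂ) (K : TopologicalSpace.Compacts ℂ) :
    IsTightMeasureSet (Set.range fun N : ℕ =>
      P.map fun ω => continuousPath K (fluctuation (fun k => ζ k ω) z₀ N)) := by
  rw [isTightMeasureSet_iff_exists_isCompact_measure_compl_le]
  intro ε hε
  obtain ⟨T, hT⟩ := exists_fluctuation_notMem_holderBall_le hlaw hindep z₀ K (β := 1 / 4)
    (by norm_num) (by norm_num) hε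
  have hc := isCompact_holderBall (K := K) (β := 1 / 4) (by norm_num) T
  refine ⟨_, hc, ?_⟩
  rintro _ ⟨N, rfl⟩
  rw [Measure.map_apply_of_aemeasurable (aemeasurable_continuousPath_fluctuation hlaw z₀ N)
    hc.measurableSet.compl]
  exact hT N

lemma ae_exists_mem_holderBall (hlaw : ∀ k, HasLaw (ζ k) stdComplexGaussian P)
    (hindep : iIndepFun ζ P) (z₀ : ℂ) (K : TopologicalSpace.Compacts ℂ) {β : ℝ} (hβ0 : 0 < β)
    (hβ : β < 1 / 2) (N : ℕ) : ∀ᵐ ω ∂P, ∃ n : ℕ,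
      continuousPath K (fluctuation (fun k => ζ k ω) z₀ N) ∈ holderBall K β n := by
  refine nonpos_iff_eq_zero.mp (le_of_forall_pos_le_add fun ε hε => ?_)
  obtain ⟨T, hT⟩ := exists_fluctuation_notMem_holderBall_le hlaw hindep z₀ K hβ0 hβ hε
  obtain ⟨n, hn⟩ := exists_nat_ge T
  rw [zero_add]
  refine (measure_mono fun ω hω => ?_).trans (hT N)
  exact fun hmem => hω ⟨n, holderBall_mono hn hmem⟩

lemma ae_memHolder_fluctuation (hlaw : ∀ k, HasLaw (ζ k) stdComplexGaussian P)
    (hindep : iIndepFun ζ P) (z₀ : ℂ) (K : TopologicalSpace.Compacts ℂ) {α : ℝ≥0} (hα0 : 0 < α)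
    (hα : (α : ℝ) < 1 / 2) : ∀ᵐ ω ∂P, ∀ N : ℕ,
      MemHolder α fun x : K => fluctuation (fun k => ζ k ω) z₀ N x := by
  obtain ⟨β, hαβ, hβ⟩ := exists_between hα
  rw [ae_all_iff]
  intro N
  filter_upwards [ae_continuous_fluctuation hlaw z₀, ae_exists_mem_holderBall hlaw hindep z₀ K
    (lt_trans (NNReal.coe_pos.mpr hα0) hαβ) hβ N] with ω hc ⟨n, hn⟩
  have h : Continuous fun x : K => fluctuation (fun k => ζ k ω) z₀ N x :=
    (hc N).comp continuous_subtype_val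
  have hm := memHolder_of_mem_holderBall hα0 hαβ hn
  rwa [continuousPath, dif_pos h] at hm

lemma aemeasurable_holderPath_fluctuation (hlaw : ∀ k, HasLaw (ζ k) stdComplexGaussian P)
    (hindep : iIndepFun ζ P) (z₀ : ℂ) {α : ℝ≥0} (hα0 : 0 < α) (hα : (α : ℝ) < 1 / 2) (N : ℕ) :
    AEMeasurable (fun ω => holderPath K α (fluctuation (fun k => ζ k ω) z₀ N)) P := by
  obtain ⟨β, hαβ, hβ⟩ := exists_between hα
  obtain ⟨Φ, hΦ, hΦe⟩ := exists_measurable_eqOn_toHolderSpace (K := K) hα0 hαβ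
  refine (hΦ.comp_aemeasurable (aemeasurable_continuousPath_fluctuation hlaw z₀ N)).congr ?_
  filter_upwards [ae_exists_mem_holderBall hlaw hindep z₀ K
    (lt_trans (NNReal.coe_pos.mpr hα0) hαβ) hβ N] with ω ⟨n, hn⟩
  rw [holderPath_eq]
  exact hΦe n _ hn

/-- An exponent β strictly between α and 1/2 is spent on compactness: the compact sets are images of
β-Hölder balls under a map continuous into C^{0,α}(K). -/
lemma isTightMeasureSet_map_holderPath (hlaw : ∀ k, HasLaw (ζ k) stdComplexGaussian P)
    (hindep : iIndepFun ζ P) (z₀ : ℂ) (K : TopologicalSpace.Compacts ℂ) {α : ℝ≥0} (hα0 : 0 < α)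
    (hα : (α : ℝ) < 1 / 2) : IsTightMeasureSet (Set.range fun N : ℕ =>
      P.map fun ω => holderPath K α (fluctuation (fun k => ζ k ω) z₀ N)) := by
  obtain ⟨β, hαβ, hβ⟩ := exists_between hα
  have hβ0 : 0 < β := lt_trans (NNReal.coe_pos.mpr hα0) hαβ
  rw [isTightMeasureSet_iff_exists_isCompact_measure_compl_le]
  intro ε hε
  obtain ⟨T, hT⟩ := exists_fluctuation_notMem_holderBall_le hlaw hindep z₀ K hβ0 hβ hε
  have hc : IsCompact (toHolderSpace α '' holderBall K β T) :=
    (isCompact_holderBall hβ0 T).image_of_continuousOn (continuousOn_toHolderSpace hα0 hαβ)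
  refine ⟨_, hc, ?_⟩
  rintro _ ⟨N, rfl⟩
  rw [Measure.map_apply_of_aemeasurable (aemeasurable_holderPath_fluctuation hlaw hindep z₀ hα0 hα N)
    hc.measurableSet.compl]
  refine (measure_mono fun ω hω => ?_).trans (hT N)
  intro hmem
  refine hω ?_
  change holderPath K α _ ∈ _
  rw [holderPath_eq]
  exact Set.mem_image_of_mem _ hmem

lemma IsOverlapField.integral_exp_sum_version {Ω' : Type*} [MeasurableSpace Ω'] {P' : Measure Ω'}
    [IsProbabilityMeasure P'] {G : ℂ → Ω' → ℝ} (hG : IsOverlapField G P') {𝒢 : Ω' → C(K, ℝ)}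
    (h𝒢 : ∀ ξ : K, (fun ω => 𝒢 ω ξ) =ᵐ[P'] G ξ) (w : K →₀ ℝ) :
    ∫ ω, Complex.exp (Complex.I * (w.sum fun x c => c * 𝒢 ω x : ℝ)) ∂P' =
      Complex.exp (-((∑ x : w.support, ∑ y : w.support, w x * w y *
        overlapKernel ‖((x : K) : ℂ) - ((y : K) : ℂ)‖) / 2 : ℝ)) := by
  have hinj : Function.Injective ((↑) : K → ℂ) := Subtype.val_injective
  have h := hG.integral_exp_sum (w.mapDomain (↑))
  simp only [Finsupp.sum_mapDomain_index_inj hinj] at h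
  have e : (w.sum fun x c => w.sum fun y d => c * d * overlapKernel ‖(x : ℂ) - (y : ℂ)‖) =
      ∑ x : w.support, ∑ y : w.support, w x * w y *
        overlapKernel ‖((x : K) : ℂ) - ((y : K) : ℂ)‖ := by
    simp only [Finsupp.sum]
    rw [← Finset.sum_coe_sort]
    exact Finset.sum_congr rfl fun x _ => (Finset.sum_coe_sort w.support fun y =>
      w x * w y * overlapKernel ‖((x : K) : ℂ) - (y : ℂ)‖).symm
  rw [← e, ← h]
  refine integral_congr_ae ?_
  have : ∀ᵐ ω ∂P', ∀ x ∈ w.support, 𝒢 ω x = G x ω :=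
    (Finset.eventually_all _).mpr fun x _ => h𝒢 x
  filter_upwards [this] with ω hω
  rw [Finsupp.sum, Finsupp.sum, Finset.sum_congr rfl fun x hx => by rw [hω x hx]]

/-- Only the finite-dimensional laws of the chosen continuous version enter, so every realization of
the limit in C(K) has the same characteristic functions and is reached. -/
lemma tendstoInDistribution_continuousPath (hlaw : ∀ k, HasLaw (ζ k) stdComplexGaussian P)
    (hindep : iIndepFun ζ P) (z₀ : ℂ) {Ω' : Type*} [MeasurableSpace Ω'] {P' : Measure Ω'}
    [IsProbabilityMeasure P'] {G : ℂ → Ω' → ℝ} (hG : IsOverlapField G P') {𝒢 : Ω' → C(K, ℝ)}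
    (h𝒢 : ∀ ξ : K, (fun ω => 𝒢 ω ξ) =ᵐ[P'] G ξ) :
    TendstoInDistribution
      (fun (N : ℕ) (ω : Ω) => continuousPath K (fluctuation (fun k => ζ k ω) z₀ N))
      atTop 𝒢 (fun _ => P) P' := by
  have hm := aemeasurable_continuousPath_fluctuation (K := K) hlaw z₀
  have hm𝒢 : AEMeasurable 𝒢 P' := aemeasurable_continuousMap_of_eval fun ξ =>
    (hG.isGaussianProcess.aemeasurable ξ).congr (h𝒢 ξ).symm
  refine ⟨hm, hm𝒢, ?_⟩
  refine tendsto_of_tight_of_tendsto_eval ?_ fun w => ?_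
  · exact isTightMeasureSet_map_continuousPath hlaw hindep z₀ K
  have hcont : Continuous fun f : C(K, ℝ) =>
      Complex.exp (Complex.I * (w.sum fun x c => c * f x : ℝ)) := by
    have : Continuous fun f : C(K, ℝ) => ∑ x ∈ w.support, w x * f x :=
      continuous_finsetSum _ fun x _ => continuous_const.mul (continuous_eval_const x)
    change Continuous fun f : C(K, ℝ) =>
      Complex.exp (Complex.I * (∑ x ∈ w.support, w x * f x : ℝ))
    fun_prop
  simp only [ProbabilityMeasure.coe_mk]
  rw [integral_map hm𝒢 hcont.aestronglyMeasurable]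
  simp_rw [fun N => integral_map (hm N) hcont.aestronglyMeasurable]
  rw [hG.integral_exp_sum_version h𝒢]
  refine (tendsto_integral_exp_sum_fluctuation hlaw hindep z₀ (fun x : w.support => w x)
    fun x => ((x : K) : ℂ)).congr fun N => integral_congr_ae ?_
  filter_upwards [ae_continuous_fluctuation hlaw z₀] with ω hω
  have h : Continuous fun x : K => fluctuation (fun k => ζ k ω) z₀ N x :=
    (hω N).comp continuous_subtype_val
  rw [continuousPath, dif_pos h, Finsupp.sum]
  congr 3
  exact Finset.sum_coe_sort w.support fun x => w x * fluctuation (fun k => ζ k ω) z₀ N x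

end Convergence

end

end LandauCLT

end

theorem theorem2p4 {Ω : Type*} [MeasurableSpace Ω] (P : Measure Ω) [IsProbabilityMeasure P]
    (ζ : ℕ → Ω → ℂ) (hlaw : ∀ k, HasLaw (ζ k) LandauCLT.stdComplexGaussian P)
    (hindep : iIndepFun ζ P) (z₀ : ℂ) (K : TopologicalSpace.Compacts ℂ) :
    -- the closed form of the overlap kernel
    (∀ r : ℝ, 0 ≤ r → r ≤ 2 → LandauCLT.overlapKernel r =
      2 / Real.pi * Real.arccos (r / 2) - r / Real.pi * Real.sqrt (1 - r ^ 2 / 4)) ∧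
    (∀ r : ℝ, 2 ≤ r → LandauCLT.overlapKernel r = 0) ∧
    -- the limit process exists
    (∃ (Ω' : Type) (_ : MeasurableSpace Ω') (P' : Measure Ω') (G : ℂ → Ω' → ℝ),
      IsProbabilityMeasure P' ∧ LandauCLT.IsOverlapField G P') ∧
    -- the fluctuation fields have continuous paths
    (∀ᵐ ω ∂P, ∀ N : ℕ, 1 ≤ N → Continuous (LandauCLT.fluctuation (fun k => ζ k ω) z₀ N)) ∧
    (∀ (Ω' : Type*) [MeasurableSpace Ω'] (P' : Measure Ω') [IsProbabilityMeasure P']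
      (G : ℂ → Ω' → ℝ), LandauCLT.IsOverlapField G P' →
      -- the limit process has versions with Hölder paths on `K`
      (∀ α : ℝ≥0, 0 < α → (α : ℝ) < 1 / 2 →
        ∃ G' : ℂ → Ω' → ℝ, (∀ ξ, G' ξ =ᵐ[P'] G ξ) ∧
          ∀ ω, MemHolder α (fun x : K => G' x ω)) ∧
      -- convergence in distribution in `C(K)` to the limit process, realized in `C(K)`
      (∀ 𝒢 : Ω' → C(K, ℝ), (∀ ξ : K, (fun ω => 𝒢 ω ξ) =ᵐ[P'] G ξ) →
        TendstoInDistribution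
          (fun (N : ℕ) (ω : Ω) =>
            LandauCLT.continuousPath K (LandauCLT.fluctuation (fun k => ζ k ω) z₀ N))
          atTop 𝒢 (fun _ => P) P')) ∧
    -- tightness in `C^{0,α}(K)`
    (∀ α : ℝ≥0, 0 < α → (α : ℝ) < 1 / 2 →
      (∀ᵐ ω ∂P, ∀ N : ℕ, 1 ≤ N →
        MemHolder α (fun x : K => LandauCLT.fluctuation (fun k => ζ k ω) z₀ N x)) ∧
      (∀ N : ℕ, 1 ≤ N → AEMeasurable (fun ω =>
        LandauCLT.holderPath K α (LandauCLT.fluctuation (fun k => ζ k ω) z₀ N)) P) ∧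
      IsTightMeasureSet ((fun N : ℕ => P.map (fun ω =>
        LandauCLT.holderPath K α (LandauCLT.fluctuation (fun k => ζ k ω) z₀ N))) ''
          Set.Ici 1)) := by
  refine ⟨fun r h0 h2 => LandauCLT.overlapKernel_eq h0 h2,
    fun r hr => LandauCLT.overlapKernel_of_two_le hr, LandauCLT.exists_isOverlapField,
    (LandauCLT.ae_continuous_fluctuation hlaw z₀).mono fun _ h N _ => h N,
    fun Ω' _ P' _ G hG => ⟨fun α hα0 hα => ?_, fun 𝒢 h𝒢 =>
      LandauCLT.tendstoInDistribution_continuousPath hlaw hindep z₀ hG h𝒢⟩,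
    fun α hα0 hα => ⟨(LandauCLT.ae_memHolder_fluctuation hlaw hindep z₀ K hα0 hα).mono
        fun _ h N _ => h N,
      fun N _ => LandauCLT.aemeasurable_holderPath_fluctuation hlaw hindep z₀ hα0 hα N,
      (LandauCLT.isTightMeasureSet_map_holderPath hlaw hindep z₀ K hα0 hα).subset
        (Set.image_subset_range _ _)⟩⟩
  exact LandauCLT.exists_memHolder_version (fun ξ => hG.isGaussianProcess.aemeasurable ξ)
    (fun p hp => ⟨4 * (2 * p).factorial * 32 ^ p, by positivity,
      fun ξ η => hG.lintegral_sub_pow_le ξ η hp⟩) K hα0 hα
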